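/- **Model.** Let $M,N\ge 1$, $[m]=\{0,\dots,m-1\}$, $\omega_N=e^{2\pi i/N}$. A hybrid algorithm with $q$ quantum and $c$ classical queries has a memory with basis states $|x,p,w\rangle$, $x\in[M]$ (index), $p\in[N]$ (phase), $w\in\{0,1\}^s$ (workspace, $s$ arbitrary), and a history register with $c$ slots, each empty or holding a pair in $[M]\times[N]$. It starts in $|0,0,0\rangle$ with empty history and applies $U_{c+q}\,O_{\lambda(c+q)}\,U_{c+q-1}\cdots U_1\,O_{\lambda(1)}\,U_0$, where the $U_t$ are arbitrary unitaries on the memory and $\lambda$ marks exactly $q$ of the $c+q$ queries as quantum. With oracle $F:[M]\to[N]$, a quantum query maps $|x,p,w\rangle|H\rangle\mapsto\omega_N^{pF(x)}|x,p,w\rangle|H\rangle$, and a classical query maps $|x,p,w\rangle|H\rangle\mapsto\omega_N^{pF(x)}|x,p,w\rangle|H'\rangle$, where $H'$ is $H$ with $(x,F(x))$ written in the leftmost empty slot. At the end the workspace is measured in the computational basis and a pair in $[M]^2$ is computed from the outcome. The algorithm succeeds if this pair $(x,y)$ is a collision, i.e. $x\ne y$ and $F(x)=F(y)$; its success probability is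 over the measurement and a uniformly random $F:[M]\to[N]$. **Theorem.** The optimal success probability of a hybrid algorithm with $q$ quantum and $c$ classical queries for finding a collision of a uniformly random function $F:[M]\to[N]$ is $\Theta\big((c^2+cq^2+q^3)/N\big)$, in the following sense. 1. (Upper bound.) There is an absolute constant $C>0$ such that for all $M,N\ge1$, all $s,c,q\ge 0$ with $c+q\ge 1$, every such algorithm has success probability at most $$C\cdot\frac{c^2+cq^2+q^3}{N}.$$ 2. (Matching algorithm.) There is an absolute constant $\kappa>0$ such that for all $M\ge2$, $N\ge1$ and $c,q\ge0$ with either $N^2\le M^3$, or $c\le M$ and $q^2\le M$, there are an $s$ and such an algorithm with success probability at least $$\kappa\cdot\min\Big(1,\ \frac{c^2+cq^2+q^3}{N}\Big).$$ Moreover, this algorithm can be chosen of the following form. All $c$ classical queries come first. The first $k=c+\lfloor q/2\rfloor$ queries (of which the last $\lfloor q/2\rfloor$ are quantum queries used as classical ones) are made at fixed indices $\xi_0,\dots,\xi_{k-1}$ (the index register is in the basis state $|\xi_t\rangle$ before query number $t+1$), of which the first $\min(k,M)$ are distinct. Then, for some $r$ with $2r\le q-\lfloor q/2\rfloor$, it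 runs $r$ iterations of Grover search on the index register, with two quantum queries per iteration, starting from the uniform superposition over $[M]$, where $x$ is marked if $(\xi_j,x)$ is a collision for some $j<k$: for every $F$ and $0\le i\le r$, the state after $k+2i$ queries is the tensor product of the $i$-th Grover iterate on the index register and a state of the remaining registers that does not depend on $i$. -/

import Mathlib

open scoped BigOperators Matrix

noncomputable section

namespace HybridOracle

/-- Basis states `(x, p, w)` of the memory of an algorithm with oracle access to a function
`[M] → [N]`: an index `x`, a phase value `p`, and a workspace of `s` bits. -/
abbrev Memory (M N s : ℕ) : Type := Fin M × Fin N × (Fin s → Bool)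

/-- Basis states of the history register: `c` slots, each of which is empty (`none`) or stores
a pair `(x, y)`. -/
abbrev History (M N c : ℕ) : Type := Fin c → Option (Fin M × Fin N)

/-- Write the pair `e` into the leftmost empty slot of the history. (An algorithm makes exactly
`c` classical queries, so there always is an empty slot when this is used on a reachable state.) -/
def History.record {M N c : ℕ} (H : History M N c) (e : Fin M × Fin N) : History M N c :=
  fun i => if H i = none ∧ ∀ j, j < i → H j ≠ none then some e else H i

/-- Joint basis states of the memory and the history register. -/
abbrev Joint (M N s c : ℕ) : Type := Memory M N s × History M N c

/-- The phase `ω_N ^ (p * y)` with `ω_N = exp (2 π i / N)`. -/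
def phase (N : ℕ) (p y : Fin N) : ℂ :=
  Complex.exp (2 * Real.pi * Complex.I / N) ^ ((p : ℕ) * (y : ℕ))

/-- Quantum query to `D`: `|x, p, w⟩ |H⟩ ↦ ω_N ^ (p * D x) |x, p, w⟩ |H⟩`. -/
def quantumOracle {M N : ℕ} (s c : ℕ) (D : Fin M → Fin N) :
    Matrix (Joint M N s c) (Joint M N s c) ℂ :=
  Matrix.diagonal fun b => phase N b.1.2.1 (D b.1.1)

/-- Classical query to `D`: the same phase is applied, and the pair `(x, D x)` is appended to the
history register, `|x, p, w⟩ |H⟩ ↦ ω_N ^ (p * D x) |x, p, w⟩ |H, (x, D x)⟩`. -/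
def classicalOracle {M N : ℕ} (s c : ℕ) (D : Fin M → Fin N) :
    Matrix (Joint M N s c) (Joint M N s c) ℂ :=
  Matrix.of fun b' b =>
    if b' = (b.1, b.2.record (b.1.1, D b.1.1)) then phase N b.1.2.1 (D b.1.1) else 0

/-- The two kinds of queries. -/
inductive QueryKind : Type
  | classical : QueryKind
  | quantum : QueryKind
  deriving DecidableEq

/-- The oracle operator for a query of the given kind. -/
def oracle {M N : ℕ} (s c : ℕ) (D : Fin M → Fin N) :
    QueryKind → Matrix (Joint M N s c) (Joint M N s c) ℂ
  | QueryKind.classical => classicalOracle s c D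
  | QueryKind.quantum => quantumOracle s c D

/-- A hybrid algorithm with `c` classical and `q` quantum queries to a function `[M] → [N]`, a
workspace of `s` qubits, and output in `[M] × [M]`: unitaries `U 0, …, U (c + q)` on the memory,
kinds `kind 1, …, kind (c + q)` of the queries, exactly `q` of which are quantum, and the
decoding of the output from a computational-basis measurement of the workspace. The values of
`U` and `kind` outside of these ranges play no role. -/
structure HybridAlgorithm (M N s c q : ℕ) where
  U : ℕ → Matrix.unitaryGroup (Memory M N s) ℂ
  kind : ℕ → QueryKind
  card_quantum : ((Finset.Icc 1 (c + q)).filter fun t => kind t = QueryKind.quantum).card = q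
  output : (Fin s → Bool) → Fin M × Fin M

namespace HybridAlgorithm

variable {M N s c q : ℕ}

/-- The unitary `U t`, extended by the identity on the history register. -/
def extU (A : HybridAlgorithm M N s c q) (t : ℕ) : Matrix (Joint M N s c) (Joint M N s c) ℂ :=
  Matrix.kronecker (A.U t : Matrix (Memory M N s) (Memory M N s) ℂ)
    (1 : Matrix (History M N c) (History M N c) ℂ)

/-- The state of memory and history, with oracle `D`, after `t` queries:
`U t * O (kind t) * ⋯ * U 1 * O (kind 1) * U 0` applied to `|0, 0, 0⟩` with empty history. -/
def state [NeZero M] [NeZero N] (A : HybridAlgorithm M N s c q) (D : Fin M → Fin N) :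
    ℕ → Joint M N s c → ℂ
  | 0 => A.extU 0 *ᵥ Pi.single ((0, 0, fun _ => false), fun _ => none) 1
  | t + 1 => A.extU (t + 1) *ᵥ (oracle s c D (A.kind (t + 1)) *ᵥ state A D t)

end HybridAlgorithm

/-- `(x, y)` is a collision of `D`. -/
abbrev IsCollision {M N : ℕ} (D : Fin M → Fin N) (z : Fin M × Fin M) : Prop :=
  z.1 ≠ z.2 ∧ D z.1 = D z.2

namespace HybridAlgorithm

variable {M N s c q : ℕ}

/-- Probability that the output of the algorithm, run with oracle `D`, is a collision of `D`. -/
def successProbOn [NeZero M] [NeZero N] (A : HybridAlgorithm M N s c q)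
    (D : Fin M → Fin N) : ℝ :=
  ∑ b : Joint M N s c, if IsCollision D (A.output b.1.2.2) then ‖A.state D (c + q) b‖ ^ 2 else 0

/-- Probability that the algorithm outputs a collision of a uniformly random `D : [M] → [N]`. -/
def successProb [NeZero M] [NeZero N] (A : HybridAlgorithm M N s c q) : ℝ :=
  (∑ D : Fin M → Fin N, A.successProbOn D) / (N : ℝ) ^ M

end HybridAlgorithm

/-- One Grover iteration on the index register with marked set `G`: flip the sign of the marked
entries, then reflect about the uniform superposition. -/
def groverIteration {M : ℕ} (G : Finset (Fin M)) (f : Fin M → ℂ) : Fin M → ℂ :=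
  fun x => 2 * ((∑ y, if y ∈ G then -f y else f y) / M) - (if x ∈ G then -f x else f x)

/-- The indices that form a collision with one of the sampled indices `ξ 0, …, ξ (k - 1)`. -/
def collidingWith {M N : ℕ} (D : Fin M → Fin N) (ξ : ℕ → Fin M) (k : ℕ) : Finset (Fin M) :=
  Finset.univ.filter fun x => ∃ j < k, IsCollision D (ξ j, x)

/-- The algorithm first makes all its `c` classical queries. Its first `k = c + ⌊q / 2⌋` queries
are made at fixed indices `ξ 0, …, ξ (k - 1)`, distinct as long as there are unused indices left.
Then, for some `r`, it uses `2 * r` of the remaining queries to perform `r` Grover iterations,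
started from the uniform superposition over all indices, in which the marked indices are those
that form a collision with a sampled index; meanwhile the rest of the joint state
is left as it was at the start of the search, up to intermediate computation within an iteration. -/
def HybridAlgorithm.SamplesThenGrover {M N s c q : ℕ} [NeZero M] [NeZero N]
    (A : HybridAlgorithm M N s c q) : Prop :=
  (∀ t ∈ Finset.Icc 1 c, A.kind t = QueryKind.classical) ∧
  ∃ ξ : ℕ → Fin M,
    (∀ i j, i < j → j < c + q / 2 → j < M → ξ i ≠ ξ j) ∧
    (∀ D : Fin M → Fin N, ∀ t < c + q / 2, ∀ b : Joint M N s c,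
      A.state D t b ≠ 0 → b.1.1 = ξ t) ∧
    ∃ r : ℕ, c + q / 2 + 2 * r ≤ c + q ∧
      ∀ D : Fin M → Fin N, ∃ χ : Fin N → (Fin s → Bool) → History M N c → ℂ,
        ∀ i ≤ r, ∀ x p w H,
          A.state D (c + q / 2 + 2 * i) ((x, p, w), H) =
            ((groverIteration (collidingWith D ξ (c + q / 2)))^[i]
              (fun _ => ((1 / Real.sqrt M : ℝ) : ℂ))) x * χ p w H

end HybridOracle

end

set_option linter.unusedSectionVars false

/-! Upper bound. The algorithm is run on all oracles at once, as a superposition over functions, and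
each coordinate of the function is compressed: the uniform superposition over values becomes an
empty entry and its orthogonal complement is kept. Indices recorded in the history form the known
set `K` and stay uncompressed. Every query adds at most one entry to the database, so the entry it
changes can agree with at most `c + q` stored values, and the mass sent onto such a value is of
order `1 / N`.

A quantum query adds this to the collision part in amplitude. Splitting squares with `(1 + η)` and
`(1 + 1 / η)`, where `η = 1 / (q + 1)`, the `q` quantum queries together add `q² (c + q) / N` up to
a constant (`potential_mul_le`). A classical query should only add probabilities, but turning a
compressed coordinate into a known one mixes amplitudes too and may double the mass on collisions;
over `c` queries this would be exponential. The cure is to count collisions with `weight`: 4, 2 or 1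
according to whether two, one or none of the colliding indices are unknown. Making an index known at
least halves the excess weight (`weight_insert_update_le`), which pays for the doubling, so a
classical query costs only an additive `(c + q) / N` (`potential_insert_le`). At the end the two
output indices are decompressed, which turns the expected weight into a success probability
(`sum_collision_le`).

Matching algorithm. With `k = c + ⌊q / 2⌋` sampled values, either a collision is sought among the
samples, or the remaining queries search by Grover for an index colliding with a sample. The first
has probability of order `k² / N` by the second moment method (`sum_exists_equal_ge`); the second
gains a factor `(2 r + 1)²` over one random guess, as long as there are not too many marked indices
(`sum_groverSuccess_ge`). Together with a blind guess of probability `1 / N`, taking the largest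
admissible `r` matches the upper bound in every case. -/

namespace HybridOracle

/-! ### Compressing coordinates of a superposition over functions. -/

section Compression

variable {X Y : Type*} [Fintype X] [DecidableEq X] [Fintype Y] [DecidableEq Y]

/-- A sum over all functions into `Option α` can be taken over the functions vanishing at `x`
and the value at `x`. -/
theorem sum_eq_sum_update {ι α β : Type*} [Fintype ι] [DecidableEq ι] [Fintype α] [DecidableEq α]
    [AddCommMonoid β] (x : ι) (F : (ι → Option α) → β) :
    ∑ d, F d = ∑ d : ι → Option α with d x = none, ∑ o, F (Function.update d x o) := by
  rw [← Finset.sum_fiberwise_of_maps_to (s := Finset.univ)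
    (t := Finset.univ.filter fun d : ι → Option α => d x = none)
    (g := fun d => Function.update d x none) (by simp)]
  refine Finset.sum_congr rfl fun d hd => ?_
  have hd : d x = none := by simpa using hd
  refine Finset.sum_nbij' (fun e => e x) (fun o => Function.update d x o) (by simp) ?_ ?_ (by simp) ?_
  · intro o _
    simp [← hd]
  · intro e he
    have he : Function.update e x none = d := by simpa using he
    simp [← he]
  · intro e he
    have he : Function.update e x none = d := by simpa using he
    simp [← he]

/-- Matrix entries of the isometry which sends the uniform superposition over `Y` to `none`, and
is the projection to its orthogonal complement on the remaining coordinates. -/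
noncomputable def uniformKernel : Option Y → Y → ℂ
  | none, _ => 1 / (Real.sqrt (Fintype.card Y) : ℂ)
  | some y', y => (if y' = y then 1 else 0) - 1 / (Fintype.card Y : ℂ)

/-- Matrix entries of the inclusion of the superpositions over `Y`. -/
def pointKernel : Option Y → Y → ℂ
  | none, _ => 0
  | some y', y => if y' = y then 1 else 0

/-- The amplitude at the database `d` of the superposition `f` over functions, where the
values at the indices in `K` are kept and those at the other indices are compressed. -/
noncomputable def databaseAmp (K : Finset X) (f : (X → Y) → ℂ) (d : X → Option Y) : ℂ :=
  ∑ D : X → Y, (∏ x, (if x ∈ K then pointKernel else uniformKernel) (d x) (D x)) * f D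

/-- The kernel is a product over coordinates, so one coordinate can be compressed with the others
left alone. All estimates for a single query reduce to one fiber through this identity. -/
theorem databaseAmp_update (K : Finset X) {x : X} (hx : x ∉ K) (f : (X → Y) → ℂ)
    (d : X → Option Y) (o : Option Y) :
    databaseAmp K f (Function.update d x o) =
      ∑ y, uniformKernel o y * databaseAmp (insert x K) f (Function.update d x (some y)) := by
  unfold databaseAmp
  simp_rw [Finset.mul_sum]
  rw [Finset.sum_comm]
  refine Finset.sum_congr rfl fun D _ => ?_
  have h1 : ∀ (L : Finset X) (o : Option Y),
      ∏ z, (if z ∈ L then pointKernel else uniformKernel) (Function.update d x o z) (D z) =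
      (if x ∈ L then pointKernel else uniformKernel) o (D x) *
      ∏ z ∈ Finset.univ.erase x, (if z ∈ L then pointKernel else uniformKernel) (d z) (D z) := by
    intro L o
    rw [← Finset.mul_prod_erase _ _ (Finset.mem_univ x)]
    congr 1
    · simp
    · refine Finset.prod_congr rfl fun z hz => ?_
      rw [Function.update_of_ne (Finset.ne_of_mem_erase hz)]
  have h2 : ∏ z ∈ Finset.univ.erase x,
        (if z ∈ insert x K then pointKernel else uniformKernel) (d z) (D z) =
      ∏ z ∈ Finset.univ.erase x, (if z ∈ K then pointKernel else uniformKernel) (d z) (D z) := by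
    refine Finset.prod_congr rfl fun z hz => ?_
    simp [Finset.ne_of_mem_erase hz]
  simp_rw [h1, h2]
  simp only [hx, if_false, Finset.mem_insert_self, if_true, pointKernel]
  simp only [ite_mul, one_mul, zero_mul, mul_ite, mul_zero]
  simp [mul_assoc]

theorem databaseAmp_eq_zero_of_none (K : Finset X) {x : X} (hx : x ∈ K) (f : (X → Y) → ℂ)
    (d : X → Option Y) (hd : d x = none) : databaseAmp K f d = 0 := by
  unfold databaseAmp
  refine Finset.sum_eq_zero fun D _ => ?_
  rw [Finset.prod_eq_zero (Finset.mem_univ x), zero_mul]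
  simp [hx, hd, pointKernel]

/-- Multiplication by a function of the value at `x ∈ K` acts diagonally on databases. -/
theorem databaseAmp_mul (K : Finset X) {x : X} (hx : x ∈ K) (h : Y → ℂ) (f : (X → Y) → ℂ)
    (d : X → Option Y) {y : Y} (hd : d x = some y) :
    databaseAmp K (fun D => h (D x) * f D) d = h y * databaseAmp K f d := by
  unfold databaseAmp
  rw [Finset.mul_sum]
  refine Finset.sum_congr rfl fun D _ => ?_
  by_cases hy : y = D x
  · rw [hy]; ring
  · rw [Finset.prod_eq_zero (Finset.mem_univ x)]
    · simp
    · simp [hx, hd, pointKernel, hy]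

/-- Multiplication by a function of the values at `a, b ∈ K` acts diagonally on databases. -/
theorem databaseAmp_mul₂ (K : Finset X) {a b : X} (ha : a ∈ K) (hb : b ∈ K) (h : Y → Y → ℂ)
    (f : (X → Y) → ℂ) (d : X → Option Y) {y z : Y} (hd : d a = some y) (hd' : d b = some z) :
    databaseAmp K (fun D => h (D a) (D b) * f D) d = h y z * databaseAmp K f d := by
  unfold databaseAmp
  rw [Finset.mul_sum]
  refine Finset.sum_congr rfl fun D _ => ?_
  by_cases hy : y = D a
  · by_cases hz : z = D b
    · rw [hy, hz]; ring
    · rw [Finset.prod_eq_zero (Finset.mem_univ b)]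
      · simp
      · simp [hb, hd', pointKernel, hz]
  · rw [Finset.prod_eq_zero (Finset.mem_univ a)]
    · simp
    · simp [ha, hd, pointKernel, hy]

theorem databaseAmp_sum {κ : Type*} (s : Finset κ) (K : Finset X) (u : κ → ℂ)
    (f : κ → (X → Y) → ℂ) (d : X → Option Y) :
    databaseAmp K (fun D => ∑ i ∈ s, u i * f i D) d = ∑ i ∈ s, u i * databaseAmp K (f i) d := by
  unfold databaseAmp
  simp_rw [Finset.mul_sum]
  rw [Finset.sum_comm]
  exact Finset.sum_congr rfl fun i _ => Finset.sum_congr rfl fun D _ => by ring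

theorem databaseAmp_zero (K : Finset X) (d : X → Option Y) :
    databaseAmp K (fun _ : X → Y => 0) d = 0 := by simp [databaseAmp]

theorem sqrt_card_mul_self {Y : Type*} [Fintype Y] :
    (Real.sqrt (Fintype.card Y) : ℂ) * (Real.sqrt (Fintype.card Y) : ℂ) = Fintype.card Y := by
  rw [← Complex.ofReal_mul, Real.mul_self_sqrt (by positivity)]; simp

theorem sum_uniformKernel_none (g : Y → ℂ) :
    ∑ y, uniformKernel none y * g y = (∑ y, g y) / (Real.sqrt (Fintype.card Y) : ℂ) := by
  simp only [uniformKernel, Finset.sum_div]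
  exact Finset.sum_congr rfl fun y _ => by ring

theorem sum_uniformKernel_some (g : Y → ℂ) (z : Y) :
    ∑ y, uniformKernel (some z) y * g y = g z - (∑ y, g y) / (Fintype.card Y : ℂ) := by
  simp only [uniformKernel, sub_mul, Finset.sum_sub_distrib]
  simp only [ite_mul, one_mul, zero_mul, Finset.sum_ite_eq, Finset.mem_univ, if_true,
    Finset.sum_div]
  congr 1
  exact Finset.sum_congr rfl fun y _ => by ring

/-- Inversion of the compression: centred part plus mean. The mean is read off from `none` with a
factor `1 / √|Y|`, which is where each `1 / N` in decompression steps comes from. -/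
theorem eq_add_sum_uniformKernel (g : Y → ℂ) (z : Y) :
    g z = ∑ y, uniformKernel (some z) y * g y
      + (∑ y, uniformKernel none y * g y) / (Real.sqrt (Fintype.card Y) : ℂ) := by
  rw [sum_uniformKernel_none, sum_uniformKernel_some, div_div, sqrt_card_mul_self]
  ring

theorem sum_option_databaseAmp (K : Finset X) {x : X} (hx : x ∈ K) (f : (X → Y) → ℂ)
    (d : X → Option Y) (w : Option Y → ℝ) :
    ∑ o, w o * ‖databaseAmp K f (Function.update d x o)‖ ^ 2 =
      ∑ y, w (some y) * ‖databaseAmp K f (Function.update d x (some y))‖ ^ 2 := by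
  rw [Fintype.sum_option, databaseAmp_eq_zero_of_none K hx f _ (by simp)]
  simp

variable [Nonempty Y]

theorem norm_sq_sum_uniformKernel_none (g : Y → ℂ) :
    ‖∑ y, uniformKernel none y * g y‖ ^ 2 =
      (Fintype.card Y : ℝ) * ‖(∑ y, g y) / (Fintype.card Y : ℂ)‖ ^ 2 := by
  have hN : (0 : ℝ) < Fintype.card Y := by exact_mod_cast Fintype.card_pos
  rw [sum_uniformKernel_none, norm_div, norm_div, div_pow, div_pow, Complex.norm_real,
    Complex.norm_natCast, Real.norm_eq_abs, sq_abs, Real.sq_sqrt hN.le]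
  field_simp

/-- Pythagoras: `none` carries the component along the uniform vector, the other entries the
component orthogonal to it. The compression is an isometry but not onto, which suffices for upper
bounds. -/
theorem parseval_uniformKernel (g : Y → ℂ) :
    ∑ o, ‖∑ y, uniformKernel o y * g y‖ ^ 2 = ∑ y, ‖g y‖ ^ 2 := by
  have hN : (Fintype.card Y : ℂ) ≠ 0 := by exact_mod_cast Fintype.card_ne_zero
  rw [Fintype.sum_option, norm_sq_sum_uniformKernel_none]
  simp_rw [sum_uniformKernel_some]
  set m : ℂ := (∑ y, g y) / (Fintype.card Y : ℂ) with hm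
  have hs : ∑ y, g y = Fintype.card Y * m := by rw [hm]; field_simp
  have h : ∀ z, ‖g z - m‖ ^ 2 = ‖g z‖ ^ 2 - 2 * (g z * (starRingEnd ℂ) m).re + ‖m‖ ^ 2 := by
    intro z
    rw [← Complex.normSq_eq_norm_sq, ← Complex.normSq_eq_norm_sq, ← Complex.normSq_eq_norm_sq,
      Complex.normSq_sub]
    ring
  simp_rw [h]
  rw [Finset.sum_add_distrib, Finset.sum_sub_distrib, ← Finset.mul_sum, ← Complex.re_sum,
    ← Finset.sum_mul, hs, mul_assoc, Complex.mul_conj, Complex.normSq_eq_norm_sq]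
  simp only [Finset.sum_const, Finset.card_univ, nsmul_eq_mul]
  rw [← Complex.ofReal_natCast, ← Complex.ofReal_mul, Complex.ofReal_re]
  ring

/-- Compressing a coordinate preserves the norm. -/
theorem sum_norm_sq_databaseAmp_insert (K : Finset X) {x : X} (hx : x ∉ K) (f : (X → Y) → ℂ)
    (d : X → Option Y) :
    ∑ o, ‖databaseAmp K f (Function.update d x o)‖ ^ 2 =
      ∑ y, ‖databaseAmp (insert x K) f (Function.update d x (some y))‖ ^ 2 := by
  simp_rw [databaseAmp_update K hx]
  exact parseval_uniformKernel _

/-- Coordinates are compressed one by one, by induction on the complement of `K`. With nothing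
compressed, the databases in the support are the total functions. -/
theorem sum_norm_sq_databaseAmp (K : Finset X) (f : (X → Y) → ℂ) :
    ∑ d, ‖databaseAmp K f d‖ ^ 2 = ∑ D, ‖f D‖ ^ 2 := by
  have key : ∀ L : Finset X, ∑ d, ‖databaseAmp Lᶜ f d‖ ^ 2 =
      ∑ d, ‖databaseAmp (Finset.univ : Finset X) f d‖ ^ 2 := by
    intro L
    induction L using Finset.induction_on with
    | empty => simp
    | insert x L hx ih =>
      rw [← ih]
      have h : insert x (insert x L)ᶜ = Lᶜ := by
        ext z; by_cases hz : z = x <;> simp [hz, hx]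
      rw [sum_eq_sum_update x, sum_eq_sum_update x]
      refine Finset.sum_congr rfl fun d _ => ?_
      rw [sum_norm_sq_databaseAmp_insert _ (by simp), h]
      have := sum_option_databaseAmp Lᶜ (x := x) (by simpa using hx) f d (fun _ => 1)
      simpa using this.symm
  have := key Kᶜ
  rw [compl_compl] at this
  rw [this]
  have hval : ∀ D : X → Y, databaseAmp Finset.univ f (fun x => some (D x)) = f D := by
    intro D
    unfold databaseAmp
    rw [Finset.sum_eq_single D]
    · simp [pointKernel]
    · intro D' _ hD'
      obtain ⟨x, hx⟩ := Function.ne_iff.1 hD'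
      rw [Finset.prod_eq_zero (Finset.mem_univ x), zero_mul]
      simp [pointKernel, hx.symm]
    · simp
  symm
  refine Finset.sum_of_injOn (fun D x => some (D x)) ?_ (by simp) ?_ ?_
  · intro D _ D' _ h
    funext x
    simpa using congrFun h x
  · intro d _ hd
    have : ∃ x, d x = none := by
      by_contra hcon
      push Not at hcon
      refine hd ⟨fun x => (d x).get (Option.isSome_iff_ne_none.2 (hcon x)), by simp, ?_⟩
      simp
    obtain ⟨x, hx⟩ := this
    rw [databaseAmp_eq_zero_of_none _ (Finset.mem_univ x) f d hx]
    simp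
  · intro D _
    rw [hval]

end Compression

/-! ### The collision weight and its change at one index. -/

section Weight

variable {X Y : Type*}

/-- The database contains a pair of equal values at two indices, of which the second one is not
in `L` and the first one is not in `K`. -/
def CollisionOutside (K L : Finset X) (d : X → Option Y) : Prop :=
  ∃ a b y, a ≠ b ∧ a ∉ K ∧ b ∉ L ∧ d a = some y ∧ d b = some y

open Classical in
/-- The weight of a database with known indices `K`: it is `4` if there is a collision between
unknown indices, otherwise `2` if there is one between a known and an unknown index, otherwise `1` if
there is one between known indices, and otherwise `0`. -/
noncomputable def weight (K : Finset X) (d : X → Option Y) : ℝ :=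
  (if CollisionOutside ∅ ∅ d then 1 else 0) + (if CollisionOutside ∅ K d then 1 else 0)
    + (if CollisionOutside K K d then 2 else 0)

theorem CollisionOutside.mono {K K' L L' : Finset X} (h : K' ⊆ K) (h' : L' ⊆ L) {d : X → Option Y} :
    CollisionOutside K L d → CollisionOutside K' L' d := by
  rintro ⟨a, b, y, hab, ha, hb, hda, hdb⟩
  exact ⟨a, b, y, hab, fun h1 => ha (h h1), fun h1 => hb (h' h1), hda, hdb⟩

theorem weight_nonneg (K : Finset X) (d : X → Option Y) : 0 ≤ weight K d := by
  unfold weight; positivity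

theorem weight_le_four (K : Finset X) (d : X → Option Y) : weight K d ≤ 4 := by
  unfold weight; split_ifs <;> norm_num

theorem one_le_weight (K : Finset X) {d : X → Option Y} {a b : X} (hab : a ≠ b) {y : Y}
    (ha : d a = some y) (hb : d b = some y) : 1 ≤ weight K d := by
  unfold weight
  rw [if_pos ⟨a, b, y, hab, by simp, by simp, ha, hb⟩]
  split_ifs <;> norm_num

variable [DecidableEq X]

theorem collisionOutside_update_iff {K L : Finset X} {d : X → Option Y} {x : X} (hd : d x = none)
    (y : Y) : CollisionOutside K L (Function.update d x (some y)) ↔ CollisionOutside K L d ∨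
      (x ∉ K ∧ ∃ a, a ∉ L ∧ d a = some y) ∨ (x ∉ L ∧ ∃ a, a ∉ K ∧ d a = some y) := by
  have hne : ∀ {a z}, d a = some z → a ≠ x := by
    rintro a z h rfl; simp [hd] at h
  constructor
  · rintro ⟨a, b, z, hab, ha, hb, hda, hdb⟩
    by_cases hax : a = x
    · subst hax
      have hz : y = z := by simpa using hda
      rw [Function.update_of_ne hab.symm] at hdb
      exact Or.inr (Or.inl ⟨ha, b, hb, hz ▸ hdb⟩)
    · rw [Function.update_of_ne hax] at hda
      by_cases hbx : b = x
      · subst hbx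
        have hz : y = z := by simpa using hdb
        exact Or.inr (Or.inr ⟨hb, a, ha, hz ▸ hda⟩)
      · rw [Function.update_of_ne hbx] at hdb
        exact Or.inl ⟨a, b, z, hab, ha, hb, hda, hdb⟩
  · rintro (⟨a, b, z, hab, ha, hb, hda, hdb⟩ | ⟨hx, a, ha, hda⟩ | ⟨hx, a, ha, hda⟩)
    · exact ⟨a, b, z, hab, ha, hb, by rwa [Function.update_of_ne (hne hda)],
        by rwa [Function.update_of_ne (hne hdb)]⟩
    · exact ⟨x, a, y, (hne hda).symm, hx, ha, by simp, by rwa [Function.update_of_ne (hne hda)]⟩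
    · exact ⟨a, x, y, hne hda, ha, hx, by rwa [Function.update_of_ne (hne hda)], by simp⟩

theorem collisionOutside_insert_iff {K L : Finset X} {d : X → Option Y} {x : X} (hd : d x = none) :
    CollisionOutside K (insert x L) d ↔ CollisionOutside K L d := by
  refine ⟨CollisionOutside.mono subset_rfl (Finset.subset_insert _ _), ?_⟩
  rintro ⟨a, b, z, hab, ha, hb, hda, hdb⟩
  refine ⟨a, b, z, hab, ha, ?_, hda, hdb⟩
  simp only [Finset.mem_insert, not_or]
  exact ⟨by rintro rfl; simp [hd] at hdb, hb⟩

theorem collisionOutside_insert_left_iff {K L : Finset X} {d : X → Option Y} {x : X}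
    (hd : d x = none) : CollisionOutside (insert x K) L d ↔ CollisionOutside K L d := by
  refine ⟨CollisionOutside.mono (Finset.subset_insert _ _) subset_rfl, ?_⟩
  rintro ⟨a, b, z, hab, ha, hb, hda, hdb⟩
  refine ⟨a, b, z, hab, ?_, hb, hda, hdb⟩
  simp only [Finset.mem_insert, not_or]
  exact ⟨by rintro rfl; simp [hd] at hda, ha⟩

theorem weight_le_weight_update (K : Finset X) {d : X → Option Y} {x : X} (hd : d x = none) (y : Y) :
    weight K d ≤ weight K (Function.update d x (some y)) := by
  unfold weight
  have h : ∀ {K L : Finset X}, CollisionOutside K L d →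
      CollisionOutside K L (Function.update d x (some y)) :=
    fun h => (collisionOutside_update_iff hd y).2 (Or.inl h)
  gcongr ?_ + ?_ + ?_ <;> split_ifs with h1 h2 <;> first | exact absurd (h h1) h2 | norm_num

/-- An index with an empty entry takes part in no collision, so declaring it known does not change
the weight; filling it in afterwards can only create collisions. -/
theorem weight_le_weight_insert_update (K : Finset X) {d : X → Option Y} {x : X} (hd : d x = none)
    (y : Y) : weight K d ≤ weight (insert x K) (Function.update d x (some y)) := by
  refine le_trans (le_of_eq ?_) (weight_le_weight_update (insert x K) hd y)
  unfold weight
  rw [collisionOutside_insert_iff hd, collisionOutside_insert_iff hd,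
    collisionOutside_insert_left_iff hd]

theorem weight_update_eq (K : Finset X) {d : X → Option Y} {x : X} (hd : d x = none) {y : Y}
    (hy : ∀ a, d a ≠ some y) : weight K (Function.update d x (some y)) = weight K d := by
  have h : ∀ L L' : Finset X, CollisionOutside L L' (Function.update d x (some y)) ↔
      CollisionOutside L L' d := fun L L' => by
    rw [collisionOutside_update_iff hd]
    simp [hy]
  unfold weight
  rw [h, h, h]

/-- Making an index known at least halves the increase of the weight. -/
theorem weight_insert_update_le (K : Finset X) {d : X → Option Y} {x : X} (hx : x ∉ K)
    (hd : d x = none) (y : Y) :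
    2 * (weight (insert x K) (Function.update d x (some y)) - weight K d) ≤
      weight K (Function.update d x (some y)) - weight K d := by
  unfold weight
  rw [collisionOutside_update_iff hd, collisionOutside_update_iff hd,
    collisionOutside_update_iff hd, collisionOutside_update_iff hd,
    collisionOutside_update_iff hd, collisionOutside_insert_iff hd, collisionOutside_insert_iff hd,
    collisionOutside_insert_left_iff hd]
  have h1 : CollisionOutside K K d → CollisionOutside ∅ K d :=
    CollisionOutside.mono (by simp) subset_rfl
  have h2 : CollisionOutside ∅ K d → CollisionOutside ∅ ∅ d :=
    CollisionOutside.mono (by simp) (by simp)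
  have h3 : (∃ a, a ∉ insert x K ∧ d a = some y) ↔ ∃ a, a ∉ K ∧ d a = some y := by
    refine exists_congr fun a => and_congr_left fun ha => ?_
    simp only [Finset.mem_insert, not_or, and_iff_right_iff_imp]
    rintro _ rfl
    simp [hd] at ha
  have h4 : (∃ a, a ∉ K ∧ d a = some y) → ∃ a, d a = some y := fun ⟨a, _, h⟩ => ⟨a, h⟩
  rw [h3]
  classical
  simp only [hx, Finset.mem_insert_self, Finset.notMem_empty, not_false_eq_true, not_true_eq_false,
    true_and, false_and, or_false, or_self]
  by_cases c1 : CollisionOutside K K d <;> by_cases c2 : CollisionOutside ∅ K d <;>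
    by_cases c3 : CollisionOutside ∅ ∅ d <;>
    by_cases c4 : (∃ a, a ∉ K ∧ d a = some y) <;> by_cases c5 : (∃ a, d a = some y) <;>
    first
    | exact absurd (h1 c1) c2
    | exact absurd (h2 c2) c3
    | exact absurd (h4 c4) c5
    | (simp only [c1, c2, c3, c4, c5, if_true, if_false, true_or, or_true, or_self]; norm_num)

end Weight

/-! ### Estimates for a single coordinate. -/

section Fiber

variable {Y : Type*} [Fintype Y] [DecidableEq Y] [Nonempty Y]

/-- This is Parseval with every term except `none` dropped. -/
theorem norm_sq_average_le (g : Y → ℂ) :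
    ‖(∑ y, g y) / (Fintype.card Y : ℂ)‖ ^ 2 ≤ (∑ y, ‖g y‖ ^ 2) / Fintype.card Y := by
  have hN : (0 : ℝ) < Fintype.card Y := by exact_mod_cast Fintype.card_pos
  rw [le_div_iff₀ hN, mul_comm, ← norm_sq_sum_uniformKernel_none, ← parseval_uniformKernel]
  exact Finset.single_le_sum (f := fun o => ‖∑ y, uniformKernel o y * g y‖ ^ 2)
    (fun o _ => by positivity) (Finset.mem_univ none)

theorem norm_add_sq_le (u v : ℂ) {η : ℝ} (hη : 0 < η) :
    ‖u + v‖ ^ 2 ≤ (1 + η) * ‖u‖ ^ 2 + (1 + 1 / η) * ‖v‖ ^ 2 := by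
  have h1 : ‖u + v‖ ^ 2 ≤ (‖u‖ + ‖v‖) ^ 2 := by gcongr; exact norm_add_le u v
  have h2 : 0 ≤ (η * ‖u‖ - ‖v‖) ^ 2 / η := by positivity
  have h3 : (η * ‖u‖ - ‖v‖) ^ 2 / η = η * ‖u‖ ^ 2 - 2 * ‖u‖ * ‖v‖ + 1 / η * ‖v‖ ^ 2 := by
    field_simp; ring
  nlinarith

/-- Effect of a quantum query on one fiber; `S` is the set of values already stored elsewhere. Only
these values carry excess weight, and at each of them multiplication by a phase commutes with the
compression up to a difference of two averages, of squared size at most `4 / |Y|` times the mass. -/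
theorem sum_weight_phase_le (g h : Y → ℂ) (hh : ∀ y, ‖h y‖ = 1) (w : Option Y → ℝ) (S : Finset Y)
    (h0 : 0 ≤ w none) (hw : ∀ y, w none ≤ w (some y)) (hw4 : ∀ y, w (some y) ≤ 4)
    (hS : ∀ y, y ∉ S → w (some y) = w none) {η : ℝ} (hη : 0 < η) :
    ∑ o, w o * ‖∑ y, uniformKernel o y * (h y * g y)‖ ^ 2 ≤
      (1 + η) * (∑ o, w o * ‖∑ y, uniformKernel o y * g y‖ ^ 2)
        + (1 + 1 / η) * (16 / Fintype.card Y) * (S.card * ∑ y, ‖g y‖ ^ 2) := by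
  have hN : (0 : ℝ) < Fintype.card Y := by exact_mod_cast Fintype.card_pos
  -- The base weight multiplies the whole mass, which the phase preserves; only the excess over `S`
  -- needs an estimate.
  have hsplit : ∀ c : Option Y → ℂ, ∑ o, w o * ‖c o‖ ^ 2 =
      w none * ∑ o, ‖c o‖ ^ 2 + ∑ y ∈ S, (w (some y) - w none) * ‖c (some y)‖ ^ 2 := by
    intro c
    rw [Fintype.sum_option, Fintype.sum_option, mul_add, Finset.mul_sum, add_assoc,
      Finset.sum_subset (Finset.subset_univ S), ← Finset.sum_add_distrib]
    · congr 1
      exact Finset.sum_congr rfl fun y _ => by ring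
    · intro y _ hy
      rw [hS y hy]; ring
  rw [hsplit, hsplit, parseval_uniformKernel, parseval_uniformKernel]
  have hnorm : ∀ y, ‖h y * g y‖ = ‖g y‖ := fun y => by rw [norm_mul, hh, one_mul]
  simp_rw [hnorm]
  set G := ∑ y, ‖g y‖ ^ 2
  have hG : 0 ≤ G := by positivity
  have hterm : ∀ y ∈ S, (w (some y) - w none) *
      ‖∑ z, uniformKernel (some y) z * (h z * g z)‖ ^ 2 ≤
      (1 + η) * ((w (some y) - w none) * ‖∑ z, uniformKernel (some y) z * g z‖ ^ 2)
        + (1 + 1 / η) * (16 / Fintype.card Y) * G := by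
    intro y _
    have hdec : ∑ z, uniformKernel (some y) z * (h z * g z) =
        h y * ∑ z, uniformKernel (some y) z * g z +
        (h y * ((∑ y, g y) / (Fintype.card Y : ℂ)) -
          (∑ y, h y * g y) / (Fintype.card Y : ℂ)) := by
      rw [sum_uniformKernel_some, sum_uniformKernel_some]; ring
    have h1 := norm_sq_average_le g
    have h2 := norm_sq_average_le fun y => h y * g y
    simp_rw [hnorm] at h2
    have h3 := norm_add_sq_le (h y * ∑ z, uniformKernel (some y) z * g z)
      (h y * ((∑ y, g y) / (Fintype.card Y : ℂ)) -
          (∑ y, h y * g y) / (Fintype.card Y : ℂ)) hη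
    have h4 := norm_add_sq_le (h y * ((∑ y, g y) / (Fintype.card Y : ℂ)))
      (-((∑ y, h y * g y) / (Fintype.card Y : ℂ))) one_pos
    rw [← sub_eq_add_neg, norm_neg, norm_mul, hh, one_mul] at h4
    rw [← hdec, norm_mul, hh, one_mul] at h3
    set E := ‖h y * ((∑ y, g y) / (Fintype.card Y : ℂ)) -
          (∑ y, h y * g y) / (Fintype.card Y : ℂ)‖ ^ 2
    have h5 : E ≤ 4 * (G / Fintype.card Y) := by linarith
    have hd : 0 ≤ w (some y) - w none := sub_nonneg.2 (hw y)
    have hd4 : w (some y) - w none ≤ 4 := by linarith [hw4 y]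
    have hη' : 0 < 1 + 1 / η := by positivity
    have h6 : (w (some y) - w none) * E ≤ 4 * (4 * (G / Fintype.card Y)) :=
      mul_le_mul hd4 h5 (by positivity) (by norm_num)
    calc _ ≤ (w (some y) - w none) *
          ((1 + η) * ‖∑ z, uniformKernel (some y) z * g z‖ ^ 2 + (1 + 1 / η) * E) :=
          mul_le_mul_of_nonneg_left h3 hd
      _ = (1 + η) * ((w (some y) - w none) * ‖∑ z, uniformKernel (some y) z * g z‖ ^ 2)
          + (1 + 1 / η) * ((w (some y) - w none) * E) := by ring
      _ ≤ (1 + η) * ((w (some y) - w none) * ‖∑ z, uniformKernel (some y) z * g z‖ ^ 2)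
          + (1 + 1 / η) * (4 * (4 * (G / Fintype.card Y))) := by gcongr
      _ = _ := by ring
  have hsum := Finset.sum_le_sum hterm
  rw [Finset.sum_add_distrib, ← Finset.mul_sum, Finset.sum_const, nsmul_eq_mul] at hsum
  have : 0 ≤ η * (w none * G) := by positivity
  linarith

/-- Effect of decompression on one fiber, with weights `w` before and `v` after. Squaring the
inversion formula doubles the mass at a value; the hypothesis `hvw` that the excess weight is halved
cancels exactly this factor, so the main term keeps coefficient `1`. -/
theorem sum_weight_point_le (g : Y → ℂ) (w : Option Y → ℝ) (v : Y → ℝ) (S : Finset Y)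
    (hw4 : ∀ y, w (some y) ≤ 4) (h0 : 0 ≤ w none)
    (hv : ∀ y, w none ≤ v y) (hvw : ∀ y, 2 * (v y - w none) ≤ w (some y) - w none)
    (hS : ∀ y, y ∉ S → w (some y) = w none) :
    ∑ y, v y * ‖g y‖ ^ 2 ≤ ∑ o, w o * ‖∑ y, uniformKernel o y * g y‖ ^ 2
        + 4 / Fintype.card Y * (S.card * ∑ y, ‖g y‖ ^ 2) := by
  have hN : (0 : ℝ) < Fintype.card Y := by exact_mod_cast Fintype.card_pos
  set c : Option Y → ℂ := fun o => ∑ y, uniformKernel o y * g y with hc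
  set G := ∑ y, ‖g y‖ ^ 2 with hG
  have hpar : ‖c none‖ ^ 2 + ∑ y, ‖c (some y)‖ ^ 2 = G := by
    rw [hG, ← parseval_uniformKernel g, Fintype.sum_option]
  have hnone : ‖c none / (Real.sqrt (Fintype.card Y) : ℂ)‖ ^ 2 ≤ G / Fintype.card Y := by
    rw [norm_div, div_pow, Complex.norm_real, Real.norm_eq_abs, sq_abs, Real.sq_sqrt hN.le]
    gcongr
    have : 0 ≤ ∑ y, ‖c (some y)‖ ^ 2 := by positivity
    linarith
  have hterm : ∀ y ∈ S, (v y - w none) * ‖g y‖ ^ 2 ≤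
      (w (some y) - w none) * ‖c (some y)‖ ^ 2 + 4 * (G / Fintype.card Y) := by
    intro y _
    have h1 := norm_add_sq_le (c (some y)) (c none / (Real.sqrt (Fintype.card Y) : ℂ)) one_pos
    rw [← eq_add_sum_uniformKernel g y] at h1
    have h2 : 0 ≤ v y - w none := sub_nonneg.2 (hv y)
    calc (v y - w none) * ‖g y‖ ^ 2
        ≤ (v y - w none) * (2 * ‖c (some y)‖ ^ 2 + 2 * (G / Fintype.card Y)) := by
          gcongr; linarith
      _ = (2 * (v y - w none)) * ‖c (some y)‖ ^ 2
            + (2 * (v y - w none)) * (G / Fintype.card Y) := by ring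
      _ ≤ (w (some y) - w none) * ‖c (some y)‖ ^ 2 + 4 * (G / Fintype.card Y) := by
          gcongr ?_ * _ + ?_ * _
          · exact hvw y
          · linarith [hvw y, hw4 y]
  have hv0 : ∀ y, y ∉ S → v y = w none := fun y hy =>
    le_antisymm (by linarith [hvw y, hS y hy]) (hv y)
  have hL : ∑ y, v y * ‖g y‖ ^ 2 = w none * G + ∑ y ∈ S, (v y - w none) * ‖g y‖ ^ 2 := by
    rw [hG, Finset.mul_sum, Finset.sum_subset (Finset.subset_univ S), ← Finset.sum_add_distrib]
    · exact Finset.sum_congr rfl fun y _ => by ring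
    · intro y _ hy; rw [hv0 y hy]; ring
  have hR : ∑ o, w o * ‖c o‖ ^ 2 =
      w none * G + ∑ y ∈ S, (w (some y) - w none) * ‖c (some y)‖ ^ 2 := by
    rw [← hpar, Fintype.sum_option, mul_add, Finset.mul_sum, add_assoc,
      Finset.sum_subset (Finset.subset_univ S), ← Finset.sum_add_distrib]
    · congr 1
      exact Finset.sum_congr rfl fun y _ => by ring
    · intro y _ hy; rw [hS y hy]; ring
  have hsum := Finset.sum_le_sum hterm
  rw [Finset.sum_add_distrib, Finset.sum_const, nsmul_eq_mul] at hsum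
  rw [hL, hR]
  have : 4 / (Fintype.card Y : ℝ) * (S.card * G) = S.card * (4 * (G / Fintype.card Y)) := by ring
  linarith

theorem norm_sq_le_uniformKernel (g : Y → ℂ) (z : Y) :
    ‖g z‖ ^ 2 ≤ 2 * ‖∑ y, uniformKernel (some z) y * g y‖ ^ 2
      + 2 / Fintype.card Y * ∑ y, ‖g y‖ ^ 2 := by
  have hN : (0 : ℝ) < Fintype.card Y := by exact_mod_cast Fintype.card_pos
  have h1 := norm_add_sq_le (∑ y, uniformKernel (some z) y * g y)
    ((∑ y, uniformKernel none y * g y) / (Real.sqrt (Fintype.card Y) : ℂ)) one_pos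
  rw [← eq_add_sum_uniformKernel g z, norm_div, div_pow, Complex.norm_real, Real.norm_eq_abs,
    sq_abs, Real.sq_sqrt hN.le] at h1
  have h2 : ‖∑ y, uniformKernel none y * g y‖ ^ 2 ≤ ∑ y, ‖g y‖ ^ 2 := by
    rw [← parseval_uniformKernel]
    exact Finset.single_le_sum (f := fun o => ‖∑ y, uniformKernel o y * g y‖ ^ 2)
      (fun o _ => by positivity) (Finset.mem_univ none)
  calc _ ≤ _ := h1
    _ ≤ (1 + 1) * ‖∑ y, uniformKernel (some z) y * g y‖ ^ 2
        + (1 + 1 / 1) * ((∑ y, ‖g y‖ ^ 2) / Fintype.card Y) := by gcongr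
    _ = _ := by ring

end Fiber

/-! ### Database size and expected weight under queries. -/

section Potential

variable {X Y : Type*} [Fintype X] [DecidableEq X] [Fintype Y] [DecidableEq Y]

/-- The number of indices at which a database stores a value. -/
def databaseSize (d : X → Option Y) : ℕ := (Finset.univ.filter fun x => d x ≠ none).card

theorem databaseSize_le_of_imp {d d' : X → Option Y} (h : ∀ x, d x ≠ none → d' x ≠ none) :
    databaseSize d ≤ databaseSize d' :=
  Finset.card_le_card fun x hx => by simpa using h x (by simpa using hx)

theorem databaseSize_update_le (d : X → Option Y) (x : X) (o : Option Y) :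
    databaseSize (Function.update d x o) ≤ databaseSize d + 1 := by
  refine le_trans (Finset.card_le_card (t := insert x (Finset.univ.filter fun x => d x ≠ none)) ?_)
    (Finset.card_insert_le _ _)
  intro z hz
  by_cases h : z = x
  · simp [h]
  · simpa [h] using hz

theorem databaseSize_update_some_le (d : X → Option Y) (x : X) (o : Option Y) (y : Y) :
    databaseSize (Function.update d x o) ≤ databaseSize (Function.update d x (some y)) := by
  refine databaseSize_le_of_imp fun z hz => ?_
  by_cases h : z = x
  · simp [h]
  · simpa [h] using hz

/-- The values stored in a database. -/
def databaseValues (d : X → Option Y) : Finset Y := Finset.univ.filter fun y => ∃ a, d a = some y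

theorem mem_databaseValues {d : X → Option Y} {y : Y} :
    y ∈ databaseValues d ↔ ∃ a, d a = some y := by simp [databaseValues]

theorem card_databaseValues_le (d : X → Option Y) : (databaseValues d).card ≤ databaseSize d := by
  rw [← Finset.card_map ⟨some, Option.some_injective Y⟩]
  refine le_trans (Finset.card_le_card ?_)
    (Finset.card_image_le (s := Finset.univ.filter fun x => d x ≠ none) (f := d))
  intro o ho
  simp only [Finset.mem_map, mem_databaseValues, Function.Embedding.coeFn_mk] at ho
  obtain ⟨y, ⟨a, ha⟩, rfl⟩ := ho
  simp only [Finset.mem_image, Finset.mem_filter, Finset.mem_univ, true_and]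
  exact ⟨a, by simp [ha], ha⟩

/-- All databases in the support of `f` have size at most `n`. -/
def SizeBounded (K : Finset X) (f : (X → Y) → ℂ) (n : ℕ) : Prop :=
  ∀ d, databaseAmp K f d ≠ 0 → databaseSize d ≤ n

theorem SizeBounded.mono {K : Finset X} {f : (X → Y) → ℂ} {m n : ℕ} (h : SizeBounded K f m)
    (hmn : m ≤ n) : SizeBounded K f n := fun d hd => (h d hd).trans hmn

theorem sizeBounded_zero_fun (K : Finset X) (n : ℕ) : SizeBounded K (fun _ : X → Y => 0) n :=
  fun d hd => absurd (databaseAmp_zero K d) hd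

theorem SizeBounded.sum {κ : Type*} {s : Finset κ} {K : Finset X} {u : κ → ℂ}
    {f : κ → (X → Y) → ℂ} {n : ℕ} (h : ∀ i ∈ s, SizeBounded K (f i) n) :
    SizeBounded K (fun D => ∑ i ∈ s, u i * f i D) n := by
  intro d hd
  rw [databaseAmp_sum] at hd
  obtain ⟨i, hi, hne⟩ := Finset.exists_ne_zero_of_sum_ne_zero hd
  exact h i hi d (right_ne_zero_of_mul hne)

/-- Compressing a coordinate can only empty its entry, so the size does not grow. -/
theorem SizeBounded.of_insert {K : Finset X} {x : X} {f : (X → Y) → ℂ} {n : ℕ}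
    (h : SizeBounded (insert x K) f n) : SizeBounded K f n := by
  by_cases hx : x ∈ K
  · rwa [Finset.insert_eq_of_mem hx] at h
  intro d hd
  rw [← Function.update_eq_self x d, databaseAmp_update K hx] at hd
  obtain ⟨y, _, hne⟩ := Finset.exists_ne_zero_of_sum_ne_zero hd
  have := h _ (right_ne_zero_of_mul hne)
  refine le_trans ?_ this
  conv_lhs => rw [← Function.update_eq_self x d]
  exact databaseSize_update_some_le d x _ y

theorem SizeBounded.mul_of_mem {K : Finset X} {x : X} (hx : x ∈ K) {f : (X → Y) → ℂ} {n : ℕ}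
    (h : SizeBounded K f n) (u : Y → ℂ) : SizeBounded K (fun D => u (D x) * f D) n := by
  intro d hd
  rcases hdx : d x with _ | y
  · exact absurd (databaseAmp_eq_zero_of_none K hx _ d hdx) hd
  · rw [databaseAmp_mul K hx u f d hdx] at hd
    exact h d (right_ne_zero_of_mul hd)

variable [Nonempty Y]

/-- By the inversion formula, an amplitude after decompression comes from a nonzero compressed
amplitude in the same fiber, whose database contains `d`. Hence decompression adds at most the entry
at `x`. -/
theorem SizeBounded.size_le_of_ne_zero {K : Finset X} {x : X} (hx : x ∉ K) {f : (X → Y) → ℂ}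
    {n : ℕ} (h : SizeBounded K f n) {d : X → Option Y} (hd : d x = none) {y : Y}
    (hne : databaseAmp (insert x K) f (Function.update d x (some y)) ≠ 0) :
    databaseSize d ≤ n := by
  rw [eq_add_sum_uniformKernel
    (fun y => databaseAmp (insert x K) f (Function.update d x (some y))) y] at hne
  simp_rw [← databaseAmp_update K hx] at hne
  have : ∃ o, databaseAmp K f (Function.update d x o) ≠ 0 := by
    by_contra hcon
    push Not at hcon
    simp [hcon] at hne
  obtain ⟨o, ho⟩ := this
  refine le_trans (databaseSize_le_of_imp fun z hz => ?_) (h _ ho)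
  rwa [Function.update_of_ne (by rintro rfl; exact hz hd)]

theorem SizeBounded.insert {K : Finset X} {x : X} {f : (X → Y) → ℂ} {n : ℕ}
    (h : SizeBounded K f n) : SizeBounded (insert x K) f (n + 1) := by
  by_cases hx : x ∈ K
  · rw [Finset.insert_eq_of_mem hx]
    exact h.mono n.le_succ
  intro d hd
  rcases hdx : d x with _ | y
  · exact absurd (databaseAmp_eq_zero_of_none _ (Finset.mem_insert_self x K) _ d hdx) hd
  · have hup : d = Function.update (Function.update d x none) x (some y) := by
      simp [← hdx]
    rw [hup] at hd ⊢
    exact (databaseSize_update_le _ _ _).trans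
      (Nat.succ_le_succ (h.size_le_of_ne_zero hx (by simp) hd))

/-- The sum over functions factors over coordinates, and the factor at a filled entry is the centred
part of a constant, which vanishes. -/
theorem sizeBounded_const (u : ℂ) : SizeBounded ∅ (fun _ : X → Y => u) 0 := by
  intro d hd
  by_contra hcon
  have : ∃ x, d x ≠ none := by
    by_contra h
    push Not at h
    exact hcon (by simp [databaseSize, h])
  obtain ⟨x, hx⟩ := this
  obtain ⟨y, hy⟩ := Option.ne_none_iff_exists'.1 hx
  apply hd
  unfold databaseAmp
  simp only [Finset.notMem_empty, if_false]
  rw [← Finset.sum_mul]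
  have h := (Finset.prod_univ_sum (fun _ : X => (Finset.univ : Finset Y))
    (fun x y => uniformKernel (d x) y)).symm
  rw [Fintype.piFinset_univ] at h
  rw [h, Finset.prod_eq_zero (Finset.mem_univ x), zero_mul]
  have hN : (Fintype.card Y : ℂ) ≠ 0 := by exact_mod_cast Fintype.card_ne_zero
  have := sum_uniformKernel_some (fun _ : Y => (1 : ℂ)) y
  simp only [mul_one] at this
  rw [hy, this]
  simp [hN]

/-- The potential of a superposition: the expected weight of its database. -/
noncomputable def potential (K : Finset X) (f : (X → Y) → ℂ) : ℝ :=
  ∑ d, weight K d * ‖databaseAmp K f d‖ ^ 2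

theorem potential_nonneg (K : Finset X) (f : (X → Y) → ℂ) : 0 ≤ potential K f :=
  Finset.sum_nonneg fun d _ => mul_nonneg (weight_nonneg K d) (by positivity)

theorem potential_zero (K : Finset X) : potential K (fun _ : X → Y => 0) = 0 := by
  simp [potential, databaseAmp_zero]

theorem potential_mul_of_mem (K : Finset X) {x : X} (hx : x ∈ K) (f : (X → Y) → ℂ) (h : Y → ℂ)
    (hh : ∀ y, ‖h y‖ = 1) : potential K (fun D => h (D x) * f D) = potential K f := by
  refine Finset.sum_congr rfl fun d _ => ?_
  rcases hdx : d x with _ | y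
  · rw [databaseAmp_eq_zero_of_none K hx _ d hdx, databaseAmp_eq_zero_of_none K hx _ d hdx]
  · rw [databaseAmp_mul K hx h f d hdx, norm_mul, hh, one_mul]

/-- Recording the value at a known index preserves the potential. -/
theorem sum_potential_point (K : Finset X) {x : X} (hx : x ∈ K) (f : (X → Y) → ℂ) (h : Y → ℂ)
    (hh : ∀ y, ‖h y‖ = 1) :
    ∑ y, potential K (fun D => (if D x = y then h (D x) else 0) * f D) = potential K f := by
  unfold potential
  rw [Finset.sum_comm]
  refine Finset.sum_congr rfl fun d _ => ?_
  rw [← Finset.mul_sum]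
  congr 1
  rcases hdx : d x with _ | z
  · rw [databaseAmp_eq_zero_of_none K hx _ d hdx]
    simp [databaseAmp_eq_zero_of_none K hx _ d hdx]
  · have : ∀ y, databaseAmp K (fun D => (if D x = y then h (D x) else 0) * f D) d =
        (if z = y then h z else 0) * databaseAmp K f d := fun y =>
      databaseAmp_mul K hx (fun z => if z = y then h z else 0) f d hdx
    simp_rw [this, norm_mul, mul_pow]
    rw [Finset.sum_eq_single z]
    · simp [hh]
    · intro y _ hy; simp [hy.symm]
    · simp

/-- On a fiber that carries amplitude the rest of the database has at most `n` entries, hence at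
most `n` values to collide with; the masses of the fibers add up to the total. -/
theorem sum_fiber_le {K : Finset X} {x : X} (hx : x ∉ K) {f : (X → Y) → ℂ}
    {n : ℕ} (h : SizeBounded K f n) :
    ∑ d : X → Option Y with d x = none, ((databaseValues d).card : ℝ) *
      ∑ y, ‖databaseAmp (insert x K) f (Function.update d x (some y))‖ ^ 2 ≤
      n * ∑ D, ‖f D‖ ^ 2 := by
  rw [← sum_norm_sq_databaseAmp K f, sum_eq_sum_update x, Finset.mul_sum]
  refine Finset.sum_le_sum fun d hd => ?_
  have hd : d x = none := by simpa using hd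
  rw [sum_norm_sq_databaseAmp_insert K hx]
  by_cases hz : ∃ y, databaseAmp (insert x K) f (Function.update d x (some y)) ≠ 0
  · obtain ⟨y, hy⟩ := hz
    have hle := (card_databaseValues_le d).trans (h.size_le_of_ne_zero hx hd hy)
    exact mul_le_mul_of_nonneg_right (Nat.cast_le.2 hle) (Finset.sum_nonneg fun y _ => sq_nonneg _)
  · push Not at hz
    simp [hz]

/-- A quantum query increases the potential by a constant factor close to `1` and a
small constant. -/
theorem potential_mul_le {K : Finset X} (x : X) {f : (X → Y) → ℂ} {n : ℕ} (hn : SizeBounded K f n)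
    (h : Y → ℂ) (hh : ∀ y, ‖h y‖ = 1) {η : ℝ} (hη : 0 < η) :
    potential K (fun D => h (D x) * f D) ≤ (1 + η) * potential K f +
      (1 + 1 / η) * (16 * n / Fintype.card Y) * ∑ D, ‖f D‖ ^ 2 := by
  have hN : (0 : ℝ) < Fintype.card Y := by exact_mod_cast Fintype.card_pos
  by_cases hx : x ∈ K
  · rw [potential_mul_of_mem K hx f h hh]
    have h1 := mul_nonneg hη.le (potential_nonneg K f)
    have h2 : 0 ≤ (1 + 1 / η) * (16 * n / Fintype.card Y) * ∑ D, ‖f D‖ ^ 2 := by positivity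
    linarith
  unfold potential
  rw [sum_eq_sum_update x, sum_eq_sum_update x, Finset.mul_sum]
  have hfib := mul_le_mul_of_nonneg_left (sum_fiber_le hx hn)
    (show 0 ≤ (1 + 1 / η) * (16 / Fintype.card Y) by positivity)
  rw [Finset.mul_sum] at hfib
  refine le_trans ?_ (add_le_add_right (hfib.trans (le_of_eq (by ring))) _)
  rw [← Finset.sum_add_distrib]
  refine Finset.sum_le_sum fun d hd => ?_
  have hd : d x = none := by simpa using hd
  have hdu : Function.update d x none = d := by rw [← hd, Function.update_eq_self]
  simp_rw [databaseAmp_update K hx]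
  have hphase : ∀ y, databaseAmp (insert x K) (fun D => h (D x) * f D)
      (Function.update d x (some y)) =
      h y * databaseAmp (insert x K) f (Function.update d x (some y)) := fun y =>
    databaseAmp_mul _ (Finset.mem_insert_self x K) h f _ (by simp)
  simp_rw [hphase]
  refine sum_weight_phase_le _ h hh (fun o => weight K (Function.update d x o))
    (databaseValues d)
    (weight_nonneg _ _) (fun y => ?_) (fun y => weight_le_four _ _) (fun y hy => ?_) hη
  · simp only [hdu]; exact weight_le_weight_update K hd y
  · simp only [hdu]
    exact weight_update_eq K hd (by simpa [mem_databaseValues] using hy)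

/-- Making an index known increases the potential by a small constant. -/
theorem potential_insert_le {K : Finset X} (x : X) {f : (X → Y) → ℂ} {n : ℕ}
    (hn : SizeBounded K f n) :
    potential (insert x K) f ≤ potential K f + 4 * n / Fintype.card Y * ∑ D, ‖f D‖ ^ 2 := by
  have hN : (0 : ℝ) < Fintype.card Y := by exact_mod_cast Fintype.card_pos
  by_cases hx : x ∈ K
  · rw [Finset.insert_eq_of_mem hx]
    have : 0 ≤ 4 * n / Fintype.card Y * ∑ D, ‖f D‖ ^ 2 := by positivity
    linarith
  unfold potential
  rw [sum_eq_sum_update x, sum_eq_sum_update x]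
  have hfib := mul_le_mul_of_nonneg_left (sum_fiber_le hx hn)
    (show (0 : ℝ) ≤ 4 / Fintype.card Y by positivity)
  rw [Finset.mul_sum] at hfib
  refine le_trans ?_ (add_le_add_right (hfib.trans (le_of_eq (by ring))) _)
  rw [← Finset.sum_add_distrib]
  refine Finset.sum_le_sum fun d hd => ?_
  have hd : d x = none := by simpa using hd
  have hdu : Function.update d x none = d := by rw [← hd, Function.update_eq_self]
  rw [sum_option_databaseAmp _ (Finset.mem_insert_self x K) f d
    (fun o => weight (insert x K) (Function.update d x o))]
  simp_rw [databaseAmp_update K hx]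
  refine sum_weight_point_le _ (fun o => weight K (Function.update d x o))
    (fun y => weight (insert x K) (Function.update d x (some y))) (databaseValues d) (fun y => weight_le_four _ _)
    (weight_nonneg _ _) (fun y => ?_) (fun y => ?_) (fun y hy => ?_)
  · simp only [hdu]; exact weight_le_weight_insert_update K hd y
  · simp only [hdu]; exact weight_insert_update_le K hx hd y
  · simp only [hdu]; exact weight_update_eq K hd (by simpa [mem_databaseValues] using hy)

/-- The probability that the database has a collision at `a` and `b`. -/
noncomputable def collisionMass (K : Finset X) (a b : X) (f : (X → Y) → ℂ) : ℝ :=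
  ∑ d, if d a = d b ∧ d b ≠ none then ‖databaseAmp K f d‖ ^ 2 else 0

theorem collisionMass_comm (K : Finset X) (a b : X) (f : (X → Y) → ℂ) :
    collisionMass K a b f = collisionMass K b a f := by
  refine Finset.sum_congr rfl fun d _ => if_congr ?_ rfl rfl
  constructor <;> rintro ⟨h1, h2⟩ <;> exact ⟨h1.symm, by rwa [h1] at *⟩

theorem collisionMass_le_potential (K : Finset X) {a b : X} (hab : a ≠ b) (f : (X → Y) → ℂ) :
    collisionMass K a b f ≤ potential K f := by
  refine Finset.sum_le_sum fun d _ => ?_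
  split_ifs with h
  · obtain ⟨y, hy⟩ := Option.ne_none_iff_exists'.1 h.2
    have := one_le_weight K hab (h.1.trans hy) hy
    nlinarith [sq_nonneg ‖databaseAmp K f d‖]
  · exact mul_nonneg (weight_nonneg _ _) (by positivity)

/-- Once the entry at `b` is fixed, the event singles out one value at `a`. Decompressing there
costs a factor of two and a `2 / |Y|` share of the mass. -/
theorem collisionMass_insert_le (K : Finset X) {a b : X} (hab : a ≠ b) (f : (X → Y) → ℂ) :
    collisionMass (insert a K) a b f ≤
      2 * collisionMass K a b f + 2 / Fintype.card Y * ∑ D, ‖f D‖ ^ 2 := by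
  have hN : (0 : ℝ) < Fintype.card Y := by exact_mod_cast Fintype.card_pos
  have hnn : 0 ≤ collisionMass K a b f := Finset.sum_nonneg fun d _ => by positivity
  by_cases ha : a ∈ K
  · rw [Finset.insert_eq_of_mem ha]
    have : 0 ≤ 2 / Fintype.card Y * ∑ D, ‖f D‖ ^ 2 := by positivity
    linarith
  unfold collisionMass
  rw [← sum_norm_sq_databaseAmp K f, sum_eq_sum_update a, sum_eq_sum_update a,
    sum_eq_sum_update a (fun d => ‖databaseAmp K f d‖ ^ 2), Finset.mul_sum, Finset.mul_sum,
    ← Finset.sum_add_distrib]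
  refine Finset.sum_le_sum fun d hd => ?_
  rw [sum_norm_sq_databaseAmp_insert K ha]
  simp only [Function.update_self, Function.update_of_ne hab.symm]
  rcases hdb : d b with _ | z
  · simp
    positivity
  · simp only [ne_eq, reduceCtorEq, not_false_eq_true, and_true]
    rw [Finset.sum_ite_eq' (s := Finset.univ), Finset.sum_ite_eq' (s := Finset.univ),
      if_pos (Finset.mem_univ _), if_pos (Finset.mem_univ _), databaseAmp_update K ha]
    exact norm_sq_le_uniformKernel
      (fun y => databaseAmp (insert a K) f (Function.update d a (some y))) z

theorem sum_collision_eq_collisionMass {K : Finset X} {a b : X} (ha : a ∈ K) (hb : b ∈ K)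
    (f : (X → Y) → ℂ) : ∑ D, (if D a = D b then ‖f D‖ ^ 2 else 0) = collisionMass K a b f := by
  have h := sum_norm_sq_databaseAmp K (fun D => (if D a = D b then (1 : ℂ) else 0) * f D)
  have h1 : ∀ D, ‖(if D a = D b then (1 : ℂ) else 0) * f D‖ ^ 2 =
      if D a = D b then ‖f D‖ ^ 2 else 0 := fun D => by split_ifs <;> simp
  simp_rw [h1] at h
  rw [← h]
  refine Finset.sum_congr rfl fun d _ => ?_
  rcases hda : d a with _ | y
  · rw [databaseAmp_eq_zero_of_none K ha _ d hda, databaseAmp_eq_zero_of_none K ha _ d hda]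
    simp
  rcases hdb : d b with _ | z
  · rw [databaseAmp_eq_zero_of_none K hb _ d hdb, databaseAmp_eq_zero_of_none K hb _ d hdb]
    simp
  rw [databaseAmp_mul₂ K ha hb (fun y z => if y = z then (1 : ℂ) else 0) f d hda hdb]
  by_cases hyz : y = z <;> simp [hyz]

/-- The probability of a collision is bounded by the potential. -/
theorem sum_collision_le (K : Finset X) {a b : X} (hab : a ≠ b) (f : (X → Y) → ℂ) :
    ∑ D, (if D a = D b then ‖f D‖ ^ 2 else 0) ≤
      4 * potential K f + 6 / Fintype.card Y * ∑ D, ‖f D‖ ^ 2 := by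
  -- With both indices uncompressed, database collisions are true collisions. The two decompressions
  -- give `2 (2 P + 2 / N) + 2 / N = 4 P + 6 / N`, at unit mass.
  rw [sum_collision_eq_collisionMass (K := insert a (insert b K)) (by simp) (by simp)]
  have h1 := collisionMass_insert_le (insert b K) hab f
  have h2 := collisionMass_insert_le K hab.symm f
  rw [collisionMass_comm, collisionMass_comm K] at h2
  have h3 := collisionMass_le_potential K hab f
  have : 6 / (Fintype.card Y : ℝ) * ∑ D, ‖f D‖ ^ 2 =
    3 * (2 / (Fintype.card Y : ℝ) * ∑ D, ‖f D‖ ^ 2) := by ring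
  linarith

end Potential

/-! ### The purified run: histories, unitaries and queries. -/

section Dynamics

variable {M N s c q : ℕ}

/-- The indices recorded in a history. -/
def History.known (H : History M N c) : Finset (Fin M) :=
  Finset.univ.filter fun x => ∃ i y, H i = some (x, y)

/-- Exactly the first `j` slots of the history are filled. -/
def History.Filled (j : ℕ) (H : History M N c) : Prop := ∀ i : Fin c, H i ≠ none ↔ (i : ℕ) < j

/-- Reachable histories are filled from the left, so recording writes to a slot known in advance.
This makes it reversible and allows sums over histories to be reindexed. -/
theorem History.Filled.record_eq {j : ℕ} (hj : j < c) {H : History M N c} (hH : H.Filled j)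
    (e : Fin M × Fin N) : H.record e = Function.update H ⟨j, hj⟩ (some e) := by
  funext i
  unfold History.record
  by_cases hi : i = ⟨j, hj⟩
  · subst hi
    rw [if_pos, Function.update_self]
    refine ⟨?_, fun i hi => (hH i).2 hi⟩
    by_contra h
    exact lt_irrefl _ ((hH _).1 h)
  · rw [Function.update_of_ne hi, if_neg]
    rintro ⟨h1, h2⟩
    rcases lt_or_gt_of_ne (fun h => hi (Fin.ext h) : (i : ℕ) ≠ j) with h | h
    · exact (hH i).2 h h1
    · exact lt_irrefl j ((hH ⟨j, hj⟩).1 (h2 ⟨j, hj⟩ h))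

theorem History.filled_update_iff {j : ℕ} (hj : j < c) {H : History M N c} (hH : H ⟨j, hj⟩ = none)
    (e : Fin M × Fin N) :
    History.Filled (j + 1) (Function.update H ⟨j, hj⟩ (some e) : History M N c) ↔ H.Filled j := by
  refine forall_congr' fun i => ?_
  by_cases hi : i = ⟨j, hj⟩
  · subst hi; simp [hH]
  · have : (i : ℕ) ≠ j := fun h => hi (Fin.ext h)
    rw [Function.update_of_ne hi]
    refine iff_congr Iff.rfl ?_
    omega

theorem History.Filled.known_update {j : ℕ} (hj : j < c) {H : History M N c} (hH : H.Filled j)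
    (x : Fin M) (y : Fin N) :
    History.known (Function.update H ⟨j, hj⟩ (some (x, y)) : History M N c) =
      insert x H.known := by
  have hnone : H ⟨j, hj⟩ = none := by
    by_contra h
    exact lt_irrefl _ ((hH _).1 h)
  ext z
  simp only [History.known, Finset.mem_filter, Finset.mem_univ, true_and, Finset.mem_insert]
  constructor
  · rintro ⟨i, w, h⟩
    by_cases hi : i = ⟨j, hj⟩
    · subst hi; simp at h; exact Or.inl h.1.symm
    · rw [Function.update_of_ne hi] at h; exact Or.inr ⟨i, w, h⟩
  · rintro (rfl | ⟨i, w, h⟩)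
    · exact ⟨⟨j, hj⟩, y, by simp⟩
    · refine ⟨i, w, ?_⟩
      rwa [Function.update_of_ne]
      rintro rfl; simp [hnone] at h

open Classical in
theorem sum_history_eq {j : ℕ} (hj : j < c) (F : History M N c → ℝ)
    (hF : ∀ H, ¬ H.Filled (j + 1) → F H = 0) :
    ∑ H, F H = ∑ H : History M N c with H.Filled j,
      ∑ e, F (Function.update H ⟨j, hj⟩ (some e)) := by
  rw [sum_eq_sum_update (ι := Fin c) ⟨j, hj⟩]
  symm
  refine Finset.sum_subset_zero_on_sdiff ?_ ?_ ?_
  · intro H hH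
    have hH : H.Filled j := by simpa using hH
    simp only [Finset.mem_filter, Finset.mem_univ, true_and]
    by_contra h
    exact lt_irrefl _ ((hH _).1 h)
  · intro H hH
    simp only [Finset.mem_sdiff, Finset.mem_filter, Finset.mem_univ, true_and] at hH
    refine Finset.sum_eq_zero fun o _ => hF _ ?_
    rcases o with _ | e
    · intro h
      exact absurd ((h ⟨j, hj⟩).2 (Nat.lt_succ_self j)) (by simp)
    · rw [History.filled_update_iff hj hH.1]
      exact hH.2
  · intro H hH
    rw [Fintype.sum_option, hF _, zero_add]
    intro h
    exact absurd ((h ⟨j, hj⟩).2 (Nat.lt_succ_self j)) (by simp)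

theorem norm_phase (p y : Fin N) : ‖phase N p y‖ = 1 := by
  unfold phase
  rw [norm_pow]
  have : (2 * Real.pi * Complex.I / N : ℂ) = ((2 * Real.pi / N : ℝ) : ℂ) * Complex.I := by
    push_cast; ring
  rw [this, Complex.norm_exp_ofReal_mul_I, one_pow]

theorem quantumOracle_mulVec (D : Fin M → Fin N) (φ : Joint M N s c → ℂ) (m : Memory M N s)
    (H : History M N c) :
    (quantumOracle s c D *ᵥ φ) (m, H) = phase N m.2.1 (D m.1) * φ (m, H) := by
  simp [quantumOracle, Matrix.mulVec_diagonal]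

theorem classicalOracle_mulVec (D : Fin M → Fin N) (φ : Joint M N s c → ℂ) (m : Memory M N s)
    (H' : History M N c) :
    (classicalOracle s c D *ᵥ φ) (m, H') =
      ∑ H, if H' = H.record (m.1, D m.1) then phase N m.2.1 (D m.1) * φ (m, H) else 0 := by
  simp only [classicalOracle, Matrix.mulVec, dotProduct, Matrix.of_apply]
  rw [Fintype.sum_prod_type, Finset.sum_eq_single m]
  · refine Finset.sum_congr rfl fun H _ => ?_
    simp
  · intro m' _ hm
    refine Finset.sum_eq_zero fun H _ => ?_
    rw [if_neg, zero_mul]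
    rintro h
    exact hm (congrArg Prod.fst h).symm
  · simp

theorem classicalOracle_mulVec_eq_zero {j : ℕ} (hj : j < c) (D : Fin M → Fin N)
    (φ : Joint M N s c → ℂ) (hφ : ∀ m H, ¬ H.Filled j → φ (m, H) = 0) (m : Memory M N s)
    (H' : History M N c) (hH' : ¬ H'.Filled (j + 1)) : (classicalOracle s c D *ᵥ φ) (m, H') = 0 := by
  rw [classicalOracle_mulVec]
  refine Finset.sum_eq_zero fun H _ => ?_
  by_cases hH : H.Filled j
  · rw [if_neg]
    rintro rfl
    rw [hH.record_eq hj, History.filled_update_iff hj] at hH'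
    · exact hH' hH
    · by_contra h
      exact lt_irrefl _ ((hH _).1 h)
  · simp [hφ m H hH]

theorem classicalOracle_mulVec_update {j : ℕ} (hj : j < c) (D : Fin M → Fin N)
    (φ : Joint M N s c → ℂ) (hφ : ∀ m H, ¬ H.Filled j → φ (m, H) = 0) (m : Memory M N s)
    (H : History M N c) (hH : H.Filled j) (e : Fin M × Fin N) :
    (classicalOracle s c D *ᵥ φ) (m, Function.update H ⟨j, hj⟩ (some e)) =
      if e = (m.1, D m.1) then phase N m.2.1 (D m.1) * φ (m, H) else 0 := by
  have hnone : ∀ {G : History M N c}, G.Filled j → G ⟨j, hj⟩ = none := by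
    intro G hG
    by_contra h
    exact lt_irrefl _ ((hG _).1 h)
  rw [classicalOracle_mulVec, Finset.sum_eq_single H]
  · rw [hH.record_eq hj]
    refine if_congr ⟨fun h => ?_, fun h => by rw [h]⟩ rfl rfl
    simpa using congrFun h ⟨j, hj⟩
  · intro G _ hG
    by_cases hGf : G.Filled j
    · rw [if_neg]
      intro h
      rw [hGf.record_eq hj] at h
      apply hG
      funext i
      by_cases hi : i = ⟨j, hj⟩
      · rw [hi, hnone hH, hnone hGf]
      · have := congrFun h i
        rwa [Function.update_of_ne hi, Function.update_of_ne hi, eq_comm] at this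
    · simp [hφ m G hGf]
  · simp

theorem extU_mulVec (A : HybridAlgorithm M N s c q) (t : ℕ) (φ : Joint M N s c → ℂ)
    (m : Memory M N s) (H : History M N c) :
    (A.extU t *ᵥ φ) (m, H) = ∑ m', (A.U t : Matrix _ _ ℂ) m m' * φ (m', H) := by
  simp only [HybridAlgorithm.extU, Matrix.mulVec, dotProduct]
  rw [Fintype.sum_prod_type]
  refine Finset.sum_congr rfl fun m' _ => ?_
  rw [Finset.sum_eq_single H]
  · change _ * (1 : Matrix _ _ ℂ) H H * _ = _
    simp
  · intro H' _ hH'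
    change _ * (1 : Matrix _ _ ℂ) H H' * _ = _
    simp [Matrix.one_apply_ne hH'.symm]
  · simp

theorem sum_norm_sq_unitary {n : Type*} [Fintype n] [DecidableEq n] (U : Matrix.unitaryGroup n ℂ)
    (v : n → ℂ) : ∑ i, ‖∑ j, (U : Matrix n n ℂ) i j * v j‖ ^ 2 = ∑ i, ‖v i‖ ^ 2 := by
  have h : ∀ w : n → ℂ, ((∑ i, ‖w i‖ ^ 2 : ℝ) : ℂ) = star w ⬝ᵥ w := by
    intro w
    rw [dotProduct]
    push_cast
    refine Finset.sum_congr rfl fun i _ => ?_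
    rw [Pi.star_apply, Complex.star_def, Complex.conj_mul']
  have h2 : ∀ i, ∑ j, (U : Matrix n n ℂ) i j * v j = ((U : Matrix n n ℂ) *ᵥ v) i := fun i => rfl
  simp_rw [h2]
  apply Complex.ofReal_injective
  rw [h, h, Matrix.star_mulVec, ← Matrix.dotProduct_mulVec, Matrix.mulVec_mulVec,
    ← Matrix.star_eq_conjTranspose, Matrix.mem_unitaryGroup_iff'.1 U.2, Matrix.one_mulVec]

/-- A family of superpositions of oracles, one for each joint basis state. -/
abbrev Purification (M N s c : ℕ) : Type := Joint M N s c → (Fin M → Fin N) → ℂ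

/-- The sum of the squared norms. -/
noncomputable def Purification.mass (φ : Purification M N s c) : ℝ := ∑ H, ∑ m, ∑ D, ‖φ (m, H) D‖ ^ 2

/-- The sum of the potentials. -/
noncomputable def Purification.totalPotential (φ : Purification M N s c) : ℝ :=
  ∑ H, ∑ m, potential H.known (φ (m, H))

/-- The histories have `j` entries, and the databases have at most `n`. -/
structure Purification.Bounded (φ : Purification M N s c) (j n : ℕ) : Prop where
  filled : ∀ m H, ¬ H.Filled j → φ (m, H) = fun _ => 0
  size : ∀ m H, SizeBounded H.known (φ (m, H)) n

/-- Apply an operator depending on the oracle. -/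
def Purification.apply (T : (Fin M → Fin N) → Matrix (Joint M N s c) (Joint M N s c) ℂ)
    (φ : Purification M N s c) : Purification M N s c :=
  fun b D => (T D *ᵥ fun b' => φ b' D) b

theorem Purification.apply_extU (A : HybridAlgorithm M N s c q) (t : ℕ)
    (φ : Purification M N s c) (m : Memory M N s) (H : History M N c) :
    φ.apply (fun _ => A.extU t) (m, H) =
      fun D => ∑ m', (A.U t : Matrix _ _ ℂ) m m' * φ (m', H) D := by
  funext D
  exact extU_mulVec A t _ m H

theorem Purification.Bounded.apply_extU {φ : Purification M N s c} {j n : ℕ} (h : φ.Bounded j n)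
    (A : HybridAlgorithm M N s c q) (t : ℕ) : (φ.apply fun _ => A.extU t).Bounded j n where
  filled m H hH := by
    rw [Purification.apply_extU]
    funext D
    exact Finset.sum_eq_zero fun m' _ => by rw [h.filled m' H hH, mul_zero]
  size m H := by
    rw [Purification.apply_extU]
    exact SizeBounded.sum fun m' _ => h.size m' H

theorem Purification.mass_apply_extU (A : HybridAlgorithm M N s c q) (t : ℕ)
    (φ : Purification M N s c) : (φ.apply fun _ => A.extU t).mass = φ.mass := by
  refine Finset.sum_congr rfl fun H _ => ?_
  simp_rw [Purification.apply_extU]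
  rw [Finset.sum_comm, Finset.sum_comm (f := fun m D => ‖φ (m, H) D‖ ^ 2)]
  exact Finset.sum_congr rfl fun D _ => sum_norm_sq_unitary (A.U t) _

/-- The weight depends only on history and database, while the unitary acts on the memory for each
fixed pair of these. -/
theorem Purification.totalPotential_apply_extU (A : HybridAlgorithm M N s c q) (t : ℕ)
    (φ : Purification M N s c) :
    (φ.apply fun _ => A.extU t).totalPotential = φ.totalPotential := by
  refine Finset.sum_congr rfl fun H _ => ?_
  simp_rw [Purification.apply_extU]
  unfold potential
  rw [Finset.sum_comm, Finset.sum_comm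
    (f := fun m d => weight H.known d * ‖databaseAmp H.known (φ (m, H)) d‖ ^ 2)]
  refine Finset.sum_congr rfl fun d _ => ?_
  simp_rw [databaseAmp_sum, ← Finset.mul_sum]
  rw [sum_norm_sq_unitary]

theorem Purification.apply_quantumOracle (φ : Purification M N s c) (m : Memory M N s)
    (H : History M N c) :
    φ.apply (quantumOracle s c) (m, H) = fun D => phase N m.2.1 (D m.1) * φ (m, H) D := by
  funext D
  exact quantumOracle_mulVec D _ m H

variable [NeZero N]

theorem Purification.Bounded.apply_quantumOracle {φ : Purification M N s c} {j n : ℕ}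
    (h : φ.Bounded j n) : (φ.apply (quantumOracle s c)).Bounded j (n + 1) where
  filled m H hH := by
    rw [Purification.apply_quantumOracle]
    funext D
    rw [h.filled m H hH, mul_zero]
  size m H := by
    rw [Purification.apply_quantumOracle]
    exact ((h.size m H).insert.mul_of_mem (Finset.mem_insert_self m.1 _) _).of_insert

theorem Purification.mass_apply_quantumOracle (φ : Purification M N s c) :
    (φ.apply (quantumOracle s c)).mass = φ.mass := by
  unfold Purification.mass
  simp_rw [Purification.apply_quantumOracle, norm_mul, norm_phase, one_mul]

theorem Purification.totalPotential_apply_quantumOracle_le {φ : Purification M N s c} {j n : ℕ}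
    (h : φ.Bounded j n) {η : ℝ} (hη : 0 < η) :
    (φ.apply (quantumOracle s c)).totalPotential ≤
      (1 + η) * φ.totalPotential + (1 + 1 / η) * (16 * n / N) * φ.mass := by
  unfold Purification.totalPotential Purification.mass
  simp_rw [Finset.mul_sum, ← Finset.sum_add_distrib, ← Finset.mul_sum]
  refine Finset.sum_le_sum fun H _ => Finset.sum_le_sum fun m _ => ?_
  rw [Purification.apply_quantumOracle]
  have := potential_mul_le m.1 (h.size m H) (phase N m.2.1) (norm_phase _) hη
  rwa [Fintype.card_fin] at this

theorem Purification.apply_classicalOracle_update {φ : Purification M N s c} {j n : ℕ}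
    (h : φ.Bounded j n) (hj : j < c) (m : Memory M N s) {H : History M N c} (hH : H.Filled j)
    (e : Fin M × Fin N) :
    φ.apply (classicalOracle s c) (m, Function.update H ⟨j, hj⟩ (some e)) = if e.1 = m.1 then
      (fun D => (if D m.1 = e.2 then phase N m.2.1 (D m.1) else 0) * φ (m, H) D)
      else fun _ => 0 := by
  funext D
  unfold Purification.apply
  rw [classicalOracle_mulVec_update hj D _ (fun m H hH => by simp [h.filled m H hH]) m H hH]
  by_cases h1 : e.1 = m.1
  · by_cases h2 : D m.1 = e.2
    · simp [h1, h2, Prod.ext_iff]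
    · simp [h1, h2, Ne.symm h2, Prod.ext_iff]
  · simp [h1, Prod.ext_iff]

theorem Purification.apply_classicalOracle_eq_zero {φ : Purification M N s c} {j n : ℕ}
    (h : φ.Bounded j n) (hj : j < c) (m : Memory M N s) {H : History M N c}
    (hH : ¬ H.Filled (j + 1)) : φ.apply (classicalOracle s c) (m, H) = fun _ => 0 := by
  funext D
  exact classicalOracle_mulVec_eq_zero hj D _ (fun m H hH => by simp [h.filled m H hH]) m H hH

theorem Purification.Bounded.apply_classicalOracle {φ : Purification M N s c} {j n : ℕ}
    (h : φ.Bounded j n) (hj : j < c) :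
    (φ.apply (classicalOracle s c)).Bounded (j + 1) (n + 1) where
  filled m H hH := Purification.apply_classicalOracle_eq_zero h hj m hH
  size m H' := by
    by_cases hH' : H'.Filled (j + 1)
    · obtain ⟨e, he⟩ := Option.ne_none_iff_exists'.1 ((hH' ⟨j, hj⟩).2 (Nat.lt_succ_self j))
      set H : History M N c := Function.update H' ⟨j, hj⟩ none with hHdef
      have hup : H' = Function.update H ⟨j, hj⟩ (some e) := by
        simp [hHdef, ← he]
      have hH : H.Filled j := by
        rw [hup, History.filled_update_iff hj (by simp [hHdef])] at hH'
        exact hH'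
      rw [hup, Purification.apply_classicalOracle_update h hj m hH, hH.known_update hj]
      split_ifs with h1
      · rw [← h1]
        exact (h.size m H).insert.mul_of_mem (Finset.mem_insert_self _ _)
          (fun y => if y = e.2 then phase N m.2.1 y else 0)
      · exact sizeBounded_zero_fun _ _
    · rw [Purification.apply_classicalOracle_eq_zero h hj m hH']
      exact sizeBounded_zero_fun _ _

open Classical in
/-- Sums over the histories after a classical query, in terms of those before. -/
theorem Purification.sum_apply_classicalOracle {φ : Purification M N s c} {j n : ℕ}
    (h : φ.Bounded j n) (hj : j < c) (F : Finset (Fin M) → ((Fin M → Fin N) → ℂ) → ℝ)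
    (hF : ∀ K, F K (fun _ => 0) = 0) :
    ∑ H, ∑ m, F H.known (φ.apply (classicalOracle s c) (m, H)) =
      ∑ H : History M N c with H.Filled j, ∑ m : Memory M N s, ∑ y, F (insert m.1 H.known)
        (fun D => (if D m.1 = y then phase N m.2.1 (D m.1) else 0) * φ (m, H) D) := by
  rw [sum_history_eq hj]
  · refine Finset.sum_congr rfl fun H hH => ?_
    have hH : H.Filled j := by simpa using hH
    rw [Finset.sum_comm]
    refine Finset.sum_congr rfl fun m _ => ?_
    rw [Fintype.sum_prod_type, Finset.sum_eq_single m.1]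
    · refine Finset.sum_congr rfl fun y _ => ?_
      rw [Purification.apply_classicalOracle_update h hj m hH, hH.known_update hj, if_pos rfl]
    · intro x _ hx
      refine Finset.sum_eq_zero fun y _ => ?_
      rw [Purification.apply_classicalOracle_update h hj m hH, if_neg hx, hF]
    · simp
  · intro H hH
    refine Finset.sum_eq_zero fun m _ => ?_
    rw [Purification.apply_classicalOracle_eq_zero h hj m hH, hF]

open Classical in
theorem Purification.sum_filled {φ : Purification M N s c} {j n : ℕ}
    (h : φ.Bounded j n) (F : Finset (Fin M) → ((Fin M → Fin N) → ℂ) → ℝ)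
    (hF : ∀ K, F K (fun _ => 0) = 0) :
    ∑ H, ∑ m, F H.known (φ (m, H)) =
      ∑ H : History M N c with H.Filled j, ∑ m : Memory M N s, F H.known (φ (m, H)) := by
  rw [Finset.sum_filter]
  refine Finset.sum_congr rfl fun H _ => ?_
  split_ifs with hH
  · rfl
  · exact Finset.sum_eq_zero fun m _ => by rw [h.filled m H hH, hF]

theorem Purification.mass_apply_classicalOracle {φ : Purification M N s c} {j n : ℕ}
    (h : φ.Bounded j n) (hj : j < c) : (φ.apply (classicalOracle s c)).mass = φ.mass := by
  classical
  unfold Purification.mass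
  rw [Purification.sum_apply_classicalOracle h hj (fun _ f => ∑ D, ‖f D‖ ^ 2) (by simp),
    Purification.sum_filled h (fun _ f => ∑ D, ‖f D‖ ^ 2) (by simp)]
  refine Finset.sum_congr rfl fun H _ => Finset.sum_congr rfl fun m _ => ?_
  rw [Finset.sum_comm]
  refine Finset.sum_congr rfl fun D _ => ?_
  simp_rw [norm_mul, mul_pow, ← Finset.sum_mul]
  rw [Finset.sum_eq_single (D m.1)]
  · simp [norm_phase]
  · intro y _ hy; simp [hy.symm]
  · simp

/-- Different recorded pairs lie in orthogonal histories, so their contributions add without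
interference. Recording and phase are free at a known index; the whole cost is that of making the
index known. -/
theorem Purification.totalPotential_apply_classicalOracle_le {φ : Purification M N s c} {j n : ℕ}
    (h : φ.Bounded j n) (hj : j < c) :
    (φ.apply (classicalOracle s c)).totalPotential ≤
      φ.totalPotential + 4 * n / N * φ.mass := by
  classical
  unfold Purification.totalPotential Purification.mass
  rw [Purification.sum_apply_classicalOracle h hj potential potential_zero,
    Purification.sum_filled h potential potential_zero,
    Purification.sum_filled h (fun _ f => ∑ D, ‖f D‖ ^ 2) (by simp)]
  simp_rw [Finset.mul_sum, ← Finset.sum_add_distrib, ← Finset.mul_sum]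
  refine Finset.sum_le_sum fun H _ => Finset.sum_le_sum fun m _ => ?_
  rw [sum_potential_point (insert m.1 H.known) (Finset.mem_insert_self _ _) _ (phase N m.2.1)
    (norm_phase _)]
  have := potential_insert_le m.1 (h.size m H)
  rwa [Fintype.card_fin] at this

end Dynamics

/-! ### The upper bound on the success probability. -/

section UpperBound

variable {M N s c q : ℕ} [NeZero M] [NeZero N]

namespace HybridAlgorithm

/-- The number of queries of the given kind among the first `t`. -/
def queryCount (A : HybridAlgorithm M N s c q) (k : QueryKind) (t : ℕ) : ℕ :=
  ((Finset.Icc 1 t).filter fun i => A.kind i = k).card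

theorem queryCount_succ (A : HybridAlgorithm M N s c q) (k : QueryKind) (t : ℕ) :
    A.queryCount k (t + 1) = A.queryCount k t + if A.kind (t + 1) = k then 1 else 0 := by
  unfold queryCount
  rw [← Finset.insert_Icc_right_eq_Icc_add_one (by omega), Finset.filter_insert]
  split_ifs with h
  · rw [Finset.card_insert_of_notMem (by simp)]
  · rfl

theorem queryCount_mono (A : HybridAlgorithm M N s c q) (k : QueryKind) :
    Monotone (A.queryCount k) :=
  monotone_nat_of_le_succ fun t => by rw [queryCount_succ]; omega

theorem queryCount_add (A : HybridAlgorithm M N s c q) (t : ℕ) :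
    A.queryCount QueryKind.classical t + A.queryCount QueryKind.quantum t = t := by
  induction t with
  | zero => simp [queryCount]
  | succ t ih =>
    rw [queryCount_succ, queryCount_succ]
    cases A.kind (t + 1) <;> simp <;> omega

theorem queryCount_classical_le (A : HybridAlgorithm M N s c q) {t : ℕ} (ht : t ≤ c + q) :
    A.queryCount QueryKind.classical t ≤ c := by
  have h1 := A.queryCount_mono QueryKind.classical ht
  have h2 := A.queryCount_add (c + q)
  have h3 : A.queryCount QueryKind.quantum (c + q) = q := A.card_quantum
  omega

/-- The states of the algorithm with all oracles. -/
noncomputable def purification (A : HybridAlgorithm M N s c q) (t : ℕ) : Purification M N s c :=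
  fun b D => A.state D t b

theorem purification_succ (A : HybridAlgorithm M N s c q) (t : ℕ) :
    A.purification (t + 1) =
      ((A.purification t).apply fun D => oracle s c D (A.kind (t + 1))).apply
        fun _ => A.extU (t + 1) := rfl

/-- The superpositions before the first unitary. -/
noncomputable def initialPurification (M N s c : ℕ) [NeZero M] [NeZero N] : Purification M N s c :=
  fun b _ => (Pi.single ((0, 0, fun _ => false), fun _ => none) 1 : Joint M N s c → ℂ) b

theorem purification_zero (A : HybridAlgorithm M N s c q) :
    A.purification 0 = (initialPurification M N s c).apply fun _ => A.extU 0 := rfl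

theorem known_none : History.known (fun _ => none : History M N c) = ∅ := by
  simp [History.known]

theorem initialPurification_bounded : (initialPurification M N s c).Bounded 0 0 where
  filled m H hH := by
    funext D
    refine Pi.single_eq_of_ne ?_ _
    intro h
    apply hH
    have h : H = fun _ => none := congrArg Prod.snd h
    intro i
    simp [h]
  size m H := by
    by_cases h : H = fun _ => none
    · rw [h, known_none]
      exact sizeBounded_const _
    · have : initialPurification M N s c (m, H) = fun _ => 0 := by
        funext D
        refine Pi.single_eq_of_ne ?_ _
        intro h'
        exact h (congrArg Prod.snd h')
      rw [this]
      exact sizeBounded_zero_fun _ _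

theorem initialPurification_mass : (initialPurification M N s c).mass = (N : ℝ) ^ M := by
  unfold Purification.mass initialPurification
  rw [← Fintype.sum_prod_type_right' (f := fun m H => ∑ D : Fin M → Fin N,
    ‖(Pi.single ((0, 0, fun _ => false), fun _ => none) 1 : Joint M N s c → ℂ) (m, H)‖ ^ 2)]
  rw [Finset.sum_eq_single (((0, 0, fun _ => false), fun _ => none) : Joint M N s c)]
  · simp
  · intro b _ hb
    simp [Pi.single_eq_of_ne hb]
  · simp

theorem initialPurification_totalPotential :
    (initialPurification M N s c).totalPotential = 0 := by
  refine Finset.sum_eq_zero fun H _ => Finset.sum_eq_zero fun m _ => ?_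
  refine Finset.sum_eq_zero fun d _ => ?_
  by_cases hd : databaseAmp H.known (initialPurification M N s c (m, H)) d = 0
  · simp [hd]
  have h := initialPurification_bounded.size m H d hd
  have hd0 : ∀ x, d x = none := by
    intro x
    by_contra hx
    have : 0 < databaseSize d := Finset.card_pos.2 ⟨x, by simpa using hx⟩
    omega
  have : ∀ K L, ¬ CollisionOutside K L d := by
    rintro K L ⟨a, b, y, -, -, -, h, -⟩
    simp [hd0] at h
  simp [weight, this]

/-- The invariant of the run. Only quantum queries contribute the factor `1 + η`, so it is raised to
their number and not to `t`. The superposition over oracles is left unnormalised, whence the mass `N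
^ M`. -/
theorem purification_bounds (A : HybridAlgorithm M N s c q) {η : ℝ} (hη : 0 < η) (t : ℕ)
    (ht : t ≤ c + q) :
    (A.purification t).Bounded (A.queryCount QueryKind.classical t) t ∧
    (A.purification t).mass = (N : ℝ) ^ M ∧
    (A.purification t).totalPotential ≤ (1 + η) ^ (A.queryCount QueryKind.quantum t) *
      (A.queryCount QueryKind.quantum t * ((1 + 1 / η) * (16 * (c + q) / N)) +
        A.queryCount QueryKind.classical t * (4 * (c + q) / N)) * (N : ℝ) ^ M := by
  have hN : (0 : ℝ) < N := by exact_mod_cast Nat.pos_of_ne_zero (NeZero.ne N)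
  induction t with
  | zero =>
    rw [purification_zero]
    refine ⟨initialPurification_bounded.apply_extU A 0, ?_, ?_⟩
    · rw [Purification.mass_apply_extU, initialPurification_mass]
    · rw [Purification.totalPotential_apply_extU, initialPurification_totalPotential]
      positivity
  | succ t ih =>
    obtain ⟨hb, hm, hp⟩ := ih (by omega)
    have htc : (t : ℝ) ≤ c + q := by exact_mod_cast (by omega : t ≤ c + q)
    have hcl := A.queryCount_classical_le ht
    rw [purification_succ, Purification.mass_apply_extU, Purification.totalPotential_apply_extU]
    rw [queryCount_succ] at hcl ⊢
    rw [queryCount_succ]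
    cases hk : A.kind (t + 1) with
    | classical =>
      simp only [hk, if_true, reduceCtorEq, if_false, add_zero] at hcl ⊢
      have hj : A.queryCount QueryKind.classical t < c := by omega
      refine ⟨(hb.apply_classicalOracle hj).apply_extU A _, ?_, ?_⟩
      · exact (Purification.mass_apply_classicalOracle hb hj).trans hm
      · refine (Purification.totalPotential_apply_classicalOracle_le hb hj).trans ?_
        rw [hm]
        have h1 : (1 : ℝ) ≤ (1 + η) ^ (A.queryCount QueryKind.quantum t) :=
          one_le_pow₀ (by linarith)
        have h2 : 4 * (t : ℝ) / N * (N : ℝ) ^ M ≤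
            (1 + η) ^ (A.queryCount QueryKind.quantum t) *
              ((4 * (c + q) / N) * (N : ℝ) ^ M) := by
          refine le_trans ?_ (le_mul_of_one_le_left (by positivity) h1)
          gcongr
        push_cast
        calc _ ≤ _ := add_le_add hp h2
          _ = _ := by ring
    | quantum =>
      simp only [hk, if_true, reduceCtorEq, if_false, add_zero] at hcl ⊢
      refine ⟨hb.apply_quantumOracle.apply_extU A _, ?_, ?_⟩
      · exact (Purification.mass_apply_quantumOracle _).trans hm
      · refine (Purification.totalPotential_apply_quantumOracle_le hb hη).trans ?_
        rw [hm]
        have h1 : (1 : ℝ) ≤ (1 + η) ^ (A.queryCount QueryKind.quantum t + 1) :=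
          one_le_pow₀ (by linarith)
        have h2 : (1 + 1 / η) * (16 * (t : ℝ) / N) * (N : ℝ) ^ M ≤
            (1 + η) ^ (A.queryCount QueryKind.quantum t + 1) *
              ((1 + 1 / η) * (16 * (c + q) / N) * (N : ℝ) ^ M) := by
          refine le_trans ?_ (le_mul_of_one_le_left (by positivity) h1)
          gcongr
        have h3 := mul_le_mul_of_nonneg_left hp (by positivity : 0 ≤ 1 + η)
        push_cast
        calc _ ≤ _ := add_le_add h3 h2
          _ = _ := by ring

theorem sum_successProbOn_le (A : HybridAlgorithm M N s c q) :
    ∑ D, A.successProbOn D ≤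
      4 * (A.purification (c + q)).totalPotential + 6 / N * (A.purification (c + q)).mass := by
  have h : ∑ D, A.successProbOn D = ∑ H, ∑ m, ∑ D : Fin M → Fin N,
      if IsCollision D (A.output m.2.2) then ‖A.purification (c + q) (m, H) D‖ ^ 2 else 0 := by
    unfold successProbOn
    rw [Finset.sum_comm, Fintype.sum_prod_type, Finset.sum_comm]
    rfl
  rw [h]
  unfold Purification.totalPotential Purification.mass
  simp_rw [Finset.mul_sum, ← Finset.sum_add_distrib, ← Finset.mul_sum]
  refine Finset.sum_le_sum fun H _ => Finset.sum_le_sum fun m _ => ?_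
  set f := A.purification (c + q) (m, H)
  by_cases hz : (A.output m.2.2).1 = (A.output m.2.2).2
  · have := potential_nonneg H.known f
    have : 0 ≤ 4 * potential H.known f + 6 / N * ∑ D, ‖f D‖ ^ 2 := by positivity
    simpa [IsCollision, hz] using this
  · have := sum_collision_le H.known hz f
    rw [Fintype.card_fin] at this
    simpa [IsCollision, hz] using this

/-- The success probability of a hybrid algorithm for finding a collision is
`O((c ^ 2 + c * q ^ 2 + q ^ 3) / N)`. -/
theorem successProb_le (A : HybridAlgorithm M N s c q) (hcq : 1 ≤ c + q) :
    A.successProb ≤ 1000 * (((c : ℝ) ^ 2 + c * q ^ 2 + q ^ 3) / N) := by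
  have hN : (0 : ℝ) < N := by exact_mod_cast Nat.pos_of_ne_zero (NeZero.ne N)
  have hq1 : (0 : ℝ) < q + 1 := by positivity
  -- This `η` keeps `(1 + η) ^ q` below `e`, at the price `1 + 1 / η = q + 2` per quantum query; the
  -- shift by one covers `q = 0`.
  obtain ⟨-, hm, hp⟩ := A.purification_bounds (η := 1 / (q + 1)) (by positivity) (c + q) le_rfl
  have hQ : A.queryCount QueryKind.quantum (c + q) = q := A.card_quantum
  have hC : A.queryCount QueryKind.classical (c + q) = c := by
    have := A.queryCount_add (c + q)
    omega
  rw [hQ, hC, one_div_one_div] at hp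
  have hexp : (1 + 1 / ((q : ℝ) + 1)) ^ q ≤ 3 := by
    have h1 : 1 + 1 / ((q : ℝ) + 1) ≤ Real.exp (1 / ((q : ℝ) + 1)) := by
      linarith [Real.add_one_le_exp (1 / ((q : ℝ) + 1))]
    calc (1 + 1 / ((q : ℝ) + 1)) ^ q ≤ Real.exp (1 / ((q : ℝ) + 1)) ^ q := by gcongr
      _ = Real.exp (q * (1 / ((q : ℝ) + 1))) := by rw [← Real.exp_nat_mul]
      _ ≤ Real.exp 1 := by
        refine Real.exp_le_exp.2 ?_
        rw [mul_one_div, div_le_one hq1]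
        linarith
      _ ≤ 3 := by linarith [Real.exp_one_lt_d9]
  have hs := A.sum_successProbOn_le
  rw [hm] at hs
  unfold successProb
  rw [div_le_iff₀ (by positivity)]
  refine hs.trans ?_
  have hc0 : (0 : ℝ) ≤ c := by positivity
  have hq0 : (0 : ℝ) ≤ q := by positivity
  have hqq : (q : ℝ) ≤ (q : ℝ) ^ 2 := by exact_mod_cast Nat.le_self_pow (by norm_num) q
  have hS1 : (1 : ℝ) ≤ (c : ℝ) ^ 2 + c * q ^ 2 + q ^ 3 := by
    rcases Nat.eq_zero_or_pos c with h | h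
    · have : (1 : ℝ) ≤ q := by exact_mod_cast (by omega : 1 ≤ q)
      have := one_le_pow₀ this (n := 3)
      rw [h]; push_cast; linarith
    · have : (1 : ℝ) ≤ c := by exact_mod_cast h
      have := one_le_pow₀ this (n := 2)
      have : 0 ≤ (c : ℝ) * q ^ 2 + q ^ 3 := by positivity
      linarith
  -- Here `52 = 48 + 4`: quantum queries give `3 * 16` by `q (q + 2) ≤ 3 q²`, classical ones give
  -- `4`, and the cross term `c q` is absorbed in `c q²` since `q` is a natural number.
  have hpot : (A.purification (c + q)).totalPotential ≤
      3 * ((52 * ((c : ℝ) ^ 2 + c * q ^ 2 + q ^ 3)) / N) * (N : ℝ) ^ M := by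
    refine hp.trans ?_
    gcongr
    have : (q : ℝ) * ((1 + (q + 1)) * (16 * (c + q) / N)) + c * (4 * (c + q) / N) =
      (q * (q + 2) * 16 * (c + q) + c * 4 * (c + q)) / N := by ring
    rw [this]
    gcongr
    have h1 : (q : ℝ) * (q + 2) ≤ 3 * q ^ 2 := by nlinarith
    have h2 : (q : ℝ) * (q + 2) * 16 * (c + q) ≤ 3 * q ^ 2 * 16 * (c + q) := by gcongr
    have h3 : (c : ℝ) * q ≤ c * q ^ 2 := by gcongr
    nlinarith [pow_nonneg hq0 3, sq_nonneg (c : ℝ)]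
  calc 4 * (A.purification (c + q)).totalPotential + 6 / N * (N : ℝ) ^ M
      ≤ 4 * (3 * ((52 * ((c : ℝ) ^ 2 + c * q ^ 2 + q ^ 3)) / N) * (N : ℝ) ^ M)
        + 6 * ((c : ℝ) ^ 2 + c * q ^ 2 + q ^ 3) / N * (N : ℝ) ^ M := by
        gcongr; linarith
    _ = 630 * (((c : ℝ) ^ 2 + c * q ^ 2 + q ^ 3) / N) * (N : ℝ) ^ M := by ring
    _ ≤ _ := by gcongr; norm_num

end HybridAlgorithm

end UpperBound

/-! ### Extending isometries to unitaries, and orthogonality of phases. -/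

section Unitaries

/-- There is a unitary matrix which maps a given orthonormal family to another one. -/
theorem exists_unitary {n ι : Type*} [Fintype n] [DecidableEq n] [DecidableEq ι] (a b : ι → n → ℂ)
    (ha : ∀ i j, star (a i) ⬝ᵥ a j = if i = j then 1 else 0)
    (hb : ∀ i j, star (b i) ⬝ᵥ b j = if i = j then 1 else 0) :
    ∃ U : Matrix.unitaryGroup n ℂ, ∀ i, (U : Matrix n n ℂ) *ᵥ a i = b i := by
  have hin : ∀ v w : EuclideanSpace ℂ n, inner ℂ v w = star v.ofLp ⬝ᵥ w.ofLp := by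
    intro v w
    rw [EuclideanSpace.inner_eq_star_dotProduct, dotProduct_comm]
  have hao : Orthonormal ℂ fun i => (WithLp.toLp 2 (a i) : EuclideanSpace ℂ n) := by
    rw [orthonormal_iff_ite]
    intro i j
    rw [hin]; exact ha i j
  have hbo : Orthonormal ℂ fun i => (WithLp.toLp 2 (b i) : EuclideanSpace ℂ n) := by
    rw [orthonormal_iff_ite]
    intro i j
    rw [hin]; exact hb i j
  let B := Module.Basis.span hao.linearIndependent
  have hB : ∀ i, (B i : EuclideanSpace ℂ n) = WithLp.toLp 2 (a i) := fun i =>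
    congrArg Subtype.val (Module.Basis.span_apply hao.linearIndependent i)
  have hBo : Orthonormal ℂ B := by
    rw [orthonormal_iff_ite]
    intro i j
    rw [Submodule.coe_inner, hB, hB]
    exact orthonormal_iff_ite.1 hao i j
  let f := B.constr ℂ fun i => (WithLp.toLp 2 (b i) : EuclideanSpace ℂ n)
  have hf : ∀ i, f (B i) = WithLp.toLp 2 (b i) := fun i => B.constr_basis ℂ _ i
  have hfo : Orthonormal ℂ (f ∘ B) := by
    have : f ∘ B = fun i => (WithLp.toLp 2 (b i) : EuclideanSpace ℂ n) := funext hf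
    rw [this]; exact hbo
  -- The isometry is prescribed on the span of the first family and extended to the whole space by
  -- finite dimension.
  let L := (f.isometryOfOrthonormal hBo hfo).extend
  have hL : ∀ i, L (WithLp.toLp 2 (a i)) = WithLp.toLp 2 (b i) := by
    intro i
    rw [← hB, LinearIsometry.extend_apply]
    exact hf i
  let U : Matrix n n ℂ := Matrix.of fun i j => (L (EuclideanSpace.single j 1)).ofLp i
  have hU : ∀ v : n → ℂ, U *ᵥ v = (L (WithLp.toLp 2 v)).ofLp := by
    intro v
    have hv : (WithLp.toLp 2 v : EuclideanSpace ℂ n) =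
        ∑ j, v j • EuclideanSpace.single j (1 : ℂ) := by
      ext i
      simp [Pi.single_apply]
    rw [hv, map_sum]
    funext i
    simp [U, Matrix.mulVec, dotProduct, mul_comm]
  refine ⟨⟨U, ?_⟩, fun i => ?_⟩
  · rw [Matrix.mem_unitaryGroup_iff']
    ext i j
    have h1 : (star U * U) i j =
        inner ℂ (L (EuclideanSpace.single i 1)) (L (EuclideanSpace.single j 1)) := by
      rw [hin, Matrix.mul_apply]
      rfl
    rw [h1, L.inner_map_map]
    rw [hin, Matrix.one_apply]
    simp [Pi.single_apply, eq_comm]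
  · change U *ᵥ a i = b i
    rw [hU, hL]

variable {N : ℕ} [NeZero N]

theorem phase_eq (p y : Fin N) :
    phase N p y = (Complex.exp (2 * Real.pi * Complex.I / N) ^ (y : ℕ)) ^ (p : ℕ) := by
  rw [← pow_mul, Nat.mul_comm]; rfl

theorem phase_add (p y z : Fin N) : phase N p (y + z) = phase N p y * phase N p z := by
  have hζ := Complex.isPrimitiveRoot_exp N (NeZero.ne N)
  rw [phase_eq, phase_eq, phase_eq, ← mul_pow, ← pow_add, Fin.val_add]
  rw [← pow_eq_pow_mod _ hζ.pow_eq_one]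

/-- For different values this is a full geometric sum of an `N`-th root of unity other than `1`. -/
theorem sum_star_phase_mul (y z : Fin N) :
    ∑ p, star (phase N p y) * phase N p z = if y = z then (N : ℂ) else 0 := by
  have hζ := Complex.isPrimitiveRoot_exp N (NeZero.ne N)
  split_ifs with h
  · subst h
    have : ∀ p, star (phase N p y) * phase N p y = 1 := fun p => by
      rw [Complex.star_def, Complex.conj_mul', norm_phase]; simp
    rw [Finset.sum_congr rfl fun p _ => this p]
    simp
  · set ζ := Complex.exp (2 * Real.pi * Complex.I / N) with hζdef
    have hstar : star ζ * ζ = 1 := by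
      rw [Complex.star_def, Complex.conj_mul', hζ.norm'_eq_one (NeZero.ne N)]; simp
    set u := star ζ ^ (y : ℕ) * ζ ^ (z : ℕ) with hu
    have hsum : ∑ p, star (phase N p y) * phase N p z = ∑ p ∈ Finset.range N, u ^ p := by
      rw [← Fin.sum_univ_eq_sum_range]
      refine Finset.sum_congr rfl fun p _ => ?_
      rw [phase_eq, phase_eq, star_pow, star_pow, ← mul_pow]
    have huN : u ^ N = 1 := by
      have h1 : star ζ ^ N = 1 := by rw [← star_pow, hζ.pow_eq_one, star_one]
      rw [hu, mul_pow, ← pow_mul, ← pow_mul, mul_comm, mul_comm _ N, mul_comm _ N, pow_mul, pow_mul,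
        hζ.pow_eq_one, h1, one_pow, one_pow, one_mul]
    have hu1 : u ≠ 1 := by
      intro h1
      apply h
      have h2 : ζ ^ (z : ℕ) = ζ ^ (y : ℕ) := by
        calc ζ ^ (z : ℕ) = (star ζ * ζ) ^ (y : ℕ) * ζ ^ (z : ℕ) := by rw [hstar]; simp
          _ = ζ ^ (y : ℕ) * u := by rw [hu]; ring
          _ = ζ ^ (y : ℕ) := by rw [h1, mul_one]
      exact (Fin.ext (hζ.pow_inj z.2 y.2 h2)).symm
    rw [hsum, geom_sum_eq hu1, huN, sub_self, zero_div]

end Unitaries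

/-! ### States with the phase register in the Fourier basis. -/

section Registers

variable {M N s c q : ℕ} [NeZero M] [NeZero N]

/-- The superposition of index registers `x` with amplitudes `g x`, where the phase register is in
the Fourier state of `Y x`, and the workspace in the state `w x`. -/
noncomputable def registers (g : Fin M → ℂ) (Y : Fin M → Fin N) (w : Fin M → Fin s → Bool) :
    Memory M N s → ℂ :=
  fun m => g m.1 * (phase N m.2.1 (Y m.1) / (Real.sqrt N : ℂ)) * if m.2.2 = w m.1 then 1 else 0

theorem sqrt_mul_self (N : ℕ) : (Real.sqrt N : ℂ) * (Real.sqrt N : ℂ) = N := by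
  rw [← Complex.ofReal_mul, Real.mul_self_sqrt (by positivity)]; simp

theorem star_registers_dotProduct (g g' : Fin M → ℂ) (y y' : Fin N) (w w' : Fin s → Bool) :
    star (registers g (fun _ => y) fun _ => w) ⬝ᵥ registers g' (fun _ => y') (fun _ => w') =
      if y = y' ∧ w = w' then star g ⬝ᵥ g' else 0 := by
  have hN : (N : ℂ) ≠ 0 := by exact_mod_cast NeZero.ne N
  have h1 : ∀ x p v, star (registers g (fun _ => y) (fun _ => w)) (x, p, v) *
      registers g' (fun _ => y') (fun _ => w') (x, p, v) =
      (star (g x) * g' x) * ((star (phase N p y) * phase N p y') / N) *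
        (if v = w then (if w = w' then 1 else 0) else 0) := by
    intro x p v
    simp only [registers, Pi.star_apply, star_mul', star_div₀]
    rw [← sqrt_mul_self N]
    have h2 : star (Real.sqrt N : ℂ) = (Real.sqrt N : ℂ) := Complex.conj_ofReal _
    rw [h2]
    by_cases hv : v = w
    · by_cases hw : w = w'
      · simp [hv, hw]; ring
      · simp [hv, hw]
    · simp [hv]
  rw [dotProduct, Fintype.sum_prod_type]
  simp_rw [Fintype.sum_prod_type, h1, ← Finset.mul_sum, ← Finset.sum_mul, ← Finset.mul_sum,
    ← Finset.sum_div, sum_star_phase_mul]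
  rw [← Finset.sum_mul]
  have h3 : ∑ x, star (g x) * g' x = star g ⬝ᵥ g' := rfl
  rw [h3]
  by_cases hy : y = y' <;> by_cases hw : w = w' <;> simp [hy, hw, hN]

theorem registers_eq_sum (g : Fin M → ℂ) (Y : Fin M → Fin N) (w : Fin M → Fin s → Bool) :
    registers g Y w =
      ∑ x, g x • registers (Pi.single x 1) (fun _ => Y x) (fun _ => w x) := by
  funext m
  rw [Finset.sum_apply, Finset.sum_eq_single m.1]
  · simp [registers]
  · intro x _ hx
    simp [registers, Pi.single_eq_of_ne hx.symm]
  · simp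

theorem registers_single (x : Fin M) (Y : Fin M → Fin N) (w : Fin M → Fin s → Bool) :
    registers (Pi.single x 1) Y w = registers (Pi.single x 1) (fun _ => Y x) (fun _ => w x) := by
  funext m
  by_cases hx : m.1 = x
  · simp [registers, hx]
  · simp [registers, Pi.single_eq_of_ne hx]

theorem sum_smul_registers {ι : Type*} (t : Finset ι) (u : ι → ℂ) (g : ι → Fin M → ℂ)
    (Y : Fin M → Fin N) (w : Fin M → Fin s → Bool) :
    ∑ i ∈ t, u i • registers (g i) Y w = registers (fun x => ∑ i ∈ t, u i * g i x) Y w := by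
  funext m
  rw [Finset.sum_apply]
  simp only [registers, Pi.smul_apply, smul_eq_mul, Finset.sum_mul]
  exact Finset.sum_congr rfl fun i _ => by ring

/-- In the Fourier basis of the phase register a query adds the oracle value, so the run can be
followed like a classical computation on labels. -/
theorem phase_mul_registers (g : Fin M → ℂ) (Y D : Fin M → Fin N) (w : Fin M → Fin s → Bool)
    (m : Memory M N s) :
    phase N m.2.1 (D m.1) * registers g Y w m = registers g (fun x => Y x + D x) w m := by
  simp only [registers, phase_add]
  ring

/-- The product of a state of the memory and a basis state of the history register. -/
def withHistory (φ : Memory M N s → ℂ) (H : History M N c) : Joint M N s c → ℂ :=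
  fun b => if b.2 = H then φ b.1 else 0

theorem extU_mulVec_withHistory (A : HybridAlgorithm M N s c q) (t : ℕ) (φ : Memory M N s → ℂ)
    (H : History M N c) :
    A.extU t *ᵥ withHistory φ H = withHistory ((A.U t : Matrix _ _ ℂ) *ᵥ φ) H := by
  funext b
  obtain ⟨m, H'⟩ := b
  rw [extU_mulVec]
  by_cases h : H' = H <;> simp [withHistory, h, Matrix.mulVec, dotProduct]

theorem quantumOracle_mulVec_withHistory (D : Fin M → Fin N) (g : Fin M → ℂ) (Y : Fin M → Fin N)
    (w : Fin M → Fin s → Bool) (H : History M N c) :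
    quantumOracle s c D *ᵥ withHistory (registers g Y w) H =
      withHistory (registers g (fun x => Y x + D x) w) H := by
  funext b
  obtain ⟨m, H'⟩ := b
  rw [quantumOracle_mulVec]
  by_cases h : H' = H <;> simp [withHistory, h, phase_mul_registers]

theorem classicalOracle_mulVec_withHistory (D : Fin M → Fin N) (x : Fin M) (Y : Fin M → Fin N)
    (w : Fin M → Fin s → Bool) (H : History M N c) :
    classicalOracle s c D *ᵥ withHistory (registers (Pi.single x 1) Y w) H =
      withHistory (registers (Pi.single x 1) (fun x => Y x + D x) w) (H.record (x, D x)) := by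
  funext b
  obtain ⟨m, H'⟩ := b
  rw [classicalOracle_mulVec]
  simp only [withHistory]
  rw [Finset.sum_eq_single H]
  · rw [if_pos rfl, phase_mul_registers]
    by_cases hx : m.1 = x
    · rw [hx]
    · have : registers (Pi.single x 1) (fun x => Y x + D x) w m = 0 := by
        simp [registers, Pi.single_eq_of_ne hx]
      simp [this]
  · intro G _ hG
    simp [hG]
  · simp

theorem sum_norm_sq_withHistory_registers (F : (Fin s → Bool) → ℝ) (g : Fin M → ℂ)
    (Y : Fin M → Fin N) (w : Fin M → Fin s → Bool) (H : History M N c) :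
    ∑ b : Joint M N s c, F b.1.2.2 * ‖withHistory (registers g Y w) H b‖ ^ 2 =
      ∑ x, F (w x) * ‖g x‖ ^ 2 := by
  have hN : (0 : ℝ) < N := by exact_mod_cast Nat.pos_of_ne_zero (NeZero.ne N)
  rw [Fintype.sum_prod_type_right, Finset.sum_eq_single H]
  · simp only [withHistory, if_true]
    rw [Fintype.sum_prod_type]
    refine Finset.sum_congr rfl fun x _ => ?_
    rw [Fintype.sum_prod_type]
    have h1 : ∀ p v, F v * ‖registers g Y w (x, p, v)‖ ^ 2 =
        if v = w x then F (w x) * ‖g x‖ ^ 2 / N else 0 := by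
      intro p v
      by_cases hv : v = w x
      · simp only [registers, hv, if_true, mul_one]
        rw [norm_mul, norm_div, norm_phase, Complex.norm_real, Real.norm_eq_abs, mul_pow, div_pow,
          sq_abs, Real.sq_sqrt hN.le]
        ring
      · simp [registers, hv]
    simp_rw [h1]
    simp
    field_simp
  · intro G _ hG
    simp [withHistory, hG]
  · simp

theorem star_single_dotProduct_single {n : Type*} [Fintype n] [DecidableEq n] (x y : n) :
    star (Pi.single x (1 : ℂ) : n → ℂ) ⬝ᵥ Pi.single y 1 = if x = y then 1 else 0 := by
  simp [Pi.single_apply, eq_comm]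

end Registers

/-! ### The unitaries used by the algorithm. -/

section Steps

variable {M N s k : ℕ} [NeZero M] [NeZero N]

theorem sum_smul_registers_single (g u : Fin M → ℂ) (Y : Fin M → Fin N) (w : Fin M → Fin s → Bool) :
    ∑ x, g x • registers (Pi.single x (u x)) (fun _ => Y x) (fun _ => w x) =
      registers (fun x => u x * g x) Y w := by
  funext m
  rw [Finset.sum_apply, Finset.sum_eq_single m.1]
  · simp only [registers, Pi.smul_apply, smul_eq_mul, Pi.single_eq_same]
    ring
  · intro x _ hx
    simp [registers, Pi.single_eq_of_ne hx.symm]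
  · simp

theorem star_single_dotProduct (x y : Fin M) (u v : ℂ) :
    star (Pi.single x u : Fin M → ℂ) ⬝ᵥ Pi.single y v = if x = y then star u * v else 0 := by
  by_cases h : x = y
  · subst h; simp
  · simp [h]

/-- The uniform superposition over all indices. -/
noncomputable def uniformState (M : ℕ) : Fin M → ℂ := fun _ => ((1 / Real.sqrt M : ℝ) : ℂ)

theorem star_uniformState_dotProduct : star (uniformState M) ⬝ᵥ uniformState M = 1 := by
  have hM : (0 : ℝ) < M := by exact_mod_cast Nat.pos_of_ne_zero (NeZero.ne M)
  have : ∀ x, star (uniformState M) x * uniformState M x = ((1 / M : ℝ) : ℂ) := by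
    intro x
    simp only [uniformState, Pi.star_apply]
    rw [Complex.star_def, Complex.conj_ofReal, ← Complex.ofReal_mul, div_mul_div_comm,
      Real.mul_self_sqrt hM.le, one_mul]
  rw [dotProduct, Finset.sum_congr rfl fun x _ => this x]
  have hM' : (M : ℂ) ≠ 0 := by exact_mod_cast NeZero.ne M
  simp [hM']

/-- The classical information stored in the workspace: the values at the sampled indices,
and possibly a further index and its value. -/
abbrev Label (M N k : ℕ) : Type := (Fin k → Fin N) × Option (Fin M × Fin N)

variable {code : Label M N k → Fin s → Bool}

theorem exists_prepare {ψ : Fin M → ℂ} (hψ : star ψ ⬝ᵥ ψ = 1) (w : Fin s → Bool) :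
    ∃ U : Matrix.unitaryGroup (Memory M N s) ℂ,
      U.1 *ᵥ (Pi.single (0, 0, fun _ => false) 1 : Memory M N s → ℂ) =
        registers ψ (fun _ => 0) (fun _ => w) := by
  obtain ⟨U, hU⟩ := exists_unitary
    (fun _ : Unit => (Pi.single (0, 0, fun _ => false) 1 : Memory M N s → ℂ))
    (fun _ => registers ψ (fun _ => 0) (fun _ => w))
    (fun _ _ => by rw [star_single_dotProduct_single]; simp)
    (fun _ _ => by rw [star_registers_dotProduct]; simp [hψ])
  exact ⟨U, hU ()⟩

/-- A swap of the phase register with slot `i` permutes the labels, hence preserves orthonormality.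
As the slot still holds `0`, the phase register is clean for the next query; the index register
moves on in the same step. -/
theorem exists_sample {ψ ψ' : Fin M → ℂ} (hψ : star ψ ⬝ᵥ ψ = 1) (hψ' : star ψ' ⬝ᵥ ψ' = 1)
    (hcode : Function.Injective code) (i : Fin k) :
    ∃ U : Matrix.unitaryGroup (Memory M N s) ℂ, ∀ (y : Fin N) (v : Fin k → Fin N),
      U.1 *ᵥ registers ψ (fun _ => y) (fun _ => code (v, none)) =
        registers ψ' (fun _ => v i) (fun _ => code (Function.update v i y, none)) := by
  obtain ⟨U, hU⟩ := exists_unitary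
    (fun a : Fin N × (Fin k → Fin N) =>
      registers ψ (fun _ => a.1) (fun _ => code (a.2, none)))
    (fun a => registers ψ' (fun _ => a.2 i) (fun _ => code (Function.update a.2 i a.1, none)))
    (fun a b => by
      rw [star_registers_dotProduct, hψ]
      exact if_congr (by simp [hcode.eq_iff, Prod.ext_iff]) rfl rfl)
    (fun a b => by
      rw [star_registers_dotProduct, hψ']
      refine if_congr ?_ rfl rfl
      simp only [hcode.eq_iff, Prod.ext_iff, and_true]
      constructor
      · rintro ⟨h1, h2⟩
        refine ⟨by simpa using congrFun h2 i, ?_⟩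
        funext j
        by_cases hj : j = i
        · rw [hj, h1]
        · simpa [hj] using congrFun h2 j
      · rintro ⟨h1, h2⟩
        rw [h1, h2]; exact ⟨rfl, rfl⟩)
  exact ⟨U, fun y v => hU (y, v)⟩

/-- The sign depends only on labels of basis states, and negation is a bijection of the values.
Negating the value makes the next query erase it. -/
theorem exists_mark (hcode : Function.Injective code) (σ : Fin M → Fin N → (Fin k → Fin N) → ℂ)
    (hσ : ∀ x y v, star (σ x y v) * σ x y v = 1) :
    ∃ U : Matrix.unitaryGroup (Memory M N s) ℂ, ∀ (g : Fin M → ℂ) (Y : Fin M → Fin N)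
      (v : Fin k → Fin N),
      U.1 *ᵥ registers g Y (fun _ => code (v, none)) =
        registers (fun x => σ x (Y x) v * g x) (fun x => - Y x) (fun _ => code (v, none)) := by
  obtain ⟨U, hU⟩ := exists_unitary
    (fun a : Fin M × Fin N × (Fin k → Fin N) =>
      registers (Pi.single a.1 1) (fun _ => a.2.1) (fun _ => code (a.2.2, none)))
    (fun a => registers (Pi.single a.1 (σ a.1 a.2.1 a.2.2)) (fun _ => -a.2.1)
      (fun _ => code (a.2.2, none)))
    (fun a b => by
      rw [star_registers_dotProduct, star_single_dotProduct, ← ite_and]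
      refine if_congr ?_ (by simp) rfl
      simp only [hcode.eq_iff, Prod.ext_iff, and_true]
      tauto)
    (fun a b => by
      rw [star_registers_dotProduct, star_single_dotProduct, ← ite_and]
      have h : ((-a.2.1 = -b.2.1 ∧ code (a.2.2, none) = code (b.2.2, none)) ∧ a.1 = b.1) ↔
          a = b := by
        simp only [hcode.eq_iff, Prod.ext_iff, and_true, neg_inj]
        tauto
      simp only [h]
      split_ifs with hab
      · rw [hab, hσ]
      · rfl)
  refine ⟨U, fun g Y v => ?_⟩
  rw [registers_eq_sum, Matrix.mulVec_sum]
  simp_rw [Matrix.mulVec_smul]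
  rw [Finset.sum_congr rfl fun x _ => congrArg (g x • ·) (hU (x, Y x, v))]
  exact sum_smul_registers_single g (fun x => σ x (Y x) v) (fun x => -Y x) _

/-- The rows of the reflection about the uniform vector are orthonormal. It is prescribed only for a
clean phase register, which is all that is needed. -/
theorem exists_diffuse (hcode : Function.Injective code) :
    ∃ U : Matrix.unitaryGroup (Memory M N s) ℂ, ∀ (g : Fin M → ℂ) (v : Fin k → Fin N),
      U.1 *ᵥ registers g (fun _ => 0) (fun _ => code (v, none)) =
        registers (fun x => 2 * ((∑ y, g y) / M) - g x) (fun _ => 0)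
          (fun _ => code (v, none)) := by
  have hM : (M : ℂ) ≠ 0 := by exact_mod_cast NeZero.ne M
  set r : Fin M → Fin M → ℂ := fun x z => 2 / M - if z = x then 1 else 0 with hr
  have hrr : ∀ x y, star (r x) ⬝ᵥ r y = if x = y then 1 else 0 := by
    intro x y
    have h1 : ∀ z, star (r x) z * r y z = 2 / M * (2 / M) - 2 / M * (if z = y then 1 else 0)
        - 2 / M * (if z = x then 1 else 0) + if z = x then (if x = y then 1 else 0) else 0 := by
      intro z
      have : star (r x) z = r x z := by
        simp only [hr, Pi.star_apply, star_sub, star_div₀]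
        split_ifs <;> simp
      rw [this]
      by_cases h1 : z = x
      · subst h1; simp only [hr, if_true]; split_ifs <;> ring
      · simp only [hr, h1, if_false]; split_ifs <;> ring
    rw [dotProduct, Finset.sum_congr rfl fun z _ => h1 z]
    simp only [Finset.sum_add_distrib, Finset.sum_sub_distrib, ← Finset.mul_sum,
      Finset.sum_ite_eq', Finset.mem_univ, if_true, Finset.sum_const, Finset.card_univ,
      Fintype.card_fin, nsmul_eq_mul]
    field_simp
    ring
  obtain ⟨U, hU⟩ := exists_unitary
    (fun a : Fin M × (Fin k → Fin N) =>
      registers (Pi.single a.1 1) (fun _ => (0 : Fin N)) (fun _ => code (a.2, none)))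
    (fun a => registers (r a.1) (fun _ => (0 : Fin N)) (fun _ => code (a.2, none)))
    (fun a b => by
      rw [star_registers_dotProduct, star_single_dotProduct, ← ite_and]
      refine if_congr ?_ (by simp) rfl
      simp only [hcode.eq_iff, Prod.ext_iff, and_true, true_and]
      tauto)
    (fun a b => by
      rw [star_registers_dotProduct, hrr, ← ite_and]
      refine if_congr ?_ rfl rfl
      simp only [hcode.eq_iff, Prod.ext_iff, and_true, true_and]
      tauto)
  refine ⟨U, fun g v => ?_⟩
  rw [registers_eq_sum, Matrix.mulVec_sum]
  simp_rw [Matrix.mulVec_smul]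
  rw [Finset.sum_congr rfl fun x _ => congrArg (g x • ·) (hU (x, v))]
  refine (sum_smul_registers Finset.univ g r (fun _ => (0 : Fin N)) (fun _ => code (v, none))).trans ?_
  congr 1
  funext x
  simp only [hr, mul_sub, Finset.sum_sub_distrib, ← Finset.sum_mul]
  simp
  ring

/-- Only the workspace is measured, so index and value have to be written there; the measurement
then yields `x` with probability `‖g x‖ ^ 2`. -/
theorem exists_copy (hcode : Function.Injective code) :
    ∃ U : Matrix.unitaryGroup (Memory M N s) ℂ, ∀ (g : Fin M → ℂ) (Y : Fin M → Fin N)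
      (v : Fin k → Fin N),
      U.1 *ᵥ registers g Y (fun _ => code (v, none)) =
        registers g Y (fun x => code (v, some (x, Y x))) := by
  obtain ⟨U, hU⟩ := exists_unitary
    (fun a : Fin M × Fin N × (Fin k → Fin N) =>
      registers (Pi.single a.1 1) (fun _ => a.2.1) (fun _ => code (a.2.2, none)))
    (fun a => registers (Pi.single a.1 1) (fun _ => a.2.1)
      (fun _ => code (a.2.2, some (a.1, a.2.1))))
    (fun a b => by
      rw [star_registers_dotProduct, star_single_dotProduct, ← ite_and]
      refine if_congr ?_ (by simp) rfl
      simp only [hcode.eq_iff, Prod.ext_iff, and_true]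
      tauto)
    (fun a b => by
      rw [star_registers_dotProduct, star_single_dotProduct, ← ite_and]
      refine if_congr ?_ (by simp) rfl
      simp only [hcode.eq_iff, Prod.ext_iff, Option.some.injEq]
      tauto)
  refine ⟨U, fun g Y v => ?_⟩
  rw [registers_eq_sum, Matrix.mulVec_sum]
  simp_rw [Matrix.mulVec_smul]
  rw [Finset.sum_congr rfl fun x _ => congrArg (g x • ·) (hU (x, Y x, v))]
  have := sum_smul_registers_single g (fun _ => 1) Y (fun x => code (v, some (x, Y x)))
  simpa using this

end Steps

/-! ### Sampling followed by Grover search, as a hybrid algorithm. -/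

section Algorithm

variable {M N s c q : ℕ} [NeZero M] [NeZero N]

theorem groverIteration_eq (G : Finset (Fin M)) (g : Fin M → ℂ) :
    groverIteration G g = fun x => 2 * ((∑ y, (if y ∈ G then -1 else 1) * g y) / M) -
      (if x ∈ G then -1 else 1) * g x := by
  funext x
  unfold groverIteration
  simp only [ite_mul, neg_mul, one_mul]

namespace HybridAlgorithm

theorem state_succ_quantum (A : HybridAlgorithm M N s c q) (D : Fin M → Fin N) {t : ℕ}
    (ht : A.kind (t + 1) = QueryKind.quantum) :
    A.state D (t + 1) = A.extU (t + 1) *ᵥ (quantumOracle s c D *ᵥ A.state D t) := by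
  rw [state, ht]; rfl

theorem state_succ_registers (A : HybridAlgorithm M N s c q) (D : Fin M → Fin N) {t : ℕ}
    (ht : A.kind (t + 1) = QueryKind.quantum) {g : Fin M → ℂ} {Y : Fin M → Fin N}
    {w : Fin M → Fin s → Bool} {H : History M N c}
    (h : A.state D t = withHistory (registers g Y w) H) :
    A.state D (t + 1) = withHistory ((A.U (t + 1)).1 *ᵥ registers g (fun x => Y x + D x) w) H := by
  rw [A.state_succ_quantum D ht, h, quantumOracle_mulVec_withHistory, extU_mulVec_withHistory]

theorem state_succ_single (A : HybridAlgorithm M N s c q) (D : Fin M → Fin N) {t : ℕ} {x : Fin M}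
    {Y : Fin M → Fin N} {w : Fin M → Fin s → Bool} {H : History M N c}
    (h : A.state D t = withHistory (registers (Pi.single x 1) Y w) H) :
    ∃ H', A.state D (t + 1) =
      withHistory ((A.U (t + 1)).1 *ᵥ registers (Pi.single x 1) (fun x => Y x + D x) w) H' := by
  cases hk : A.kind (t + 1) with
  | quantum => exact ⟨H, A.state_succ_registers D hk h⟩
  | classical =>
    refine ⟨H.record (x, D x), ?_⟩
    rw [state, hk, h]
    change A.extU (t + 1) *ᵥ (classicalOracle s c D *ᵥ _) = _
    rw [classicalOracle_mulVec_withHistory, extU_mulVec_withHistory]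

theorem norm_state_succ (A : HybridAlgorithm M N s c q) (D : Fin M → Fin N) {t : ℕ}
    (ht : A.kind (t + 1) = QueryKind.quantum) (hU : A.U (t + 1) = 1) (b : Joint M N s c) :
    ‖A.state D (t + 1) b‖ = ‖A.state D t b‖ := by
  obtain ⟨m, H⟩ := b
  rw [A.state_succ_quantum D ht, extU_mulVec, hU]
  simp [Matrix.one_apply, quantumOracle_mulVec, norm_phase]

theorem norm_state_of_le (A : HybridAlgorithm M N s c q) (D : Fin M → Fin N) {t u : ℕ}
    (htu : t ≤ u) (hk : ∀ i, t < i → A.kind i = QueryKind.quantum) (hU : ∀ i, t < i → A.U i = 1)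
    (b : Joint M N s c) : ‖A.state D u b‖ = ‖A.state D t b‖ := by
  induction u, htu using Nat.le_induction with
  | base => rfl
  | succ u hu ih =>
    rw [A.norm_state_succ D (hk _ (by omega)) (hU _ (by omega)), ih]

/-- If only phases are changed after `t` queries, the success probability can be read off
from the state after `t` queries. -/
theorem successProbOn_eq_of_state (A : HybridAlgorithm M N s c q) (D : Fin M → Fin N) {t : ℕ}
    (ht : t ≤ c + q) (hk : ∀ i, t < i → A.kind i = QueryKind.quantum)
    (hU : ∀ i, t < i → A.U i = 1) {g : Fin M → ℂ} {Y : Fin M → Fin N}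
    {w : Fin M → Fin s → Bool} {H : History M N c}
    (h : A.state D t = withHistory (registers g Y w) H) :
    A.successProbOn D = ∑ x, if IsCollision D (A.output (w x)) then ‖g x‖ ^ 2 else 0 := by
  unfold successProbOn
  simp_rw [A.norm_state_of_le D ht hk hU, h]
  have := sum_norm_sq_withHistory_registers
    (fun v => if IsCollision D (A.output v) then 1 else 0) g Y w H
  simpa using this

/-- The algorithm which samples at the indices `ξ`, performs `r` Grover iterations, and then
applies `V` after the next query. -/
theorem exists_samplesThenGrover {k r : ℕ} (hk : k = c + q / 2) (hr : k + 2 * r ≤ c + q) (ξ : ℕ → Fin M)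
    (hξ : ∀ i j, i < j → j < k → j < M → ξ i ≠ ξ j)
    {code : Label M N (k) → Fin s → Bool} (hcode : Function.Injective code)
    (V : Matrix.unitaryGroup (Memory M N s) ℂ) (out : (Fin s → Bool) → Fin M × Fin M) :
    ∃ A : HybridAlgorithm M N s c q, A.SamplesThenGrover ∧ A.output = out ∧
      A.U (k + 2 * r + 1) = V ∧ (∀ t, k + 2 * r + 1 < t → A.U t = 1) ∧
      (∀ t, c < t → A.kind t = QueryKind.quantum) ∧
      ∀ D, ∃ H, A.state D (k + 2 * r) = withHistory
        (registers ((groverIteration (collidingWith D ξ (k)))^[r] (uniformState M))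
          (fun _ => 0) (fun _ => code (fun j => D (ξ j), none))) H := by
  -- `ψ k` is already uniform, so the last sampling unitary (or the preparation, if `k = 0`) also
  -- starts the search.
  set ψ : ℕ → Fin M → ℂ := fun t => if t < k then Pi.single (ξ t) 1 else uniformState M with hψdef
  have hψ : ∀ t, star (ψ t) ⬝ᵥ ψ t = 1 := by
    intro t
    simp only [hψdef]
    split_ifs
    · rw [star_single_dotProduct_single, if_pos rfl]
    · exact star_uniformState_dotProduct
  set σ : Fin M → Fin N → (Fin k → Fin N) → ℂ :=
    fun x y v => if ∃ j : Fin k, ξ j ≠ x ∧ v j = y then -1 else 1 with hσdef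
  obtain ⟨U₀, hU₀⟩ := exists_prepare (N := N) (hψ 0) (code (fun _ => 0, none))
  choose S hS using fun i : Fin k => exists_sample (hψ i) (hψ (i + 1)) hcode i
  obtain ⟨G₁, hG₁⟩ := exists_mark hcode σ
    (fun x y v => by simp only [hσdef]; split_ifs <;> simp)
  obtain ⟨G₂, hG₂⟩ := exists_diffuse hcode
  -- `U t` follows query `t`, so slot `i` is filled by `U (i + 1)`. In the search, odd offsets from
  -- `k` mark and even offsets diffuse.
  let A : HybridAlgorithm M N s c q :=
    { U := fun t => if t = 0 then U₀ else if h : t - 1 < k then S ⟨t - 1, h⟩ else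
        if t ≤ k + 2 * r then (if (t - k) % 2 = 1 then G₁ else G₂) else
        if t = k + 2 * r + 1 then V else 1
      kind := fun t => if t ≤ c then QueryKind.classical else QueryKind.quantum
      card_quantum := by
        have : (Finset.Icc 1 (c + q)).filter
            (fun t => (if t ≤ c then QueryKind.classical else QueryKind.quantum) =
              QueryKind.quantum) = Finset.Icc (c + 1) (c + q) := by
          ext t
          by_cases h : t ≤ c
          · simp; omega
          · simp; omega
        rw [this]; simp
      output := out }
  have hkind : ∀ t, c < t → A.kind t = QueryKind.quantum := fun t ht =>
    if_neg (not_le.2 ht)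
  have hAS : ∀ i : Fin k, A.U (i + 1) = S i := fun i => by simp [A]
  have hAG₁ : ∀ i, i < r → A.U (k + 2 * i + 1) = G₁ := fun i hi => by
    have h1 : ¬ k + 2 * i < k := by omega
    have h2 : k + 2 * i + 1 ≤ k + 2 * r := by omega
    have h3 : (k + 2 * i + 1 - k) % 2 = 1 := by omega
    simp [A, h1, h2, h3]
  have hAG₂ : ∀ i, i < r → A.U (k + 2 * i + 1 + 1) = G₂ := fun i hi => by
    have h1 : ¬ k + 2 * i + 1 < k := by omega
    have h2 : k + 2 * i + 1 + 1 ≤ k + 2 * r := by omega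
    have h3 : ¬ (k + 2 * i + 1 + 1 - k) % 2 = 1 := by omega
    simp only [A, Nat.add_sub_cancel, h1, h2, h3, dif_neg, not_false_eq_true, if_true, if_false,
      Nat.succ_ne_zero]
  have hsample : ∀ D, ∀ t ≤ k, ∃ H, A.state D t = withHistory (registers (ψ t) (fun _ => 0)
      (fun _ => code (fun j => if (j : ℕ) < t then D (ξ j) else 0, none))) H := by
    intro D t
    induction t with
    | zero =>
      intro _
      refine ⟨fun _ => none, ?_⟩
      have h1 : (Pi.single ((0, 0, fun _ => false), fun _ => none) 1 : Joint M N s c → ℂ) =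
          withHistory (Pi.single (0, 0, fun _ => false) 1) (fun _ => none) := by
        funext b
        obtain ⟨m, H⟩ := b
        simp only [withHistory, Pi.single_apply, Prod.mk.injEq]
        by_cases h : H = fun _ => none <;> simp [h]
      have hA0 : A.U 0 = U₀ := rfl
      rw [state, h1, extU_mulVec_withHistory, hA0, hU₀]
      simp
    | succ t ih =>
      intro ht
      obtain ⟨H, hH⟩ := ih (by omega)
      have hψt : ψ t = Pi.single (ξ t) 1 := if_pos (by omega)
      rw [hψt] at hH
      obtain ⟨H', hH'⟩ := A.state_succ_single D hH
      refine ⟨H', ?_⟩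
      rw [hH', registers_single, ← hψt]
      have := hS ⟨t, ht⟩
      have hU := hAS ⟨t, ht⟩
      simp only at this hU
      rw [hU, this]
      simp only [lt_irrefl, if_false, zero_add]
      congr 2
      funext _
      congr 2
      funext j
      by_cases hj : j = ⟨t, ht⟩
      · subst hj; simp
      · have : (j : ℕ) ≠ t := fun h => hj (Fin.ext h)
        rw [Function.update_of_ne hj]
        exact if_congr (by omega) rfl rfl
  -- One history serves all `i`, because only quantum queries remain.
  have hgrover : ∀ D, ∃ H, ∀ i ≤ r, A.state D (k + 2 * i) = withHistory
      (registers ((groverIteration (collidingWith D ξ k))^[i] (uniformState M))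
        (fun _ => 0) (fun _ => code (fun j => D (ξ j), none))) H := by
    intro D
    obtain ⟨H, hH⟩ := hsample D k le_rfl
    refine ⟨H, fun i => ?_⟩
    induction i with
    | zero =>
      intro _
      rw [mul_zero, add_zero, hH]
      simp [hψdef]
    | succ i ih =>
      intro hi
      have h1 := A.state_succ_registers D (hkind _ (by omega)) (ih (by omega))
      rw [hAG₁ i (by omega), hG₁] at h1
      have h2 := A.state_succ_registers D (hkind _ (by omega)) h1
      -- Uncomputation: the second query of the iteration cancels the negated value.
      have h3 : ∀ x, -(0 + D x) + D x = 0 := fun x => by simp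
      simp only [h3] at h2
      rw [hAG₂ i (by omega), hG₂] at h2
      rw [show k + 2 * (i + 1) = k + 2 * i + 1 + 1 by ring, h2, Function.iterate_succ_apply',
        groverIteration_eq]
      have h4 : ∀ x, σ x (0 + D x) (fun j => D (ξ j)) =
          if x ∈ collidingWith D ξ k then -1 else 1 := by
        intro x
        simp only [hσdef, zero_add]
        refine if_congr ?_ rfl rfl
        simp only [collidingWith, Finset.mem_filter, Finset.mem_univ, true_and]
        exact ⟨fun ⟨j, h⟩ => ⟨j, j.2, h⟩, fun ⟨j, hj, h⟩ => ⟨⟨j, hj⟩, h⟩⟩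
      simp_rw [h4]
  subst hk
  refine ⟨A, ⟨?_, ξ, hξ, ?_, r, hr, ?_⟩, rfl, ?_, ?_, hkind, ?_⟩
  · intro t ht
    exact if_pos (Finset.mem_Icc.1 ht).2
  · intro D t ht b hb
    obtain ⟨H, hH⟩ := hsample D t ht.le
    have hψt : ψ t = Pi.single (ξ t) 1 := if_pos ht
    rw [hH, hψt] at hb
    by_contra hne
    apply hb
    simp [withHistory, registers, Pi.single_eq_of_ne hne]
  · intro D
    obtain ⟨H, hH⟩ := hgrover D
    refine ⟨fun p w H' => if H' = H then phase N p 0 / (Real.sqrt N : ℂ) *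
      (if w = code (fun j => D (ξ j), none) then 1 else 0) else 0, fun i hi x p w H' => ?_⟩
    rw [hH i hi]
    simp only [withHistory, registers]
    split_ifs
    · rw [mul_assoc]; rfl
    all_goals simp
  · simp [A]
  · intro t ht
    have h1 : ¬ t - 1 < c + q / 2 := by omega
    have h2 : ¬ t ≤ c + q / 2 + 2 * r := by omega
    have h3 : t ≠ 0 := by omega
    have h4 : t ≠ c + q / 2 + 2 * r + 1 := by omega
    simp [A, h1, h2, h3, h4]
  · intro D
    obtain ⟨H, hH⟩ := hgrover D
    exact ⟨H, hH r le_rfl⟩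

end HybridAlgorithm

/-- One-hot encoding. -/
theorem exists_code (α : Type*) [Fintype α] :
    ∃ (s : ℕ) (code : α → Fin s → Bool), Function.Injective code := by
  classical
  refine ⟨Fintype.card α, fun a i => decide (Fintype.equivFin α a = i), fun a b h => ?_⟩
  have := congrFun h (Fintype.equivFin α b)
  simpa using this

/-- There is an algorithm whose output is determined by the sampled values. -/
theorem exists_samplingAlgorithm (c q : ℕ) (ξ : ℕ → Fin M)
    (hξ : ∀ i j, i < j → j < c + q / 2 → j < M → ξ i ≠ ξ j)
    (out : (Fin (c + q / 2) → Fin N) → Fin M × Fin M) :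
    ∃ (s : ℕ) (A : HybridAlgorithm M N s c q), A.SamplesThenGrover ∧ ∀ D,
      A.successProbOn D = if IsCollision D (out fun j => D (ξ j)) then 1 else 0 := by
  obtain ⟨s, code, hcode⟩ := exists_code (Label M N (c + q / 2))
  obtain ⟨A, hA, hout, hV, hU, hk, hstate⟩ := HybridAlgorithm.exists_samplesThenGrover (c := c)
    (q := q) (r := 0) rfl (by omega) ξ hξ hcode 1 (fun w => out (Function.invFun code w).1)
  refine ⟨s, A, hA, fun D => ?_⟩
  obtain ⟨H, hH⟩ := hstate D
  rw [A.successProbOn_eq_of_state D (by omega) (fun i hi => hk i (by omega)) (fun i hi => ?_) hH,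
    hout]
  · simp only [Function.leftInverse_invFun hcode _]
    split_ifs
    · have h := star_uniformState_dotProduct (M := M)
      rw [dotProduct] at h
      have h1 : ∀ x, star (uniformState M) x * uniformState M x =
          ((‖uniformState M x‖ ^ 2 : ℝ) : ℂ) := fun x => by
        rw [Pi.star_apply, Complex.star_def, Complex.conj_mul']; push_cast; rfl
      rw [Finset.sum_congr rfl fun x _ => h1 x] at h
      exact_mod_cast h
    · simp
  · rcases (show c + q / 2 + 2 * 0 + 1 ≤ i by omega).eq_or_lt with h | h
    · rw [← h]; exact hV
    · exact hU i h

/-- There is an algorithm which succeeds with the probability of finding a marked element by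
Grover search. -/
theorem exists_groverAlgorithm (c q : ℕ) {r : ℕ} (hr : c + q / 2 + 2 * r + 1 ≤ c + q)
    (ξ : ℕ → Fin M) (hξ : ∀ i j, i < j → j < c + q / 2 → j < M → ξ i ≠ ξ j) :
    ∃ (s : ℕ) (A : HybridAlgorithm M N s c q), A.SamplesThenGrover ∧ ∀ D,
      A.successProbOn D = ∑ x ∈ collidingWith D ξ (c + q / 2),
        ‖((groverIteration (collidingWith D ξ (c + q / 2)))^[r] (uniformState M)) x‖ ^ 2 := by
  classical
  obtain ⟨s, code, hcode⟩ := exists_code (Label M N (c + q / 2))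
  obtain ⟨V, hVcopy⟩ := exists_copy (M := M) (N := N) hcode
  -- The default `(0, 0)` is never a collision, so the success probability is exactly the mass on
  -- marked indices.
  let out : Label M N (c + q / 2) → Fin M × Fin M := fun l =>
    match l.2 with
    | none => (0, 0)
    | some (x, y) => if h : ∃ j : Fin (c + q / 2), ξ j ≠ x ∧ l.1 j = y then
        (ξ h.choose, x) else (0, 0)
  obtain ⟨A, hA, hout, hV, hU, hk, hstate⟩ := HybridAlgorithm.exists_samplesThenGrover (c := c)
    (q := q) (r := r) rfl (by omega) ξ hξ hcode V (fun w => out (Function.invFun code w))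
  refine ⟨s, A, hA, fun D => ?_⟩
  obtain ⟨H, hH⟩ := hstate D
  have h1 := A.state_succ_registers D (hk _ (by omega)) hH
  rw [hV, hVcopy] at h1
  rw [A.successProbOn_eq_of_state D hr (fun i hi => hk i (by omega)) (fun i hi => hU i hi) h1, hout]
  simp only [Function.leftInverse_invFun hcode _, zero_add]
  rw [← Finset.sum_filter]
  refine Finset.sum_congr ?_ fun _ _ => rfl
  ext x
  simp only [Finset.mem_filter, Finset.mem_univ, true_and, collidingWith, out]
  by_cases h : ∃ j : Fin (c + q / 2), ξ j ≠ x ∧ D (ξ j) = D x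
  · rw [dif_pos h]
    have h2 : ∃ j < c + q / 2, IsCollision D (ξ j, x) := h.elim fun j hj => ⟨j, j.2, hj⟩
    simp only [h2, iff_true]
    exact h.choose_spec
  · rw [dif_neg h]
    have h2 : ¬ ∃ j < c + q / 2, IsCollision D (ξ j, x) :=
      fun ⟨j, hj, hjx⟩ => h ⟨⟨j, hj⟩, hjx⟩
    simp [h2]

end Algorithm

/-! ### Analysis of Grover search. -/

section Grover

variable {M : ℕ} [NeZero M]

/-- The iterates of Grover search are rotations by twice the angle `arcsin √(#G / M)`. -/
theorem iterate_groverIteration (G : Finset (Fin M)) (i : ℕ) :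
    (groverIteration G)^[i] (uniformState M) = fun x =>
      ((if x ∈ G then
          Real.sin ((2 * i + 1) * Real.arcsin √(G.card / M)) / √(G.card : ℝ)
        else Real.cos ((2 * i + 1) * Real.arcsin √(G.card / M)) / √((M : ℝ) - G.card) : ℝ) : ℂ) := by
  have hM : (0 : ℝ) < M := by exact_mod_cast Nat.pos_of_ne_zero (NeZero.ne M)
  have hGM : (G.card : ℝ) ≤ M := by exact_mod_cast (Finset.card_le_univ G).trans_eq (by simp)
  set g : ℝ := (G.card : ℝ) with hg
  have hg0 : 0 ≤ g := by positivity
  set θ := Real.arcsin √(g / M) with hθ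
  set a := √g with ha
  set b := √((M : ℝ) - g) with hb
  have haa : a ^ 2 = g := Real.sq_sqrt hg0
  have hbb : b ^ 2 = M - g := Real.sq_sqrt (by linarith)
  have hsin : Real.sin θ = a / √M := by
    rw [hθ, Real.sin_arcsin, Real.sqrt_div hg0]
    · linarith [Real.sqrt_nonneg (g / M)]
    · rw [Real.sqrt_le_one]; exact (div_le_one hM).2 hGM
  have hcos : Real.cos θ = b / √M := by
    rw [hθ, Real.cos_arcsin, Real.sq_sqrt (by positivity), hb, ← Real.sqrt_div (by linarith)]
    congr 1; field_simp
  have hmm : √(M : ℝ) ^ 2 = M := Real.sq_sqrt hM.le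
  have hm0 : √(M : ℝ) ≠ 0 := (Real.sqrt_pos.2 hM).ne'
  have hapos : ∀ x, x ∈ G → a ≠ 0 := fun x hx => by
    have : 0 < G.card := Finset.card_pos.2 ⟨x, hx⟩
    exact (Real.sqrt_pos.2 (by rw [hg]; exact_mod_cast this)).ne'
  have hbpos : ∀ x, x ∉ G → b ≠ 0 := fun x hx => by
    have : G.card < M := by
      simpa using Finset.card_lt_univ_of_notMem hx
    exact (Real.sqrt_pos.2 (by rw [hg, sub_pos]; exact_mod_cast this)).ne'
  induction i with
  | zero =>
    funext x
    simp only [Function.iterate_zero, id, uniformState, Nat.cast_zero, mul_zero, zero_add, one_mul,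
      hsin, hcos]
    congr 1
    split_ifs with hx
    · have := hapos x hx; field_simp
    · have := hbpos x hx; field_simp
  | succ i ih =>
    rw [Function.iterate_succ_apply', ih]
    set φ := (2 * (i : ℝ) + 1) * θ with hφ
    have hφ' : (2 * ((i + 1 : ℕ) : ℝ) + 1) * θ = φ + 2 * θ := by rw [hφ]; push_cast; ring
    rw [hφ', Real.sin_add, Real.cos_add, Real.sin_two_mul, Real.cos_two_mul, hsin, hcos]
    have hsum : (∑ y, if y ∈ G then
        -((if y ∈ G then Real.sin φ / a else Real.cos φ / b : ℝ) : ℂ)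
        else ((if y ∈ G then Real.sin φ / a else Real.cos φ / b : ℝ) : ℂ)) =
        ((b * Real.cos φ - a * Real.sin φ : ℝ) : ℂ) := by
      have h1 : ∀ y, (if y ∈ G then
          -((if y ∈ G then Real.sin φ / a else Real.cos φ / b : ℝ) : ℂ)
          else ((if y ∈ G then Real.sin φ / a else Real.cos φ / b : ℝ) : ℂ)) =
          ((if y ∈ G then -(Real.sin φ / a) else Real.cos φ / b : ℝ) : ℂ) := by
        intro y; split_ifs <;> simp
      rw [Finset.sum_congr rfl fun y _ => h1 y, ← Complex.ofReal_sum, Finset.sum_ite]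
      congr 1
      have h2 : (Finset.univ.filter fun y => y ∈ G) = G := by ext; simp
      have h3 : (Finset.univ.filter fun y => y ∉ G) = Gᶜ := by ext; simp
      rw [h2, h3, Finset.sum_const, Finset.sum_const, Finset.card_compl, nsmul_eq_mul,
        nsmul_eq_mul, Nat.cast_sub (Finset.card_le_univ G), Fintype.card_fin, ← hg]
      have h4 : g / a = a := Real.div_sqrt
      have h5 : ((M : ℝ) - g) / b = b := Real.div_sqrt
      calc g * -(Real.sin φ / a) + ((M : ℝ) - g) * (Real.cos φ / b)
          = ((M : ℝ) - g) / b * Real.cos φ - g / a * Real.sin φ := by ring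
        _ = _ := by rw [h4, h5]
    funext x
    unfold groverIteration
    rw [hsum]
    have hM2 : (M : ℝ) = a ^ 2 + b ^ 2 := by linarith
    have hab : a ^ 2 + b ^ 2 ≠ 0 := by rw [← hM2]; exact hM.ne'
    by_cases hx : x ∈ G
    · have ha0 := hapos x hx
      simp only [hx, if_true]
      rw [← Complex.ofReal_natCast, ← Complex.ofReal_neg, ← Complex.ofReal_div,
        ← Complex.ofReal_ofNat, ← Complex.ofReal_mul, ← Complex.ofReal_sub]
      congr 1
      rw [div_pow, hmm, mul_assoc 2 (a / _), div_mul_div_comm a, ← pow_two, hmm, hM2]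
      field_simp
      ring
    · have hb0 := hbpos x hx
      simp only [hx, if_false]
      rw [← Complex.ofReal_natCast, ← Complex.ofReal_div,
        ← Complex.ofReal_ofNat, ← Complex.ofReal_mul, ← Complex.ofReal_sub]
      congr 1
      rw [div_pow, hmm, mul_assoc 2 (a / _), div_mul_div_comm a, ← pow_two, hmm, hM2]
      field_simp
      ring

/-- The success probability of Grover search grows quadratically until it is constant. -/
theorem sum_iterate_groverIteration_ge (G : Finset (Fin M)) (r : ℕ)
    (h : (2 * (r : ℝ) + 1) ^ 2 * G.card ≤ M) :
    (2 * (r : ℝ) + 1) ^ 2 * G.card / (4 * M) ≤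
      ∑ x ∈ G, ‖((groverIteration G)^[r] (uniformState M)) x‖ ^ 2 := by
  have hM : (0 : ℝ) < M := by exact_mod_cast Nat.pos_of_ne_zero (NeZero.ne M)
  have hGM : (G.card : ℝ) ≤ M := by exact_mod_cast (Finset.card_le_univ G).trans_eq (by simp)
  rcases G.eq_empty_or_nonempty with rfl | hne
  · simp
  have hg : (0 : ℝ) < G.card := by exact_mod_cast Finset.card_pos.2 hne
  rw [iterate_groverIteration]
  have h1 : ∀ x ∈ G, ‖((if x ∈ G then
          Real.sin ((2 * r + 1) * Real.arcsin √(G.card / M)) / √(G.card : ℝ)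
        else Real.cos ((2 * r + 1) * Real.arcsin √(G.card / M)) / √((M : ℝ) - G.card) : ℝ) : ℂ)‖ ^ 2
      = Real.sin ((2 * r + 1) * Real.arcsin √(G.card / M)) ^ 2 / G.card := by
    intro x hx
    rw [if_pos hx, Complex.norm_real, Real.norm_eq_abs, sq_abs, div_pow, Real.sq_sqrt hg.le]
  rw [Finset.sum_congr rfl h1, Finset.sum_const, nsmul_eq_mul, mul_div_cancel₀ _ hg.ne']
  set u := √((G.card : ℝ) / M) with hu
  set θ := Real.arcsin u with hθ
  have hu0 : 0 ≤ u := Real.sqrt_nonneg _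
  have huu : u ^ 2 = G.card / M := Real.sq_sqrt (by positivity)
  have hu1 : u ≤ 1 := by rw [hu, Real.sqrt_le_one]; exact (div_le_one hM).2 hGM
  have hsin : Real.sin θ = u := Real.sin_arcsin (by linarith) hu1
  have hθ0 : 0 ≤ θ := Real.arcsin_nonneg.2 hu0
  have hθ1 : u ≤ θ := by rw [← hsin]; exact Real.sin_le hθ0
  -- Jordan's inequality, used twice: here it keeps `(2 r + 1) θ` below `π / 2`, and there it bounds
  -- the sine from below.
  have hθ2 : 2 / Real.pi * θ ≤ u := by
    rw [← hsin]; exact Real.mul_le_sin hθ0 (Real.arcsin_le_pi_div_two u)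
  have hπ := Real.pi_pos
  have hℓ : (0 : ℝ) < 2 * r + 1 := by positivity
  have hℓu : (2 * (r : ℝ) + 1) * u ≤ 1 := by
    rw [← abs_of_nonneg (mul_nonneg hℓ.le hu0), ← sq_le_one_iff_abs_le_one, mul_pow, huu,
      ← mul_div_assoc, div_le_one hM]
    exact h
  have hangle : (2 * (r : ℝ) + 1) * θ ≤ Real.pi / 2 := by
    have h2 : θ ≤ Real.pi / 2 * u := by
      rw [div_mul_eq_mul_div, div_le_iff₀ hπ] at hθ2
      linarith
    calc (2 * (r : ℝ) + 1) * θ ≤ (2 * (r : ℝ) + 1) * (Real.pi / 2 * u) := by gcongr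
      _ = Real.pi / 2 * ((2 * (r : ℝ) + 1) * u) := by ring
      _ ≤ Real.pi / 2 * 1 := by gcongr
      _ = _ := mul_one _
  have h3 := Real.mul_le_sin (mul_nonneg hℓ.le hθ0) hangle
  have h4 : (1 : ℝ) / 2 ≤ 2 / Real.pi := by
    rw [div_le_div_iff₀ two_pos hπ]; linarith [Real.pi_le_four]
  have h5 : 1 / 2 * ((2 * (r : ℝ) + 1) * u) ≤ Real.sin ((2 * r + 1) * θ) :=
    le_trans (by gcongr) h3
  calc (2 * (r : ℝ) + 1) ^ 2 * G.card / (4 * M) = (1 / 2 * ((2 * (r : ℝ) + 1) * u)) ^ 2 := by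
        rw [mul_pow, mul_pow, huu]; field_simp; norm_num
    _ ≤ _ := by gcongr

end Grover

/-! ### Moments of the number of equal pairs of a random function. -/

section Moments

variable {X : Type*} [Fintype X] [DecidableEq X] {N : ℕ} [NeZero N]

/-- Resampling one coordinate keeps the distribution uniform: exchanging the old and the new value
is an involution. -/
theorem sum_sum_update (x : X) (F : (X → Fin N) → ℝ) :
    ∑ D, ∑ y, F (Function.update D x y) = N * ∑ D, F D := by
  have h : ∑ D, ∑ y, F (Function.update D x y) = ∑ D : X → Fin N, ∑ _y : Fin N, F D := by
    rw [← Fintype.sum_prod_type' (f := fun D y => F (Function.update D x y)),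
      ← Fintype.sum_prod_type' (f := fun D _ => F D)]
    refine Fintype.sum_bijective (fun p : (X → Fin N) × Fin N => (Function.update p.1 x p.2, p.1 x))
      (Function.Involutive.bijective fun p => ?_) _ _ fun p => rfl
    simp
  rw [h, Finset.mul_sum]
  simp

/-- The event that the values at `a` and `b` agree is independent of events which do not depend
on the value at `b`. -/
theorem card_mul_sum_ite_eq {a b : X} (hab : a ≠ b) (P : (X → Fin N) → Prop) [DecidablePred P]
    (hP : ∀ D y, P (Function.update D b y) ↔ P D) :
    (N : ℝ) * ∑ D : X → Fin N, (if P D ∧ D a = D b then (1 : ℝ) else 0) =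
      ∑ D, if P D then (1 : ℝ) else 0 := by
  rw [← sum_sum_update b]
  refine Finset.sum_congr rfl fun D _ => ?_
  simp only [hP, Function.update_self, Function.update_of_ne hab]
  by_cases h : P D <;> simp [h]

theorem sum_ite_eq_pair {a b : X} (hab : a ≠ b) :
    ∑ D : X → Fin N, (if D a = D b then (1 : ℝ) else 0) = N ^ Fintype.card X / N := by
  have hN : (N : ℝ) ≠ 0 := by exact_mod_cast NeZero.ne N
  have := card_mul_sum_ite_eq (N := N) hab (fun _ => True) (by simp)
  simp only [true_and, if_true] at this
  rw [eq_div_iff hN, mul_comm, this]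
  simp

/-- Different unordered pairs may share an index, but `f` has an endpoint outside `e`, and the value
there is fresh. So the two events are independent. -/
theorem sum_ite_eq_two_pairs {e f : X × X} (he : e.1 ≠ e.2) (hf : f.1 ≠ f.2) (hef : f ≠ e)
    (hef' : f ≠ e.swap) :
    ∑ D : X → Fin N, (if D e.1 = D e.2 ∧ D f.1 = D f.2 then (1 : ℝ) else 0) =
      N ^ Fintype.card X / N ^ 2 := by
  have hN : (N : ℝ) ≠ 0 := by exact_mod_cast NeZero.ne N
  have key : ∀ {a b : X}, a ≠ b → b ≠ e.1 → b ≠ e.2 →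
      ∑ D : X → Fin N, (if D e.1 = D e.2 ∧ D a = D b then (1 : ℝ) else 0) =
      N ^ Fintype.card X / N ^ 2 := by
    intro a b hab h1 h2
    have := card_mul_sum_ite_eq (N := N) hab (fun D => D e.1 = D e.2)
      (fun D y => by rw [Function.update_of_ne h1.symm, Function.update_of_ne h2.symm])
    rw [sum_ite_eq_pair he] at this
    rw [eq_div_iff (pow_ne_zero 2 hN), mul_comm, pow_two, mul_assoc, this]
    field_simp
  by_cases h1 : f.2 ≠ e.1 ∧ f.2 ≠ e.2
  · exact key hf h1.1 h1.2
  · by_cases h2 : f.1 ≠ e.1 ∧ f.1 ≠ e.2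
    · rw [← key hf.symm h2.1 h2.2]
      exact Finset.sum_congr rfl fun D _ => if_congr (and_congr_right fun _ => eq_comm) rfl rfl
    · exfalso
      simp only [ne_eq, Prod.ext_iff, Prod.fst_swap, Prod.snd_swap] at *
      grind

/-- The number of pairs in `E` with equal values. -/
def equalPairs (E : Finset (X × X)) (D : X → Fin N) : ℝ :=
  ∑ e ∈ E, if D e.1 = D e.2 then (1 : ℝ) else 0

theorem sum_equalPairs {E : Finset (X × X)} (hE : ∀ e ∈ E, e.1 ≠ e.2) :
    ∑ D : X → Fin N, equalPairs E D = E.card / N * (N : ℝ) ^ Fintype.card X := by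
  unfold equalPairs
  rw [Finset.sum_comm, Finset.sum_congr rfl fun e he => sum_ite_eq_pair (hE e he)]
  rw [Finset.sum_const, nsmul_eq_mul]
  ring

/-- Pairwise independence gives the square of the mean. The factor `2` in the other term arises
because `E` may contain a pair in both orders, and these define the same event. -/
theorem sum_equalPairs_sq_le {E : Finset (X × X)} (hE : ∀ e ∈ E, e.1 ≠ e.2) :
    ∑ D : X → Fin N, equalPairs E D ^ 2 ≤
      (2 * (E.card / N) + (E.card / N : ℝ) ^ 2) * (N : ℝ) ^ Fintype.card X := by
  have hN : (0 : ℝ) < N := by exact_mod_cast Nat.pos_of_ne_zero (NeZero.ne N)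
  have h1 : ∀ D : X → Fin N, equalPairs E D ^ 2 = ∑ e ∈ E, ∑ f ∈ E,
      if D e.1 = D e.2 ∧ D f.1 = D f.2 then (1 : ℝ) else 0 := by
    intro D
    unfold equalPairs
    rw [pow_two, Finset.sum_mul_sum]
    refine Finset.sum_congr rfl fun e _ => Finset.sum_congr rfl fun f _ => ?_
    by_cases h : D e.1 = D e.2 <;> simp [h]
  simp_rw [h1]
  rw [Finset.sum_comm]
  set T : ℝ := (N : ℝ) ^ Fintype.card X with hT
  have h2 : ∀ e ∈ E, ∑ D : X → Fin N, ∑ f ∈ E,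
      (if D e.1 = D e.2 ∧ D f.1 = D f.2 then (1 : ℝ) else 0) ≤
      E.card * (T / N ^ 2) + 2 * (T / N) := by
    intro e he
    rw [Finset.sum_comm]
    have h3 : ∀ f ∈ E, ∑ D : X → Fin N,
        (if D e.1 = D e.2 ∧ D f.1 = D f.2 then (1 : ℝ) else 0) ≤
        T / N ^ 2 + ((if f = e then T / N else 0) + if f = e.swap then T / N else 0) := by
      intro f hf
      have hle : ∑ D : X → Fin N,
          (if D e.1 = D e.2 ∧ D f.1 = D f.2 then (1 : ℝ) else 0) ≤ T / N := by
        rw [hT, ← sum_ite_eq_pair (hE e he)]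
        refine Finset.sum_le_sum fun D _ => ?_
        split_ifs with h4 h5
        · exact le_rfl
        · exact absurd h4.1 h5
        · exact zero_le_one
        · exact le_rfl
      have h4 : 0 ≤ T / (N : ℝ) ^ 2 := by positivity
      have h5 : 0 ≤ T / (N : ℝ) := by positivity
      by_cases hfe : f = e
      · rw [if_pos hfe]; split_ifs <;> linarith
      · by_cases hfe' : f = e.swap
        · rw [if_pos hfe']; split_ifs; linarith
        · rw [sum_ite_eq_two_pairs (hE e he) (hE f hf) hfe hfe', if_neg hfe, if_neg hfe']
          simp [hT]
    refine (Finset.sum_le_sum h3).trans ?_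
    rw [Finset.sum_add_distrib, Finset.sum_add_distrib, Finset.sum_const, nsmul_eq_mul,
      Finset.sum_ite_eq', Finset.sum_ite_eq']
    have h5 : 0 ≤ T / (N : ℝ) := by positivity
    split_ifs <;> linarith
  refine (Finset.sum_le_sum h2).trans (le_of_eq ?_)
  rw [Finset.sum_const, nsmul_eq_mul]
  field_simp
  ring

theorem equalPairs_nonneg (E : Finset (X × X)) (D : X → Fin N) : 0 ≤ equalPairs E D :=
  Finset.sum_nonneg fun e _ => by split_ifs <;> norm_num

/-- The second moment method for pairs of equal values. -/
theorem sum_exists_equal_ge {E : Finset (X × X)} (hE : ∀ e ∈ E, e.1 ≠ e.2) :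
    (E.card / N : ℝ) / (2 + E.card / N) * (N : ℝ) ^ Fintype.card X ≤
      ∑ D : X → Fin N, if ∃ e ∈ E, D e.1 = D e.2 then (1 : ℝ) else 0 := by
  have hN : (0 : ℝ) < N := by exact_mod_cast Nat.pos_of_ne_zero (NeZero.ne N)
  set T : ℝ := (N : ℝ) ^ Fintype.card X with hT
  have hT0 : 0 < T := by positivity
  set ν : ℝ := E.card / N with hν
  have hν0 : 0 ≤ ν := by positivity
  set I : (X → Fin N) → ℝ := fun D => if ∃ e ∈ E, D e.1 = D e.2 then (1 : ℝ) else 0 with hI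
  -- Cauchy–Schwarz for the indicator `I` of a nonzero count, so that multiplying the count by `I`
  -- does not change it.
  have h1 := Finset.sum_mul_sq_le_sq_mul_sq Finset.univ I (fun D : X → Fin N => equalPairs E D)
  have h2 : ∀ D, I D * equalPairs E D = equalPairs E D := by
    intro D
    by_cases h : ∃ e ∈ E, D e.1 = D e.2
    · rw [show I D = 1 from if_pos h, one_mul]
    · rw [equalPairs, Finset.sum_eq_zero, mul_zero]
      intro e he
      exact if_neg fun h' => h ⟨e, he, h'⟩
  have h3 : ∀ D, I D ^ 2 = I D := fun D => by simp only [hI]; split_ifs <;> simp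
  simp_rw [h2, h3] at h1
  rw [sum_equalPairs hE] at h1
  have h4 := sum_equalPairs_sq_le (N := N) hE
  have hI0 : 0 ≤ ∑ D, I D := Finset.sum_nonneg fun D _ => by simp only [hI]; split_ifs <;> norm_num
  have h5 : (ν * T) ^ 2 ≤ (∑ D, I D) * ((2 * ν + ν ^ 2) * T) :=
    h1.trans (mul_le_mul_of_nonneg_left h4 hI0)
  rcases hν0.eq_or_lt with h0 | h0
  · rw [← h0]; simpa using hI0
  · rw [div_mul_eq_mul_div, div_le_iff₀ (by positivity)]
    have h6 : ν * T * (ν * T) ≤ ((∑ D, I D) * (2 + ν)) * (ν * T) := by nlinarith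
    exact le_of_mul_le_mul_right h6 (by positivity)

end Moments

/-! ### Success probabilities of sampling and of Grover search. -/

section LowerBound

variable {M N c q : ℕ} [NeZero M] [NeZero N]

/-- The pairs of different indices in `S` and `T`. -/
def pairsBetween (S T : Finset (Fin M)) : Finset (Fin M × Fin M) :=
  (S ×ˢ T).filter fun e => e.1 ≠ e.2

theorem ne_of_mem_pairsBetween {S T : Finset (Fin M)} :
    ∀ e ∈ pairsBetween S T, e.1 ≠ e.2 := fun _ he => (Finset.mem_filter.1 he).2

theorem card_pairsBetween_le (S T : Finset (Fin M)) :
    (pairsBetween S T).card ≤ S.card * T.card :=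
  (Finset.card_filter_le _ _).trans_eq (Finset.card_product S T)

theorem le_card_pairsBetween_singleton (S : Finset (Fin M)) (x : Fin M) :
    S.card - 1 ≤ (pairsBetween S {x}).card := by
  refine (Finset.pred_card_le_card_erase (a := x)).trans ?_
  refine Finset.card_le_card_of_injOn (s := S.erase x) (fun j => (j, x)) ?_ ?_
  · intro j hj
    have := Finset.mem_erase.1 (Finset.mem_coe.1 hj)
    simp [pairsBetween, this.1, this.2]
  · intro j _ j' _ h
    exact congrArg Prod.fst h

theorem exists_mem_pairsBetween_singleton {S : Finset (Fin M)} {x : Fin M} {D : Fin M → Fin N} :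
    (∃ e ∈ pairsBetween S {x}, D e.1 = D e.2) ↔ ∃ j ∈ S, IsCollision D (j, x) := by
  simp only [pairsBetween, Finset.mem_filter, Finset.mem_product, Finset.mem_singleton, IsCollision,
    Prod.exists]
  constructor
  · rintro ⟨j, y, ⟨⟨hj, rfl⟩, hne⟩, h⟩
    exact ⟨j, hj, hne, h⟩
  · rintro ⟨j, hj, hne, h⟩
    exact ⟨j, x, ⟨⟨hj, rfl⟩, hne⟩, h⟩

theorem card_collidingWith (D : Fin M → Fin N) (ξ : ℕ → Fin M) (k : ℕ) :
    ((collidingWith D ξ k).card : ℝ) = ∑ x,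
      if ∃ e ∈ pairsBetween ((Finset.range k).image ξ) {x}, D e.1 = D e.2 then (1 : ℝ) else 0 := by
  rw [Finset.sum_boole, collidingWith]
  congr 2
  ext x
  rw [Finset.mem_filter, Finset.mem_filter, exists_mem_pairsBetween_singleton]
  simp

theorem card_collidingWith_le (D : Fin M → Fin N) (ξ : ℕ → Fin M) (k : ℕ) :
    ((collidingWith D ξ k).card : ℝ) ≤
      equalPairs (pairsBetween ((Finset.range k).image ξ) Finset.univ) D := by
  unfold equalPairs
  rw [Finset.sum_boole, Nat.cast_le]
  refine le_trans (Finset.card_le_card (t := Finset.image Prod.snd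
    ((pairsBetween ((Finset.range k).image ξ) Finset.univ).filter fun e => D e.1 = D e.2)) ?_)
    Finset.card_image_le
  intro x hx
  obtain ⟨j, hj, hjx⟩ := (Finset.mem_filter.1 hx).2
  refine Finset.mem_image.2 ⟨(ξ j, x), ?_, rfl⟩
  simp only [pairsBetween, Finset.mem_filter, Finset.mem_product, Finset.mem_univ, and_true]
  exact ⟨⟨Finset.mem_image_of_mem _ (Finset.mem_range.2 hj), hjx.1⟩, hjx.2⟩

/-- Grover's gain holds only for few marked indices, so their random number has to be truncated. The
truncation loss is controlled by the second moment of the number of equal pairs, which dominates the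
number of marked indices and is easy to compute. -/
theorem sum_groverSuccess_ge (ξ : ℕ → Fin M) (k r : ℕ) {m : ℕ}
    (hm : ((Finset.range k).image ξ).card = m) (hm2 : 2 ≤ m)
    (hM : 64 * (2 * r + 1) ^ 2 ≤ M) (hN : 64 * m * (2 * r + 1) ^ 2 ≤ N) :
    (2 * (r : ℝ) + 1) ^ 2 * m / (64 * N) * (N : ℝ) ^ M ≤
      ∑ D : Fin M → Fin N, ∑ x ∈ collidingWith D ξ k,
        ‖((groverIteration (collidingWith D ξ k))^[r] (uniformState M)) x‖ ^ 2 := by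
  have hM0 : (0 : ℝ) < M := by exact_mod_cast Nat.pos_of_ne_zero (NeZero.ne M)
  have hN0 : (0 : ℝ) < N := by exact_mod_cast Nat.pos_of_ne_zero (NeZero.ne N)
  set S := (Finset.range k).image ξ with hS
  set E := pairsBetween S Finset.univ with hE
  set L : ℝ := (2 * (r : ℝ) + 1) ^ 2 with hL
  set T : ℝ := (N : ℝ) ^ M with hT
  have hL1 : 1 ≤ L := one_le_pow₀ (by linarith [(Nat.cast_nonneg r : (0 : ℝ) ≤ r)])
  have hLM : 64 * L ≤ M := by rw [hL]; exact_mod_cast hM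
  have hLN : 64 * m * L ≤ N := by rw [hL]; exact_mod_cast hN
  have hm2' : (2 : ℝ) ≤ m := by exact_mod_cast hm2
  set μ : ℝ := m * M / N with hμ
  have hμ0 : 0 < μ := by positivity
  -- Small enough for `L * g₀ ≤ M`, so that up to `g₀` marked indices are allowed; large enough for
  -- the loss `(2 μ + μ²) / g₀` to be at most `μ / 12`, half of the first moment bound `μ / 6`.
  set g₀ : ℝ := 24 * (1 + μ) with hg₀
  have hg₀0 : 0 < g₀ := by positivity
  have hLg₀ : L * g₀ ≤ M := by
    have h1 : 64 * L * μ ≤ M := by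
      rw [hμ, mul_div_assoc', div_le_iff₀ hN0]
      nlinarith
    rw [hg₀]; nlinarith
  -- Above `g₀` marked indices the left side is nonpositive, so nothing has to be known about Grover
  -- search there.
  have hpoint : ∀ D : Fin M → Fin N, L / (4 * M) *
      ((collidingWith D ξ k).card - equalPairs E D ^ 2 / g₀) ≤
      ∑ x ∈ collidingWith D ξ k,
        ‖((groverIteration (collidingWith D ξ k))^[r] (uniformState M)) x‖ ^ 2 := by
    intro D
    have hXg := card_collidingWith_le D ξ k
    rcases le_or_gt ((collidingWith D ξ k).card : ℝ) g₀ with h | h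
    · refine le_trans ?_ (sum_iterate_groverIteration_ge (collidingWith D ξ k) r
        (le_trans (by gcongr) hLg₀))
      rw [mul_div_right_comm, ← hL]
      gcongr
      have : 0 ≤ equalPairs E D ^ 2 / g₀ := by positivity
      linarith
    · refine le_trans (mul_nonpos_of_nonneg_of_nonpos (by positivity) ?_)
        (Finset.sum_nonneg fun x _ => by positivity)
      rw [sub_nonpos, le_div_iff₀ hg₀0]
      have h0 : (0 : ℝ) ≤ (collidingWith D ξ k).card := by positivity
      calc ((collidingWith D ξ k).card : ℝ) * g₀ ≤ (collidingWith D ξ k).card *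
            (collidingWith D ξ k).card := by gcongr
        _ ≤ equalPairs E D * equalPairs E D := mul_le_mul hXg hXg h0 (equalPairs_nonneg E D)
        _ = _ := (pow_two _).symm
  have hfirst : μ / 6 * T ≤ ∑ D : Fin M → Fin N, ((collidingWith D ξ k).card : ℝ) := by
    simp_rw [card_collidingWith]
    rw [Finset.sum_comm]
    have h1 : ∀ x ∈ (Finset.univ : Finset (Fin M)), (m / (6 * N) : ℝ) * T ≤
        ∑ D : Fin M → Fin N, if ∃ e ∈ pairsBetween S {x}, D e.1 = D e.2 then (1 : ℝ) else 0 := by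
      intro x _
      refine le_trans ?_ (sum_exists_equal_ge ne_of_mem_pairsBetween)
      rw [Fintype.card_fin]
      refine mul_le_mul_of_nonneg_right ?_ (by positivity)
      set ν : ℝ := (pairsBetween S {x}).card / N with hν
      have hlow : (m : ℝ) / (2 * N) ≤ ν := by
        have h2 := le_card_pairsBetween_singleton S x
        have h3 : (m : ℝ) ≤ 2 * (pairsBetween S {x}).card := by
          exact_mod_cast (by omega : m ≤ 2 * (pairsBetween S {x}).card)
        rw [hν, div_le_div_iff₀ (by positivity) hN0]
        nlinarith
      have hν0 : 0 ≤ ν := by positivity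
      have hup : ν ≤ 1 := by
        have h2 := card_pairsBetween_le S {x}
        rw [Finset.card_singleton, mul_one, hm] at h2
        have h3 : ((pairsBetween S {x}).card : ℝ) ≤ m := by exact_mod_cast h2
        rw [hν, div_le_one hN0]
        nlinarith
      calc (m : ℝ) / (6 * N) = m / (2 * N) / 3 := by field_simp; norm_num
        _ ≤ ν / 3 := by gcongr
        _ ≤ ν / (2 + ν) := by gcongr; linarith
    refine le_trans (le_of_eq ?_) (Finset.sum_le_sum h1)
    rw [Finset.sum_const, Finset.card_univ, Fintype.card_fin, nsmul_eq_mul, hμ]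
    field_simp
  have hsecond : ∑ D : Fin M → Fin N, equalPairs E D ^ 2 ≤ (2 * μ + μ ^ 2) * T := by
    refine (sum_equalPairs_sq_le ne_of_mem_pairsBetween).trans ?_
    rw [Fintype.card_fin]
    have h1 : ((E.card : ℝ) / N) ≤ μ := by
      have h2 := card_pairsBetween_le S Finset.univ
      rw [hm, Finset.card_univ, Fintype.card_fin] at h2
      rw [hμ]
      gcongr
      exact_mod_cast h2
    gcongr
  refine le_trans ?_ (Finset.sum_le_sum fun D _ => hpoint D)
  rw [← Finset.mul_sum, Finset.sum_sub_distrib, ← Finset.sum_div]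
  have hsecond' : (∑ D : Fin M → Fin N, equalPairs E D ^ 2) / g₀ ≤ μ / 12 * T := by
    rw [div_le_iff₀ hg₀0]
    refine hsecond.trans ?_
    rw [hg₀]
    have : 0 ≤ μ ^ 2 * T := by positivity
    nlinarith
  calc L * m / (64 * N) * T ≤ L * m / (48 * N) * T := by gcongr; norm_num
    _ = L / (4 * M) * (μ / 12 * T) := by rw [hμ]; field_simp; ring
    _ ≤ _ := by gcongr; linarith

/-- The indices in cyclic order. -/
def cyclicIndex (M : ℕ) [NeZero M] (i : ℕ) : Fin M := Fin.ofNat M i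

theorem cyclicIndex_ne {i j : ℕ} (hij : i < j) (hj : j < M) : cyclicIndex M i ≠ cyclicIndex M j := by
  intro h
  have := congrArg Fin.val h
  simp only [cyclicIndex, Fin.val_ofNat] at this
  rw [Nat.mod_eq_of_lt hj, Nat.mod_eq_of_lt (hij.trans hj)] at this
  omega

theorem card_image_cyclicIndex (k : ℕ) :
    ((Finset.range k).image (cyclicIndex M)).card = min k M := by
  apply le_antisymm
  · refine le_min (Finset.card_image_le.trans_eq (Finset.card_range k)) ?_
    exact (Finset.card_le_univ _).trans_eq (Fintype.card_fin M)
  · refine le_trans (le_of_eq ?_) (Finset.card_le_card (Finset.image_subset_image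
      (Finset.range_subset_range.2 (min_le_left k M))))
    rw [Finset.card_image_of_injOn, Finset.card_range]
    intro i hi j hj h
    have hi : i < min k M := by simpa using hi
    have hj : j < min k M := by simpa using hj
    rcases lt_trichotomy i j with h1 | h1 | h1
    · exact absurd h (cyclicIndex_ne h1 (by omega))
    · exact h1
    · exact absurd h.symm (cyclicIndex_ne h1 (by omega))

theorem exists_groverAlgorithm_successProb_ge (M N c q r : ℕ) [NeZero M] [NeZero N]
    (hr : 2 * r + 1 ≤ q - q / 2) (hm2 : 2 ≤ min (c + q / 2) M)
    (hM : 64 * (2 * r + 1) ^ 2 ≤ M) (hN : 64 * min (c + q / 2) M * (2 * r + 1) ^ 2 ≤ N) :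
    ∃ (s : ℕ) (A : HybridAlgorithm M N s c q), A.SamplesThenGrover ∧
      (2 * (r : ℝ) + 1) ^ 2 * min (c + q / 2) M / (64 * N) ≤ A.successProb := by
  have hN0 : (0 : ℝ) < N := by exact_mod_cast Nat.pos_of_ne_zero (NeZero.ne N)
  obtain ⟨s, A, hA, hs⟩ := exists_groverAlgorithm (N := N) c q (r := r) (by omega) (cyclicIndex M)
    (fun i j hij _ hj => cyclicIndex_ne hij hj)
  refine ⟨s, A, hA, ?_⟩
  unfold HybridAlgorithm.successProb
  simp_rw [hs]
  rw [le_div_iff₀ (by positivity)]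
  have := sum_groverSuccess_ge (N := N) (cyclicIndex M) (c + q / 2) r
    (card_image_cyclicIndex (c + q / 2)) hm2 hM hN
  push_cast at this ⊢
  exact this

theorem exists_samplingAlgorithm_successProb_ge (M N c q : ℕ) [NeZero M] [NeZero N]
    (hM : 2 ≤ M) :
    ∃ (s : ℕ) (A : HybridAlgorithm M N s c q), A.SamplesThenGrover ∧
      1 / (N : ℝ) ≤ A.successProb ∧ (2 ≤ min (c + q / 2) M →
        1 / 6 * min 1 (((min (c + q / 2) M : ℕ) : ℝ) ^ 2 / N) ≤ A.successProb) := by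
  classical
  have hN0 : (0 : ℝ) < N := by exact_mod_cast Nat.pos_of_ne_zero (NeZero.ne N)
  set k := c + q / 2 with hk
  set m := min k M with hmdef
  -- If the samples show no collision, the fixed pair of indices `0, 1` is guessed. This gives `1 /
  -- N` even without queries, and the indices differ since `2 ≤ M`.
  let out : (Fin k → Fin N) → Fin M × Fin M := fun v =>
    if h : ∃ p : Fin k × Fin k, cyclicIndex M p.1 ≠ cyclicIndex M p.2 ∧ v p.1 = v p.2 then
      (cyclicIndex M h.choose.1, cyclicIndex M h.choose.2) else (cyclicIndex M 0, cyclicIndex M 1)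
  obtain ⟨s, A, hA, hs⟩ := exists_samplingAlgorithm (N := N) c q (cyclicIndex M)
    (fun i j hij _ hj => cyclicIndex_ne hij hj) out
  have hout : ∀ D : Fin M → Fin N, ∀ S : Prop, (S → ∃ p : Fin k × Fin k,
      IsCollision D (cyclicIndex M p.1, cyclicIndex M p.2)) → S →
      IsCollision D (out fun j => D (cyclicIndex M j)) := by
    intro D S h hS
    have h1 := h hS
    simp only [out]
    rw [dif_pos h1]
    exact h1.choose_spec
  refine ⟨s, A, hA, ?_, fun hm2 => ?_⟩
  · unfold HybridAlgorithm.successProb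
    simp_rw [hs]
    rw [le_div_iff₀ (by positivity)]
    have h01 : cyclicIndex M 0 ≠ cyclicIndex M 1 := cyclicIndex_ne one_pos (by omega)
    have h1 := sum_ite_eq_pair (N := N) h01
    rw [Fintype.card_fin] at h1
    rw [one_div_mul_eq_div, ← h1]
    refine Finset.sum_le_sum fun D _ => ?_
    by_cases hc : ∃ p : Fin k × Fin k, IsCollision D (cyclicIndex M p.1, cyclicIndex M p.2)
    · rw [if_pos (hout D _ id hc)]
      split_ifs <;> norm_num
    · have h2 : out (fun j => D (cyclicIndex M j)) = (cyclicIndex M 0, cyclicIndex M 1) := dif_neg hc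
      rw [h2]
      by_cases hD : D (cyclicIndex M 0) = D (cyclicIndex M 1) <;> simp [IsCollision, hD, h01]
  · unfold HybridAlgorithm.successProb
    simp_rw [hs]
    rw [le_div_iff₀ (by positivity)]
    set S := (Finset.range k).image (cyclicIndex M) with hS
    have hScard : S.card = m := card_image_cyclicIndex k
    have h1 := sum_exists_equal_ge (N := N) (E := pairsBetween S S) ne_of_mem_pairsBetween
    rw [Fintype.card_fin] at h1
    refine le_trans ?_ (h1.trans (Finset.sum_le_sum fun D _ => ?_))
    · gcongr
      have hcard : m * (m - 1) ≤ (pairsBetween S S).card := by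
        have h2 : pairsBetween S S = S.offDiag := by
          ext e; simp [pairsBetween, and_assoc]
        rw [h2, Finset.offDiag_card, hScard, Nat.mul_sub_one]
      have hcard' : (m : ℝ) ^ 2 / 2 ≤ (pairsBetween S S).card := by
        have h2 : (m : ℝ) * (m - 1) ≤ (pairsBetween S S).card := by
          have : ((m - 1 : ℕ) : ℝ) = m - 1 := by rw [Nat.cast_sub (by omega)]; simp
          rw [← this]; exact_mod_cast hcard
        have h3 : (2 : ℝ) ≤ m := by exact_mod_cast hm2
        nlinarith
      set ν : ℝ := (pairsBetween S S).card / N with hν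
      have hν0 : 0 ≤ ν := by positivity
      have hlow : (m : ℝ) ^ 2 / N ≤ 2 * ν := by
        rw [hν, mul_div_assoc', div_le_div_iff_of_pos_right hN0]
        linarith
      rw [le_div_iff₀ (by positivity)]
      rcases le_total ν 1 with h | h
      · calc 1 / 6 * min 1 ((m : ℝ) ^ 2 / N) * (2 + ν) ≤ 1 / 6 * (2 * ν) * (2 + 1) := by
              gcongr; exact (min_le_right _ _).trans hlow
          _ = ν := by ring
      · calc 1 / 6 * min 1 ((m : ℝ) ^ 2 / N) * (2 + ν) ≤ 1 / 6 * 1 * (2 + ν) := by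
              gcongr; exact min_le_left _ _
          _ ≤ ν := by linarith
    · by_cases hc : ∃ e ∈ pairsBetween S S, D e.1 = D e.2
      · rw [if_pos hc, if_pos (hout D _ (fun h => ?_) hc)]
        obtain ⟨⟨a, b⟩, hab, hD⟩ := h
        simp only [pairsBetween, Finset.mem_filter, Finset.mem_product, hS, Finset.mem_image,
          Finset.mem_range] at hab
        obtain ⟨⟨⟨i, hi, rfl⟩, ⟨j, hj, rfl⟩⟩, hne⟩ := hab
        exact ⟨(⟨i, hi⟩, ⟨j, hj⟩), hne, hD⟩
      · rw [if_neg hc]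
        split_ifs <;> norm_num

end LowerBound

/-! ### Choice of the algorithm in each range of parameters. -/

/-- There are algorithms which match the upper bound up to a constant. -/
theorem exists_algorithm_successProb_ge (M N c q : ℕ) [NeZero M] [NeZero N] (hM2 : 2 ≤ M)
    (h : (c ≤ M ∧ q ^ 2 ≤ M) ∨ N ^ 2 ≤ M ^ 3) :
    ∃ (s : ℕ) (A : HybridAlgorithm M N s c q), A.SamplesThenGrover ∧
      1 / 1000000 * min 1 (((c : ℝ) ^ 2 + c * q ^ 2 + q ^ 3) / N) ≤ A.successProb := by
  have hN0 : (0 : ℝ) < N := by exact_mod_cast Nat.pos_of_ne_zero (NeZero.ne N)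
  have hM0 : (0 : ℝ) < M := by exact_mod_cast Nat.pos_of_ne_zero (NeZero.ne M)
  have hc0 : (0 : ℝ) ≤ c := Nat.cast_nonneg c
  have hq0 : (0 : ℝ) ≤ q := Nat.cast_nonneg q
  set B : ℝ := (c : ℝ) ^ 2 + c * q ^ 2 + q ^ 3 with hB
  set k := c + q / 2 with hk
  set m := min k M with hm
  have hB0 : 0 ≤ B / N := by positivity
  have hmin1 : min 1 (B / N) ≤ 1 := min_le_left _ _
  have hminB : min 1 (B / N) ≤ B / N := min_le_right _ _
  have hmin0 : 0 ≤ min 1 (B / N) := le_min zero_le_one hB0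
  obtain ⟨s, A, hA, hguess, hsample⟩ := exists_samplingAlgorithm_successProb_ge M N c q hM2
  -- Guessing suffices if the number of queries is bounded.
  have byGuess : B ≤ 100000 → ∃ (s : ℕ) (A : HybridAlgorithm M N s c q), A.SamplesThenGrover ∧
      1 / 1000000 * min 1 (B / N) ≤ A.successProb := by
    intro hBle
    refine ⟨s, A, hA, le_trans ?_ hguess⟩
    have : B / N ≤ 100000 / N := by gcongr
    have h2 : (100000 : ℝ) / N = 100000 * (1 / N) := by ring
    have h3 : (0 : ℝ) < 1 / N := by positivity
    linarith
  -- Sampling suffices if it finds a collision with constant probability.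
  have bySample : 2 ≤ m → (N : ℝ) ≤ 64 ^ 2 * (m : ℝ) ^ 2 → ∃ (s : ℕ)
      (A : HybridAlgorithm M N s c q), A.SamplesThenGrover ∧
      1 / 1000000 * min 1 (B / N) ≤ A.successProb := by
    intro hm2 hNm
    refine ⟨s, A, hA, le_trans ?_ (hsample hm2)⟩
    have : (1 : ℝ) / 64 ^ 2 ≤ min 1 ((m : ℝ) ^ 2 / N) := by
      refine le_min (by norm_num) ?_
      rw [div_le_div_iff₀ (by norm_num) hN0]
      linarith
    linarith
  have hNM : N ^ 2 ≤ M ^ 3 → (N : ℝ) ≤ M ^ 2 := by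
    intro h
    have h1 : N ^ 2 ≤ (M ^ 2) ^ 2 := by
      rw [← pow_mul]
      exact h.trans (Nat.pow_le_pow_right (by omega) (by norm_num))
    exact_mod_cast (Nat.pow_le_pow_iff_left two_ne_zero).1 h1
  -- The case where everything has been sampled.
  by_cases hkM : M < k ∧ N ^ 2 ≤ M ^ 3
  · have hmM : m = M := min_eq_right hkM.1.le
    refine bySample (by omega) ?_
    rw [hmM]
    have := hNM hkM.2
    have : (0 : ℝ) ≤ (M : ℝ) ^ 2 := by positivity
    linarith
  -- In this range `c²` dominates the other two terms, and sampling alone is optimal up to a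
  -- constant.
  by_cases hcq : q ^ 2 ≤ c
  · have hcq' : (q : ℝ) ^ 2 ≤ c := by exact_mod_cast hcq
    have hq3 : (q : ℝ) ^ 3 ≤ c ^ 2 := by
      have h1 : q ^ 3 ≤ c ^ 2 := by
        rcases Nat.eq_zero_or_pos q with rfl | hq
        · simp
        · calc q ^ 3 ≤ q ^ 4 := Nat.pow_le_pow_right hq (by norm_num)
            _ = (q ^ 2) ^ 2 := by ring
            _ ≤ c ^ 2 := Nat.pow_le_pow_left hcq 2
      exact_mod_cast h1
    have hBc : B ≤ 3 * c ^ 2 := by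
      have : (c : ℝ) * q ^ 2 ≤ c * c := by gcongr
      nlinarith
    by_cases hc2 : c < 2
    · apply byGuess
      have : (c : ℝ) ≤ 1 := by exact_mod_cast (by omega : c ≤ 1)
      nlinarith
    have hcM : c ≤ m := by
      refine le_min (by omega) ?_
      rcases h with h | h
      · exact h.1
      · have : ¬ M < k := fun h1 => hkM ⟨h1, h⟩
        omega
    refine ⟨s, A, hA, le_trans ?_ (hsample (by omega))⟩
    have h1 : B / N ≤ 3 * ((m : ℝ) ^ 2 / N) := by
      rw [← mul_div_assoc]
      gcongr
      refine hBc.trans ?_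
      gcongr
    have h2 : min 1 (B / N) ≤ 3 * min 1 ((m : ℝ) ^ 2 / N) := by
      rw [mul_min_of_nonneg _ _ (by norm_num)]
      exact min_le_min (by norm_num) h1
    linarith
  push Not at hcq
  by_cases hq8 : q < 8
  · apply byGuess
    have h1 : c ^ 2 + c * q ^ 2 + q ^ 3 ≤ 100000 := by
      have : q ≤ 7 := by omega
      have : c ≤ 49 := by nlinarith
      calc c ^ 2 + c * q ^ 2 + q ^ 3 ≤ 49 ^ 2 + 49 * 7 ^ 2 + 7 ^ 3 := by gcongr
        _ ≤ _ := by norm_num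
    rw [hB]; exact_mod_cast h1
  push Not at hq8
  have hBk : B ≤ 6 * q ^ 2 * k := by
    have h1 : (c : ℝ) + q ≤ 3 * k := by exact_mod_cast (by omega : c + q ≤ 3 * k)
    have h2 : (c : ℝ) * c ≤ c * q ^ 2 := by
      gcongr; exact_mod_cast hcq.le
    calc B ≤ 2 * q ^ 2 * (c + q) := by nlinarith [pow_nonneg hq0 3]
      _ ≤ 2 * q ^ 2 * (3 * k) := by gcongr
      _ = _ := by ring
  -- Since `8 ≤ q`, this excludes `q ^ 2 ≤ M`, so `N² ≤ M³` holds and `N` is bounded; a guess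
  -- suffices.
  by_cases hM64 : M < 64
  · have hN512 : N ≤ 512 := by
      rcases h with h | h
      · nlinarith [h.2]
      · have h1 : N ^ 2 ≤ 512 ^ 2 := h.trans
          ((Nat.pow_le_pow_left hM64.le 3).trans (by norm_num))
        exact (Nat.pow_le_pow_iff_left two_ne_zero).1 h1
    refine ⟨s, A, hA, le_trans ?_ hguess⟩
    have : (1 : ℝ) / 512 ≤ 1 / N := by
      rw [div_le_div_iff₀ (by norm_num) hN0]
      have : (N : ℝ) ≤ 512 := by exact_mod_cast hN512
      linarith
    linarith
  have hm2 : 2 ≤ m := le_min (by omega) (by omega)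
  have hm2' : (2 : ℝ) ≤ m := by exact_mod_cast hm2
  by_cases hN64 : N < 64 * m
  · refine bySample hm2 ?_
    have : (N : ℝ) ≤ 64 * m := by exact_mod_cast hN64.le
    nlinarith
  push Not at hM64 hN64
  -- The maximal number of iterations.
  have hex : ∃ r, ¬ (64 * (2 * r + 1) ^ 2 ≤ M ∧ 64 * m * (2 * r + 1) ^ 2 ≤ N ∧
      2 * r + 1 ≤ q - q / 2) := ⟨q, fun h => by omega⟩
  obtain ⟨r, hr, hr'⟩ : ∃ r, (64 * (2 * r + 1) ^ 2 ≤ M ∧ 64 * m * (2 * r + 1) ^ 2 ≤ N ∧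
      2 * r + 1 ≤ q - q / 2) ∧ ¬ (64 * (2 * (r + 1) + 1) ^ 2 ≤ M ∧
      64 * m * (2 * (r + 1) + 1) ^ 2 ≤ N ∧ 2 * (r + 1) + 1 ≤ q - q / 2) := by
    classical
    rcases hfind : Nat.find hex with _ | r
    · exfalso
      have := Nat.find_spec hex
      rw [hfind] at this
      exact this ⟨by omega, by omega, by omega⟩
    · refine ⟨r, not_not.1 (Nat.find_min hex (by omega)), ?_⟩
      have := Nat.find_spec hex
      rwa [hfind] at this
  obtain ⟨s', A', hA', hgrover⟩ :=
    exists_groverAlgorithm_successProb_ge M N c q r hr.2.2 hm2 hr.1 hr.2.1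
  refine ⟨s', A', hA', le_trans ?_ hgrover⟩
  set L : ℝ := (2 * (r : ℝ) + 1) ^ 2 with hL
  have hL9 : ((2 * ((r : ℝ) + 1) + 1) ^ 2) ≤ 9 * L := by
    have : (0 : ℝ) ≤ r := Nat.cast_nonneg r
    rw [hL]; nlinarith
  have hkm : (k ≤ M → (k : ℝ) ≤ 2 * m) ∧ (q ^ 2 ≤ M → (k : ℝ) ≤ 2 * m) := by
    refine ⟨fun h1 => ?_, fun h1 => ?_⟩
    · have : m = k := min_eq_left h1
      rw [this]; linarith [(Nat.cast_nonneg k : (0 : ℝ) ≤ k)]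
    · have h2 : q / 2 ≤ M := by nlinarith [Nat.div_le_self q 2]
      have h3 : k ≤ 2 * m := by
        rcases le_total k M with h4 | h4
        · rw [hm, min_eq_left h4]; omega
        · rw [hm, min_eq_right h4]
          rcases h with h | h
          · omega
          · have : ¬ M < k := fun h5 => hkM ⟨h5, h⟩
            omega
      exact_mod_cast h3
  have hkm' : (k : ℝ) ≤ 2 * m := by
    rcases h with h | h
    · exact hkm.2 h.2
    · exact hkm.1 (not_lt.1 fun h1 => hkM ⟨h1, h⟩)
  have hBm : B / N ≤ 12 * (q ^ 2 * m / N) := by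
    rw [← mul_div_assoc]
    gcongr
    calc B ≤ 6 * q ^ 2 * k := hBk
      _ ≤ 6 * q ^ 2 * (2 * m) := by gcongr
      _ = _ := by ring
  -- The constant `1 / 1000000` is below `1 / (12 * 576 * 64)`, the total loss of this comparison.
  have hfin : ∀ z : ℝ, z ≤ 576 * (L * m / N) → 1 / 12 * min 1 (B / N) ≤ z →
      1 / 1000000 * min 1 (B / N) ≤ L * m / (64 * N) := by
    intro z h1 h2
    have : L * m / (64 * N) = 1 / 64 * (L * m / N) := by field_simp
    rw [this]
    linarith
  -- By maximality of `r` one of the three constraints fails for `r + 1`, hence is tight up to the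
  -- factor `9` for `r`.
  have hcases : (M : ℝ) < 64 * (9 * L) ∨ (N : ℝ) < 64 * m * (9 * L) ∨ (q : ℝ) ^ 2 ≤ 36 * L := by
    by_cases h1 : 64 * (2 * (r + 1) + 1) ^ 2 ≤ M
    · by_cases h2 : 64 * m * (2 * (r + 1) + 1) ^ 2 ≤ N
      · right; right
        have h3 : q ≤ 2 * (2 * (r + 1) + 1) := by
          by_contra h4
          exact hr' ⟨h1, h2, by omega⟩
        have h4 : (q : ℝ) ≤ 2 * (2 * ((r : ℝ) + 1) + 1) := by exact_mod_cast h3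
        calc (q : ℝ) ^ 2 ≤ (2 * (2 * ((r : ℝ) + 1) + 1)) ^ 2 := by gcongr
          _ = 4 * (2 * ((r : ℝ) + 1) + 1) ^ 2 := by ring
          _ ≤ _ := by linarith
      · right; left
        have h3 : (N : ℝ) < 64 * m * (2 * ((r : ℝ) + 1) + 1) ^ 2 := by exact_mod_cast not_le.1 h2
        exact h3.trans_le (by gcongr)
    · left
      have h3 : (M : ℝ) < 64 * (2 * ((r : ℝ) + 1) + 1) ^ 2 := by exact_mod_cast not_le.1 h1
      exact h3.trans_le (by gcongr)
  rcases hcases with h1 | h1 | h1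
  · by_cases hqM : q ^ 2 ≤ M
    · refine hfin (q ^ 2 * m / N) ?_ (by linarith)
      rw [← mul_div_assoc]
      refine div_le_div_of_nonneg_right ?_ hN0.le
      have : (q : ℝ) ^ 2 ≤ M := by exact_mod_cast hqM
      calc (q : ℝ) ^ 2 * m ≤ (64 * (9 * L)) * m := by gcongr; linarith
        _ = _ := by ring
    -- The search has reached its full length `√M` and extra queries are wasted. As `√M` is at most
    -- `3 m`, the hypothesis `N² ≤ M³` yields `N ≤ 3 M m`, so the success probability is already
    -- constant.
    · have hN3 : N ^ 2 ≤ M ^ 3 := h.resolve_left fun h2 => hqM h2.2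
      have hkM' : k ≤ M := not_lt.1 fun h2 => hkM ⟨h2, hN3⟩
      have hmk : m = k := min_eq_left hkM'
      have hqk : q ≤ 3 * m := by omega
      have hMm : M ≤ 9 * m ^ 2 := by
        calc M ≤ q ^ 2 := (not_le.1 hqM).le
          _ ≤ (3 * m) ^ 2 := Nat.pow_le_pow_left hqk 2
          _ = _ := by ring
      have hNMm : N ≤ 3 * (M * m) := by
        apply (Nat.pow_le_pow_iff_left two_ne_zero).1
        calc N ^ 2 ≤ M ^ 2 * M := hN3.trans_eq (by ring)
          _ ≤ M ^ 2 * (9 * m ^ 2) := Nat.mul_le_mul_left _ hMm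
          _ = _ := by ring
      have hNMm' : (N : ℝ) ≤ 3 * (M * m) := by exact_mod_cast hNMm
      refine hfin (M * m / N) ?_ ?_
      · rw [← mul_div_assoc]
        refine div_le_div_of_nonneg_right ?_ hN0.le
        calc (M : ℝ) * m ≤ (64 * (9 * L)) * m := by gcongr
          _ = _ := by ring
      · have : (1 : ℝ) / 3 ≤ M * m / N := by
          rw [div_le_div_iff₀ (by norm_num) hN0]; linarith
        linarith
  · refine hfin 1 ?_ (by linarith)
    rw [← mul_div_assoc, le_div_iff₀ hN0]
    linarith
  · refine hfin (q ^ 2 * m / N) ?_ (by linarith)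
    rw [← mul_div_assoc]
    refine div_le_div_of_nonneg_right ?_ hN0.le
    have hL0 : 0 ≤ L := by positivity
    calc (q : ℝ) ^ 2 * m ≤ (36 * L) * m := by gcongr
      _ ≤ (576 * L) * m := by gcongr; linarith
      _ = _ := by ring

end HybridOracle

theorem mainTheorem1 :
    (∃ C : ℝ, 0 < C ∧ ∀ (M N s c q : ℕ) [NeZero M] [NeZero N]
      (A : HybridOracle.HybridAlgorithm M N s c q), 1 ≤ c + q →
        A.successProb ≤ C * (((c : ℝ) ^ 2 + c * q ^ 2 + q ^ 3) / N)) ∧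
    (∃ κ : ℝ, 0 < κ ∧ ∀ (M N c q : ℕ) [NeZero M] [NeZero N], 2 ≤ M →
      ((c ≤ M ∧ q ^ 2 ≤ M) ∨ N ^ 2 ≤ M ^ 3) →
        ∃ (s : ℕ) (A : HybridOracle.HybridAlgorithm M N s c q),
          A.SamplesThenGrover ∧
          κ * min 1 (((c : ℝ) ^ 2 + c * q ^ 2 + q ^ 3) / N) ≤ A.successProb) :=
  ⟨⟨1000, by norm_num, fun _ _ _ _ _ _ _ A h => A.successProb_le h⟩,
    ⟨1 / 1000000, by norm_num, fun M N c q _ _ hM h =>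
      HybridOracle.exists_algorithm_successProb_ge M N c q hM h⟩⟩
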